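/- Let $H=(V,E,w)$ be a weighted undirected hypergraph: $V$ is a finite set of $n\ge 1$ vertices, $E$ is a finite family of nonempty subsets of $V$ (hyperedges) that cover $V$, and $w:E\to[0,\infty)$. Put $\Phi=\sum_{e\in E}|e|^2$. A hyperpath from $u$ to $v$ is a finite nonempty sequence of hyperedges $e_0,\dots,e_l$ with $u\in e_0$, $v\in e_l$ and $e_i\cap e_{i+1}\neq\emptyset$ for all $i<l$; its weight is $\sum_i w(e_i)$. The hypergraph is a simplicial complex if $E$ is a set (no repeated hyperedges) that is closed under taking nonempty subsets; its facets are the inclusion-maximal hyperedges, $m$ denotes the number of facets, and $d$ the maximum dimension $|F|-1$ of a facet $F$. Consider the following algorithms for the single-source shortest hyperpath problem with source $s\in V$ on a unit-cost random access machine (zero-initialised memory; integer arithmetic, indexed memory access, and addition and comparison of weights at unit cost), where the priority queue is a Fibonacci heap and the input consists of the lists of vertices (in increasing order) and the weights of the hyperedges. * Gallo's algorithm: Dijkstra's algorithm on $H$; start with $D[s]=0$, $D[v]=\infty$ for $v\ne s$, and the queue $\{s\}$; whenever a vertex $z$ with minimum $D[z]$ is dequeued, scan all hyperedges $e\ni z$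 and all $v\in e$, and if $D[v]>D[z]+w(e)$, set $D[v]=D[z]+w(e)$ and enqueue or update $v$. * DR-SP: Step 1 computes the underlying graph $G$ of $H$, whose edges are the pairs $\{u,v\}$, $u\neq v$, contained in some hyperedge, with weights $w_G(uv)=\min\{w(e): e\in E,\ \{u,v\}\subseteq e\}$, by a scan of all pairs of vertices in every hyperedge; Step 2 applies Dijkstra's algorithm to $G$. * DR-SP with top-down computation of the edge weights, for simplicial complexes: as DR-SP, except that Step 1 computes $w_G$ on the faces in order of decreasing dimension through $w_G(f)=\min\big(\{w(f)\}\cup\{w_G(f'): f'\supset f,\ \dim f'=\dim f+1\}\big)$. There is an absolute constant $C$ such that the following holds. 1. For every weighted hypergraph $H$ and every source $s$, Gallo's algorithm and DR-SP both halt after at most $C\,(n\log n+\Phi)$ steps. 2. For every weighted hypergraph $H$ that is a simplicial complex on $n\ge 2$ vertices and every source $s$, Gallo's algorithm halts after at most $C\,(n\log n+d^2\,2^d\,m)$ steps, and DR-SP with top-down computation of the edge weights halts after at most $C\,(n\log n+d\,2^d\,m)$ steps. In each case, when the algorithm halts, $D[v]$ is, for every $v\neq s$, the minimum weight of a hyperpath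 from $s$ to $v$ (and $\infty$ if there is none). -/

import Mathlib

open scoped NNReal ENNReal

/-! ## Weighted hypergraphs -/

/-- A weighted undirected hypergraph: the vertices are numbered by `Fin n`, the hyperedges by
`Fin m`; hyperedges are nonempty, they cover the vertex set, and have nonnegative real weights. -/
structure WHypergraph (n m : ℕ) where
  edge : Fin m → Finset (Fin n)
  edge_nonempty : ∀ j, (edge j).Nonempty
  edge_cover : ∀ v, ∃ j, v ∈ edge j
  weight : Fin m → ℝ≥0

namespace WHypergraph

/-- `Φ = ∑ |e|²`. -/
def Phi {n m : ℕ} (H : WHypergraph n m) : ℕ := ∑ j, (H.edge j).card ^ 2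

/-- A hypergraph is a simplicial complex if its hyperedges form a set (no repetition) which is
closed under passing to nonempty subsets. -/
def IsSimplicialComplex {n m : ℕ} (H : WHypergraph n m) : Prop :=
  Function.Injective H.edge ∧ IsRelLowerSet (Set.range H.edge) Finset.Nonempty

open Classical in
/-- The facets: the hyperedges that are maximal under inclusion. -/
noncomputable def facets {n m : ℕ} (H : WHypergraph n m) : Finset (Finset (Fin n)) :=
  Finset.univ.filter fun F => Maximal (fun s => s ∈ Set.range H.edge) F

/-- The maximal dimension of a facet; a set of `k + 1` vertices has dimension `k`. -/
noncomputable def dim {n m : ℕ} (H : WHypergraph n m) : ℕ :=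
  H.facets.sup fun F => F.card - 1

/-- `L` is (the list of indices of) a hyperpath from `u` to `v`. -/
def IsHyperpath {n m : ℕ} (H : WHypergraph n m) (u v : Fin n) (L : List (Fin m)) : Prop :=
  L.IsChain (fun i j => (H.edge i ∩ H.edge j).Nonempty) ∧
    ∃ h : L ≠ [], u ∈ H.edge (L.head h) ∧ v ∈ H.edge (L.getLast h)

/-- The weight of a shortest hyperpath from `u` to `v`, and `∞` if there is no hyperpath. -/
noncomputable def dist {n m : ℕ} (H : WHypergraph n m) (u v : Fin n) : ℝ≥0∞ :=
  ⨅ L : {L : List (Fin m) // H.IsHyperpath u v L}, (L.1.map fun j => (H.weight j : ℝ≥0∞)).sum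

end WHypergraph

/-! ## The machine model

A unit-cost random access machine programmed in a small imperative language. The memory consists of
integer registers, integer arrays with one or two indices, and arrays of weights (nonnegative reals
or `∞`). One assignment, and one evaluation of a test, takes one step. -/

namespace RAM

set_option linter.constructorNameAsVariable false

/-- Names of the integer registers. -/
inductive Reg where
  /- input: number of vertices, number of hyperedges, source -/
  | n | m | src
  /- memory allocation, heap operations -/
  | cell | minv | p | x | y | c | r | top | tmp
  /- main programs -/
  | z | q | e | v | i | j | k | node | last | size
deriving DecidableEq

/-- Names of the integer arrays. -/
inductive Arr where
  /- input: cardinality of a hyperedge, list of its vertices -/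
  | card | vert
  /- linked lists: element and successor of a list cell -/
  | elt | nxt
  /- heap: list of roots, lists of children, parent, number of children, mark, membership, and the
  table of roots indexed by the number of children that is used in consolidation -/
  | roots | chd | par | deg | mark | inQ | slot
  /- hyperedges containing a vertex, neighbours of a vertex, minimum hyperedge on a pair -/
  | inc | adj | best
  /- hyperedges by cardinality, trie of hyperedges, codimension one faces, minimum hyperedge above -/
  | bucket | child | sub | cheap
  /- output: parent of a vertex, hyperedge leading to a vertex -/
  | P | E
deriving DecidableEq

/-- Names of the weight arrays: the weights of the hyperedges, the current distances. -/
inductive WArr where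
  | w | D
deriving DecidableEq

/-- Memory contents. An array with one index is the column `0` of an array with two indices. -/
structure Mem where
  reg : Reg → ℕ
  arr : Arr → ℕ → ℕ → ℕ
  wt : WArr → ℕ → ℝ≥0∞

/-- Integer expressions. -/
inductive Expr where
  | lit (a : ℕ)
  | reg (x : Reg)
  | get (a : Arr) (i j : Expr)
  | add (a b : Expr)
  | sub (a b : Expr)

instance : Coe Reg Expr := ⟨Expr.reg⟩
instance (a : ℕ) : OfNat Expr a := ⟨Expr.lit a⟩
instance : Add Expr := ⟨Expr.add⟩
instance : Sub Expr := ⟨Expr.sub⟩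

/-- Weight expressions. -/
inductive WExpr where
  | zero
  | infty
  | get (a : WArr) (i : Expr)
  | add (a b : WExpr)

/-- Tests. -/
inductive Test where
  | eq (a b : Expr)
  | lt (a b : Expr)
  | wlt (a b : WExpr)
  | and (a b : Test)
  | or (a b : Test)

/-- Programs. -/
inductive Cmd where
  | skip
  | assign (x : Reg) (a : Expr)
  | write (a : Arr) (i j : Expr) (b : Expr)
  | wwrite (a : WArr) (i : Expr) (b : WExpr)
  | seq (c d : Cmd)
  | ite (b : Test) (c d : Cmd)
  | loop (b : Test) (c : Cmd)

def Expr.eval (s : Mem) : Expr → ℕ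
  | .lit a => a
  | .reg x => s.reg x
  | .get a i j => s.arr a (i.eval s) (j.eval s)
  | .add a b => a.eval s + b.eval s
  | .sub a b => a.eval s - b.eval s

noncomputable def WExpr.eval (s : Mem) : WExpr → ℝ≥0∞
  | .zero => 0
  | .infty => ∞
  | .get a i => s.wt a (i.eval s)
  | .add a b => a.eval s + b.eval s

def Test.holds (s : Mem) : Test → Prop
  | .eq a b => a.eval s = b.eval s
  | .lt a b => a.eval s < b.eval s
  | .wlt a b => a.eval s < b.eval s
  | .and a b => a.holds s ∧ b.holds s
  | .or a b => a.holds s ∨ b.holds s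

def Mem.setReg (s : Mem) (x : Reg) (a : ℕ) : Mem :=
  { s with reg := fun y => if y = x then a else s.reg y }

def Mem.setArr (s : Mem) (a : Arr) (i j b : ℕ) : Mem :=
  { s with arr := fun a' i' j' => if a' = a ∧ i' = i ∧ j' = j then b else s.arr a' i' j' }

noncomputable def Mem.setWt (s : Mem) (a : WArr) (i : ℕ) (b : ℝ≥0∞) : Mem :=
  { s with wt := fun a' i' => if a' = a ∧ i' = i then b else s.wt a' i' }

/-- `Exec c s t s'`: started in memory `s`, the program `c` halts after exactly `t` steps, with
memory `s'`. -/
inductive Exec : Cmd → Mem → ℕ → Mem → Prop where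
  | skip (s : Mem) : Exec .skip s 1 s
  | assign (s : Mem) (x : Reg) (a : Expr) :
      Exec (.assign x a) s 1 (s.setReg x (a.eval s))
  | write (s : Mem) (a : Arr) (i j b : Expr) :
      Exec (.write a i j b) s 1 (s.setArr a (i.eval s) (j.eval s) (b.eval s))
  | wwrite (s : Mem) (a : WArr) (i : Expr) (b : WExpr) :
      Exec (.wwrite a i b) s 1 (s.setWt a (i.eval s) (b.eval s))
  | seq {c d : Cmd} {s s' s'' : Mem} {t t' : ℕ} :
      Exec c s t s' → Exec d s' t' s'' → Exec (.seq c d) s (t + t') s''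
  | ite_true {b : Test} {c d : Cmd} {s s' : Mem} {t : ℕ} :
      b.holds s → Exec c s t s' → Exec (.ite b c d) s (1 + t) s'
  | ite_false {b : Test} {c d : Cmd} {s s' : Mem} {t : ℕ} :
      ¬ b.holds s → Exec d s t s' → Exec (.ite b c d) s (1 + t) s'
  | loop_true {b : Test} {c : Cmd} {s s' s'' : Mem} {t t' : ℕ} :
      b.holds s → Exec c s t s' → Exec (.loop b c) s' t' s'' →
        Exec (.loop b c) s (1 + t + t') s''
  | loop_false {b : Test} {c : Cmd} {s : Mem} :
      ¬ b.holds s → Exec (.loop b c) s 1 s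

/-- The machine is deterministic, so the number of steps is well defined. -/
theorem Exec.deterministic {c : Cmd} {s s₁ s₂ : Mem} {t₁ t₂ : ℕ}
    (h₁ : Exec c s t₁ s₁) (h₂ : Exec c s t₂ s₂) : t₁ = t₂ ∧ s₁ = s₂ := by
  induction h₁ generalizing t₂ s₂ with
  | skip | assign | write | wwrite => cases h₂; exact ⟨rfl, rfl⟩
  | seq _ _ ih ih' =>
    cases h₂ with
    | seq g g' =>
      obtain ⟨rfl, rfl⟩ := ih g
      obtain ⟨rfl, rfl⟩ := ih' g'
      exact ⟨rfl, rfl⟩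
  | ite_true hb _ ih =>
    cases h₂ with
    | ite_true _ g => obtain ⟨rfl, rfl⟩ := ih g; exact ⟨rfl, rfl⟩
    | ite_false hb' _ => exact absurd hb hb'
  | ite_false hb _ ih =>
    cases h₂ with
    | ite_true hb' _ => exact absurd hb' hb
    | ite_false _ g => obtain ⟨rfl, rfl⟩ := ih g; exact ⟨rfl, rfl⟩
  | loop_true hb _ _ ih ih' =>
    cases h₂ with
    | loop_true _ g g' =>
      obtain ⟨rfl, rfl⟩ := ih g
      obtain ⟨rfl, rfl⟩ := ih' g'
      exact ⟨rfl, rfl⟩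
    | loop_false hb' => exact absurd hb hb'
  | loop_false hb =>
    cases h₂ with
    | loop_true hb' _ _ => exact absurd hb' hb
    | loop_false _ => exact ⟨rfl, rfl⟩

/-! ### Derived programming constructs -/

open Cmd

/-- Sequential composition of a list of programs. -/
def block : List Cmd → Cmd
  | [] => skip
  | [c] => c
  | c :: d :: l => seq c (block (d :: l))

/-- Entry of an array with one index. -/
def get1 (a : Arr) (i : Expr) : Expr := .get a i 0

/-- Assignment to an entry of an array with one index. -/
def write1 (a : Arr) (i b : Expr) : Cmd := write a i 0 b

/-- `if b then c`. -/
def when (b : Test) (c : Cmd) : Cmd := ite b c skip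

/-- `for i = lo, …, hi - 1 do c`. -/
def forRange (i : Reg) (lo hi : Expr) (c : Cmd) : Cmd :=
  block [assign i lo, loop (.lt i hi) (block [c, assign i (i + 1)])]

/-- Iterate `c` over the cells `p` of a linked list that begins at the cell `h`; the pointer `0`
ends a list. -/
def forCells (p : Reg) (h : Expr) (c : Cmd) : Cmd :=
  block [assign p h, loop (.lt 0 p) (block [c, assign p (get1 .nxt p)])]

/-- Put `b` in front of the linked list whose first cell is stored in `a[i]`. -/
def push (a : Arr) (i b : Expr) : Cmd :=
  block [
    assign .cell (Reg.cell + 1),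
    write1 .elt Reg.cell b,
    write1 .nxt Reg.cell (get1 a i),
    write1 a i Reg.cell]

/-- The element in the list cell `p`. -/
def eltAt (p : Reg) : Expr := get1 .elt p

/-- The weight of the hyperedge `a`. -/
def wOf (a : Expr) : WExpr := .get .w a

/-- The current distance of the vertex `a`. -/
def dOf (a : Expr) : WExpr := .get .D a

/-! ### Fibonacci heap

A priority queue of vertices, with key `D[x]` for the vertex `x`. A child that is cut from its
parent remains in the list of children of the former parent; such stale entries are recognised, by
the `par` array, when that list is read. The queue is nonempty if and only if `minv ≠ 0`, and then
`minv` is an element with minimum key. -/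

/-- Make `x` a root. -/
def makeRoot (x : Reg) : Cmd :=
  block [write1 .par x 0, write1 .mark x 0, push .roots 0 x]

/-- Let `minv` point to `x` if the key of `x` is smaller. -/
def updateMin (x : Reg) : Cmd :=
  when (.or (.eq Reg.minv 0) (.wlt (dOf x) (dOf Reg.minv))) (assign .minv x)

/-- Insert `x`. -/
def enqueue (x : Reg) : Cmd :=
  block [
    write1 .inQ x 1,
    write1 .deg x 0,
    write1 .chd x 0,
    makeRoot x,
    updateMin x]

/-- Restore the heap after a decrease of the key of `x`: cut `x` from its parent if necessary, with
cascading cuts at marked vertices. -/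
def decreaseKey (x : Reg) : Cmd :=
  block [
    assign .y (get1 .par x),
    when (.and (.lt 0 Reg.y) (.wlt (dOf x) (dOf Reg.y))) (block [
      assign .c x,
      loop (.lt 0 Reg.y) (block [
        makeRoot .c,
        write1 .deg Reg.y (get1 .deg Reg.y - 1),
        ite (.eq (get1 .mark Reg.y) 1)
          (block [
            assign .c Reg.y,
            assign .y (get1 .par Reg.y)])
          (block [
            when (.lt 0 (get1 .par Reg.y)) (write1 .mark Reg.y 1),
            assign .y 0])])]),
    updateMin x]

/-- Make the root `y` a child of the root `x`. -/
def link : Cmd :=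
  block [
    write1 .par Reg.y Reg.x,
    write1 .mark Reg.y 0,
    push .chd Reg.x Reg.y,
    write1 .deg Reg.x (get1 .deg Reg.x + 1)]

/-- Link the roots, except the deleted root `z`, until their numbers of children are distinct. -/
def consolidate : Cmd :=
  block [
    assign .top 0,
    assign .p (get1 .roots 0),
    write1 .roots 0 0,
    loop (.lt 0 Reg.p) (block [
      assign .x (eltAt .p),
      assign .p (get1 .nxt Reg.p),
      ite (.eq Reg.x Reg.z) skip (block [
        assign .r (get1 .deg Reg.x),
        loop (.lt 0 (get1 .slot Reg.r)) (block [
          assign .y (get1 .slot Reg.r),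
          write1 .slot Reg.r 0,
          when (.wlt (dOf Reg.y) (dOf Reg.x)) (block [
            assign .tmp Reg.x,
            assign .x Reg.y,
            assign .y Reg.tmp]),
          link,
          assign .r (Reg.r + 1)]),
        write1 .slot Reg.r Reg.x,
        when (.lt Reg.top (Reg.r + 1)) (assign .top (Reg.r + 1))])]),
    assign .minv 0,
    loop (.lt 0 Reg.top) (block [
      assign .top (Reg.top - 1),
      assign .x (get1 .slot Reg.top),
      when (.lt 0 Reg.x) (block [
        write1 .slot Reg.top 0,
        makeRoot .x,
        updateMin .x])])]

/-- Delete an element with minimum key, and return it in `z`. -/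
def dequeue : Cmd :=
  block [
    assign .z Reg.minv,
    write1 .inQ Reg.z 0,
    forCells .p (get1 .chd Reg.z) (block [
      assign .x (eltAt .p),
      when (.eq (get1 .par Reg.x) Reg.z) (makeRoot .x)]),
    write1 .chd Reg.z 0,
    write1 .deg Reg.z 0,
    consolidate]

/-! ### The algorithms -/

/-- `D[v] ← ∞` for all `v`, then `D[src] ← 0` and the source is put into the queue. -/
def initSource : Cmd :=
  block [
    forRange .v 1 (Reg.n + 1) (wwrite .D Reg.v .infty),
    assign .v Reg.src,
    wwrite .D Reg.v .zero,
    enqueue .v]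

/-- `if D[v] > D[z] + w(a)` then `D[v] ← D[z] + w(a)`, `P[v] ← z`, `E[v] ← a`, and enqueue or
update `v`. -/
def relax (a : Expr) : Cmd :=
  when (.wlt (.add (dOf Reg.z) (wOf a)) (dOf Reg.v)) (block [
    wwrite .D Reg.v (.add (dOf Reg.z) (wOf a)),
    write1 .P Reg.v Reg.z,
    write1 .E Reg.v a,
    ite (.eq (get1 .inQ Reg.v) 1) (decreaseKey .v) (enqueue .v)])

/-- Gallo's algorithm (the extension of Dijkstra's algorithm to hypergraphs): whenever a vertex `z`
is dequeued, all hyperedges `e` that contain `z`, and all vertices `v` of `e`, are scanned. The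
lists `inc[v]` of the hyperedges that contain `v` are computed first. -/
def gallo : Cmd :=
  block [
    forRange .e 1 (Reg.m + 1)
      (forRange .k 0 (get1 .card Reg.e)
        (push .inc (.get .vert Reg.e Reg.k) Reg.e)),
    initSource,
    loop (.lt 0 Reg.minv) (block [
      dequeue,
      forCells .q (get1 .inc Reg.z) (block [
        assign .e (eltAt .q),
        forRange .k 0 (get1 .card Reg.e) (block [
          assign .v (.get .vert Reg.e Reg.k),
          relax Reg.e])])])]

/-- Dijkstra's algorithm in the underlying graph `G`, which is given by the lists `adj[z]` of the
neighbours of `z` and by the hyperedges `best[z, v]` that lend their weight to the edges `zv`. -/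
def dijkstra : Cmd :=
  block [
    initSource,
    loop (.lt 0 Reg.minv) (block [
      dequeue,
      forCells .q (get1 .adj Reg.z) (block [
        assign .v (eltAt .q),
        relax (.get .best Reg.z Reg.v)])])]

/-- The underlying graph, computed directly from `w_G(uv) = min {w(e) : e ⊇ uv}` by a scan of all
pairs of vertices in all hyperedges `e`. -/
def underlyingGraph : Cmd :=
  block [
    forRange .e 1 (Reg.m + 1)
      (forRange .i 0 (get1 .card Reg.e)
        (forRange .j 0 (get1 .card Reg.e) (block [
          assign .x (.get .vert Reg.e Reg.i),
          assign .y (.get .vert Reg.e Reg.j),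
          ite (.eq Reg.x Reg.y) skip
            (ite (.eq (.get .best Reg.x Reg.y) 0)
              (block [
                write .best Reg.x Reg.y Reg.e,
                push .adj Reg.x Reg.y])
              (when (.wlt (wOf Reg.e) (wOf (.get .best Reg.x Reg.y)))
                (write .best Reg.x Reg.y Reg.e)))])))]

/-- The underlying graph of a simplicial complex, with top-down computation of the edge weights. -/
def underlyingGraphTopDown : Cmd :=
  block [
    /- sort the faces by cardinality -/
    assign .size 0,
    forRange .e 1 (Reg.m + 1) (block [
      write1 .cheap Reg.e Reg.e,
      push .bucket (get1 .card Reg.e) Reg.e,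
      when (.lt Reg.size (get1 .card Reg.e)) (assign .size (get1 .card Reg.e))]),
    /- bottom-up: `child[f, v]` is the face `f ∪ {v}`, for `v` beyond the vertices of `f` (the
    number `0` stands for the empty set), and `sub[e, i]` is the face `e` without its vertex at
    position `i` -/
    forRange .k 1 (Reg.size + 1)
      (forCells .q (get1 .bucket Reg.k) (block [
        assign .e (eltAt .q),
        assign .node 0,
        forRange .i 0 (Reg.k - 1)
          (assign .node (.get .child Reg.node (.get .vert Reg.e Reg.i))),
        assign .last (.get .vert Reg.e (Reg.k - 1)),
        write .child Reg.node Reg.last Reg.e,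
        write .sub Reg.e (Reg.k - 1) Reg.node,
        forRange .i 0 (Reg.k - 1)
          (write .sub Reg.e Reg.i (.get .child (.get .sub Reg.node Reg.i) Reg.last))])),
    /- top-down: `w_G(f) = min {w(f), w_G(f') : f' ⊃ f, dim f' = dim f + 1}`, where `w_G(f)` is
    stored through the hyperedge `cheap[f]` of that weight -/
    assign .k Reg.size,
    loop (.lt 2 Reg.k) (block [
      forCells .q (get1 .bucket Reg.k) (block [
        assign .e (eltAt .q),
        forRange .i 0 Reg.k (block [
          assign .x (.get .sub Reg.e Reg.i),
          when (.wlt (wOf (get1 .cheap Reg.e)) (wOf (get1 .cheap Reg.x)))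
            (write1 .cheap Reg.x (get1 .cheap Reg.e))])]),
      assign .k (Reg.k - 1)]),
    /- the edges of the underlying graph are the faces of cardinality `2` -/
    forCells .q (get1 .bucket 2) (block [
      assign .e (eltAt .q),
      assign .x (.get .vert Reg.e 0),
      assign .y (.get .vert Reg.e 1),
      write .best Reg.x Reg.y (get1 .cheap Reg.e),
      write .best Reg.y Reg.x (get1 .cheap Reg.e),
      push .adj Reg.x Reg.y,
      push .adj Reg.y Reg.x])]

/-- DR-SP: construct the underlying graph, then apply Dijkstra's algorithm to it. -/
def drsp : Cmd := block [underlyingGraph, dijkstra]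

/-- DR-SP for simplicial complexes, with top-down computation of the edge weights. -/
def drspTopDown : Cmd := block [underlyingGraphTopDown, dijkstra]

/-! ### Input and running time -/

/-- The initial memory for the hypergraph `H` and the source `s`. Vertices are numbered from `1` to
`n` and hyperedges from `1` to `m`; each hyperedge is given by its cardinality, the increasing list
of its vertices (at positions `0, 1, …`), and its weight. All other memory is zero. -/
noncomputable def input {n m : ℕ} (H : WHypergraph n m) (s : Fin n) : Mem where
  reg := fun x => match x with
    | .n => n
    | .m => m
    | .src => s + 1
    | _ => 0
  arr := fun a e k => match a with
    | .card => if h : 1 ≤ e ∧ e - 1 < m ∧ k = 0 then (H.edge ⟨e - 1, h.2.1⟩).card else 0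
    | .vert =>
      if h : 1 ≤ e ∧ e - 1 < m then
        (((H.edge ⟨e - 1, h.2⟩).sort (· ≤ ·)).map fun v => (v : ℕ) + 1).getD k 0
      else 0
    | _ => 0
  wt := fun a e => match a with
    | .w => if h : 1 ≤ e ∧ e - 1 < m then (H.weight ⟨e - 1, h.2⟩ : ℝ≥0∞) else 0
    | .D => 0

/-- On the hypergraph `H` with source `s`, the program `c` halts after at most `T` steps, and then
`D[v]` is the weight of a shortest hyperpath from `s` to `v`, for every vertex `v ≠ s`. -/
def SolvesWithin {n m : ℕ} (c : Cmd) (H : WHypergraph n m) (s : Fin n) (T : ℝ) : Prop :=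
  ∃ (t : ℕ) (s' : Mem), Exec c (input H s) t s' ∧ (t : ℝ) ≤ T ∧
    ∀ v : Fin n, v ≠ s → s'.wt .D (v + 1) = H.dist s v

end RAM

set_option linter.constructorNameAsVariable false

/-! Correctness is linear programming duality. If a labelling `D` of the vertices satisfies `D src =
0` and `D v ≤ D z + w(e)` whenever `z` and `v` lie in a common hyperedge `e`, then adding these
inequalities along a hyperpath shows that `D` is at most the distance (`WHypergraph.le_dist`).
Conversely, a label assigned to a vertex other than the source is never below the distance, since a
relaxation appends a hyperedge to a hyperpath. When the queue is empty the inequalities hold: at an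
infinite `D z` trivially, and otherwise because `z` has been dequeued and scanned. As weights are
nonnegative, a dequeued vertex keeps its label, so what was achieved by its scan is not undone.
`dijkstra_loop_spec` carries this out once, for an arbitrary scanning program. In the underlying
graph one hyperedge of minimum weight over a pair of vertices does the work of all hyperedges over
that pair.

The running time rests on amortised analysis of the Fibonacci heap. The potential counts roots,
marks, and entries of the lists of children, including stale ones. Enqueueing and decreasing a key
cost `O(1)`; deleting the minimum costs `O(log n)`, and happens once per vertex. The logarithm comes
from `Forest.fib_le`. For every vertex and every `j`, at most `j` children have degree plus mark
below `j`, which is an order-free form of the usual statement on the `i`-th child; hence a vertex of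
degree `k` has at least `fib (k + 2)` descendants.

It remains to count scans. Gallo's algorithm reads a hyperedge `e` once for each of its vertices,
which gives `Φ`. DR-SP builds the graph in `O(Φ)` steps, and the adjacency lists cannot have more
entries than steps were spent. The top-down variant treats each face together with its faces of
codimension one, found by a trie, in `O(∑ |e|)` steps; it is correct because between two faces `f ⊂
j` there is always a face with one vertex more than `f`. Finally every face lies in a facet, so
there are at most `2 ^ (d + 1) * m` faces, each with at most `d + 1` vertices (`sum_card_pow_le`).

Programs are verified by a total-correctness calculus `wp` in which the step counter is part of the
postcondition. Syntactic frame rules tell which memory a program leaves alone, and `Alloc` ensures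
that linked lists survive all later allocation. -/

namespace RAM

/-! ### Weakest preconditions with a step counter -/

/-- Started in memory `s` after `t` steps, `c` halts, and the final step count and memory satisfy
`Q`. -/
def wp (c : Cmd) (t : ℕ) (s : Mem) (Q : ℕ → Mem → Prop) : Prop :=
  ∃ t' s', Exec c s t' s' ∧ Q (t + t') s'

theorem wp.mono {c : Cmd} {t : ℕ} {s : Mem} {Q R : ℕ → Mem → Prop} (h : wp c t s Q)
    (hQR : ∀ t' s', Q t' s' → R t' s') : wp c t s R := by
  obtain ⟨t', s', hE, hQ⟩ := h
  exact ⟨t', s', hE, hQR _ _ hQ⟩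

/-- The execution is handed on together with the postcondition, so that the frame rules can be
applied to it. Specifications then only have to describe what a program changes. -/
theorem wp.exec {c : Cmd} {t : ℕ} {s : Mem} {Q R : ℕ → Mem → Prop} (h : wp c t s Q)
    (hQR : ∀ t' s', Exec c s t' s' → Q (t + t') s' → R (t + t') s') : wp c t s R := by
  obtain ⟨t', s', hE, hQ⟩ := h
  exact ⟨t', s', hE, hQR _ _ hE hQ⟩

@[simp] theorem wp_skip {t s Q} : wp .skip t s Q ↔ Q (t + 1) s :=
  ⟨by rintro ⟨_, _, ⟨⟩, h⟩; exact h, fun h => ⟨_, _, .skip s, h⟩⟩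

@[simp] theorem wp_assign {x a t s Q} :
    wp (.assign x a) t s Q ↔ Q (t + 1) (s.setReg x (a.eval s)) :=
  ⟨by rintro ⟨_, _, ⟨⟩, h⟩; exact h, fun h => ⟨_, _, .assign s x a, h⟩⟩

@[simp] theorem wp_write {a i j b t s Q} :
    wp (.write a i j b) t s Q ↔ Q (t + 1) (s.setArr a (i.eval s) (j.eval s) (b.eval s)) :=
  ⟨by rintro ⟨_, _, ⟨⟩, h⟩; exact h, fun h => ⟨_, _, .write s a i j b, h⟩⟩

@[simp] theorem wp_wwrite {a i b t s Q} :
    wp (.wwrite a i b) t s Q ↔ Q (t + 1) (s.setWt a (i.eval s) (b.eval s)) :=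
  ⟨by rintro ⟨_, _, ⟨⟩, h⟩; exact h, fun h => ⟨_, _, .wwrite s a i b, h⟩⟩

@[simp] theorem wp_seq {c d t s Q} :
    wp (.seq c d) t s Q ↔ wp c t s (fun t' s' => wp d t' s' Q) := by
  constructor
  · rintro ⟨_, _, h, hQ⟩
    cases h with
    | seq h h' => exact ⟨_, _, h, _, _, h', by rwa [Nat.add_assoc]⟩
  · rintro ⟨_, _, h, _, _, h', hQ⟩
    exact ⟨_, _, .seq h h', by rwa [← Nat.add_assoc]⟩

@[simp] theorem wp_ite {b c d t s Q} :
    wp (.ite b c d) t s Q ↔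
      (b.holds s → wp c (t + 1) s Q) ∧ (¬ b.holds s → wp d (t + 1) s Q) := by
  constructor
  · rintro ⟨_, _, h, hQ⟩
    cases h with
    | ite_true hb h =>
      exact ⟨fun _ => ⟨_, _, h, by rwa [Nat.add_assoc]⟩, fun hb' => absurd hb hb'⟩
    | ite_false hb h =>
      exact ⟨fun hb' => absurd hb' hb, fun _ => ⟨_, _, h, by rwa [Nat.add_assoc]⟩⟩
  · rintro ⟨h₁, h₂⟩
    by_cases hb : b.holds s
    · obtain ⟨_, _, h, hQ⟩ := h₁ hb
      exact ⟨_, _, .ite_true hb h, by rwa [← Nat.add_assoc]⟩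
    · obtain ⟨_, _, h, hQ⟩ := h₂ hb
      exact ⟨_, _, .ite_false hb h, by rwa [← Nat.add_assoc]⟩

theorem wp_when {b c t s Q} :
    wp (when b c) t s Q ↔ (b.holds s → wp c (t + 1) s Q) ∧ (¬ b.holds s → Q (t + 2) s) := by
  simp [when]

/-- The index `k` of the invariant is a variant, and strong induction on it gives termination. Each
evaluation of the test is one step, whence `t + 1` both on entry to the body and on exit. -/
theorem wp_loop {b : Test} {c : Cmd} {Q : ℕ → Mem → Prop} (I : ℕ → ℕ → Mem → Prop)
    (step : ∀ k t s, I k t s → b.holds s →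
      wp c (t + 1) s fun t' s' => ∃ k' < k, I k' t' s')
    (done : ∀ k t s, I k t s → ¬ b.holds s → Q (t + 1) s) :
    ∀ k t s, I k t s → wp (.loop b c) t s Q := by
  intro k
  induction k using Nat.strong_induction_on with
  | _ k ih =>
    intro t s hI
    by_cases hb : b.holds s
    · obtain ⟨t', s', h, k', hk', hI'⟩ := step k t s hI hb
      obtain ⟨t'', s'', h', hQ⟩ := ih k' hk' _ _ hI'
      exact ⟨_, _, .loop_true hb h h', by
        rwa [show t + (1 + t' + t'') = t + 1 + t' + t'' by ring]⟩
    · exact ⟨_, _, .loop_false hb, done k t s hI hb⟩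

/-! ### Memory access -/

/-- An array with one index. -/
def Mem.a1 (s : Mem) (a : Arr) : ℕ → ℕ := fun i => s.arr a i 0

@[simp] theorem Mem.reg_setReg (s : Mem) (x y : Reg) (a : ℕ) :
    (s.setReg x a).reg y = if y = x then a else s.reg y := rfl
@[simp] theorem Mem.arr_setReg (s : Mem) (x : Reg) (a : ℕ) : (s.setReg x a).arr = s.arr := rfl
@[simp] theorem Mem.a1_setReg (s : Mem) (x : Reg) (a : ℕ) : (s.setReg x a).a1 = s.a1 := rfl
@[simp] theorem Mem.wt_setReg (s : Mem) (x : Reg) (a : ℕ) : (s.setReg x a).wt = s.wt := rfl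
@[simp] theorem Mem.reg_setArr (s : Mem) (a : Arr) (i j b : ℕ) :
    (s.setArr a i j b).reg = s.reg := rfl
@[simp] theorem Mem.wt_setArr (s : Mem) (a : Arr) (i j b : ℕ) :
    (s.setArr a i j b).wt = s.wt := rfl
@[simp] theorem Mem.reg_setWt (s : Mem) (a : WArr) (i : ℕ) (b : ℝ≥0∞) :
    (s.setWt a i b).reg = s.reg := rfl
@[simp] theorem Mem.arr_setWt (s : Mem) (a : WArr) (i : ℕ) (b : ℝ≥0∞) :
    (s.setWt a i b).arr = s.arr := rfl
@[simp] theorem Mem.a1_setWt (s : Mem) (a : WArr) (i : ℕ) (b : ℝ≥0∞) :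
    (s.setWt a i b).a1 = s.a1 := rfl

@[simp] theorem Mem.wt_setWt (s : Mem) (a a' : WArr) (i : ℕ) (b : ℝ≥0∞) :
    (s.setWt a i b).wt a' = if a' = a then Function.update (s.wt a') i b else s.wt a' := by
  ext k
  by_cases h : a' = a <;> by_cases h' : k = i <;> simp [Mem.setWt, h, h', Function.update]

theorem Mem.arr_setArr (s : Mem) (a a' : Arr) (i j b : ℕ) :
    (s.setArr a i j b).arr a' =
      if a' = a then Function.update (s.arr a') i (Function.update (s.arr a' i) j b)
      else s.arr a' := by
  ext k l
  by_cases h : a' = a <;> by_cases h' : k = i <;> by_cases h'' : l = j <;>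
    simp [Mem.setArr, h, h', h'', Function.update]

@[simp] theorem Mem.arr_setArr_ne (s : Mem) {a a' : Arr} (h : a' ≠ a) (i j b : ℕ) :
    (s.setArr a i j b).arr a' = s.arr a' := by
  simp [Mem.arr_setArr, h]

@[simp] theorem Mem.a1_setArr (s : Mem) (a a' : Arr) (i b : ℕ) :
    (s.setArr a i 0 b).a1 a' = if a' = a then Function.update (s.a1 a') i b else s.a1 a' := by
  ext k
  by_cases h : a' = a <;> by_cases h' : k = i <;>
    simp [Mem.setArr, Mem.a1, h, h', Function.update]

@[simp] theorem Mem.a1_setArr_ne (s : Mem) {a a' : Arr} (h : a' ≠ a) (i j b : ℕ) :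
    (s.setArr a i j b).a1 a' = s.a1 a' := by
  ext k
  simp [Mem.a1, h]

@[simp] theorem Expr.eval_zero (s : Mem) : (0 : Expr).eval s = 0 := rfl
@[simp] theorem Expr.eval_one (s : Mem) : (1 : Expr).eval s = 1 := rfl
@[simp] theorem Expr.eval_two (s : Mem) : (2 : Expr).eval s = 2 := rfl
@[simp] theorem Expr.eval_reg (s : Mem) (x : Reg) : (Expr.reg x).eval s = s.reg x := rfl
@[simp] theorem Expr.eval_add (s : Mem) (a b : Expr) : (a + b).eval s = a.eval s + b.eval s := rfl
@[simp] theorem Expr.eval_sub (s : Mem) (a b : Expr) : (a - b).eval s = a.eval s - b.eval s := rfl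
@[simp] theorem Expr.eval_get (s : Mem) (a : Arr) (i j : Expr) :
    (Expr.get a i j).eval s = s.arr a (i.eval s) (j.eval s) := rfl
@[simp] theorem eval_get1 (s : Mem) (a : Arr) (i : Expr) :
    (get1 a i).eval s = s.a1 a (i.eval s) := rfl
@[simp] theorem eval_eltAt (s : Mem) (p : Reg) : (eltAt p).eval s = s.a1 .elt (s.reg p) := rfl
@[simp] theorem eval_wOf (s : Mem) (a : Expr) : (wOf a).eval s = s.wt .w (a.eval s) := rfl
@[simp] theorem eval_dOf (s : Mem) (a : Expr) : (dOf a).eval s = s.wt .D (a.eval s) := rfl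
@[simp] theorem WExpr.eval_zero (s : Mem) : WExpr.zero.eval s = 0 := rfl
@[simp] theorem WExpr.eval_infty (s : Mem) : WExpr.infty.eval s = ∞ := rfl
@[simp] theorem WExpr.eval_add (s : Mem) (a b : WExpr) :
    (WExpr.add a b).eval s = a.eval s + b.eval s := rfl
@[simp] theorem Test.holds_eq (s : Mem) (a b : Expr) :
    (Test.eq a b).holds s ↔ a.eval s = b.eval s := Iff.rfl
@[simp] theorem Test.holds_lt (s : Mem) (a b : Expr) :
    (Test.lt a b).holds s ↔ a.eval s < b.eval s := Iff.rfl
@[simp] theorem Test.holds_wlt (s : Mem) (a b : WExpr) :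
    (Test.wlt a b).holds s ↔ a.eval s < b.eval s := Iff.rfl
@[simp] theorem Test.holds_and (s : Mem) (a b : Test) :
    (Test.and a b).holds s ↔ a.holds s ∧ b.holds s := Iff.rfl
@[simp] theorem Test.holds_or (s : Mem) (a b : Test) :
    (Test.or a b).holds s ↔ a.holds s ∨ b.holds s := Iff.rfl

@[simp] theorem wp_write1 {a i b t s Q} :
    wp (write1 a i b) t s Q ↔ Q (t + 1) (s.setArr a (i.eval s) 0 (b.eval s)) := wp_write

/-! ### Frame rules -/

/-- `c` may assign to the register `x`. -/
def Cmd.modReg (x : Reg) : Cmd → Bool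
  | .assign y _ => decide (x = y)
  | .seq c d => c.modReg x || d.modReg x
  | .ite _ c d => c.modReg x || d.modReg x
  | .loop _ c => c.modReg x
  | _ => false

/-- `c` may write to the array `a`. -/
def Cmd.modArr (a : Arr) : Cmd → Bool
  | .write a' _ _ _ => decide (a = a')
  | .seq c d => c.modArr a || d.modArr a
  | .ite _ c d => c.modArr a || d.modArr a
  | .loop _ c => c.modArr a
  | _ => false

/-- `c` may write to the weight array `a`. -/
def Cmd.modWt (a : WArr) : Cmd → Bool
  | .wwrite a' _ _ => decide (a = a')
  | .seq c d => c.modWt a || d.modWt a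
  | .ite _ c d => c.modWt a || d.modWt a
  | .loop _ c => c.modWt a
  | _ => false

/-- The hypothesis is a Boolean check of the program text, so for a concrete program it is
discharged by `decide`. -/
theorem Exec.reg_eq {c : Cmd} {s s' : Mem} {t : ℕ} (h : Exec c s t s') {x : Reg}
    (hx : c.modReg x = false) : s'.reg x = s.reg x := by
  induction h with
  | assign => simp_all [Cmd.modReg]
  | _ => simp_all [Cmd.modReg]

theorem Exec.arr_eq {c : Cmd} {s s' : Mem} {t : ℕ} (h : Exec c s t s') {a : Arr}
    (ha : c.modArr a = false) : s'.arr a = s.arr a := by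
  induction h with
  | write => simp_all [Cmd.modArr]
  | _ => simp_all [Cmd.modArr]

theorem Exec.a1_eq {c : Cmd} {s s' : Mem} {t : ℕ} (h : Exec c s t s') {a : Arr}
    (ha : c.modArr a = false) : s'.a1 a = s.a1 a := by
  unfold Mem.a1; rw [h.arr_eq ha]

theorem Exec.wt_eq {c : Cmd} {s s' : Mem} {t : ℕ} (h : Exec c s t s') {a : WArr}
    (ha : c.modWt a = false) : s'.wt a = s.wt a := by
  induction h with
  | wwrite => simp_all [Cmd.modWt]
  | _ => simp_all [Cmd.modWt]

/-! ### Linked lists -/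

/-- The list cells of `s` are unchanged in `s'`. -/
structure Extends (s s' : Mem) : Prop where
  cell : s.reg .cell ≤ s'.reg .cell
  elt : ∀ p ≤ s.reg .cell, s'.a1 .elt p = s.a1 .elt p
  nxt : ∀ p ≤ s.reg .cell, s'.a1 .nxt p = s.a1 .nxt p

theorem Extends.refl (s : Mem) : Extends s s := ⟨le_rfl, fun _ _ => rfl, fun _ _ => rfl⟩

theorem Extends.trans {s s' s'' : Mem} (h : Extends s s') (h' : Extends s' s'') :
    Extends s s'' :=
  ⟨h.cell.trans h'.cell, fun p hp => (h'.elt p (hp.trans h.cell)).trans (h.elt p hp),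
    fun p hp => (h'.nxt p (hp.trans h.cell)).trans (h.nxt p hp)⟩

theorem Extends.of_eq {s s' : Mem} (h : s'.reg .cell = s.reg .cell)
    (he : s'.a1 .elt = s.a1 .elt) (hn : s'.a1 .nxt = s.a1 .nxt) : Extends s s' :=
  ⟨h.ge, fun _ _ => by rw [he], fun _ _ => by rw [hn]⟩

theorem Mem.extends_setReg (s : Mem) {x : Reg} (hx : x ≠ .cell) (a : ℕ) :
    Extends s (s.setReg x a) := .of_eq (by simp [hx.symm]) rfl rfl

theorem Mem.extends_setArr (s : Mem) {a : Arr} (he : a ≠ .elt) (hn : a ≠ .nxt) (i j b : ℕ) :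
    Extends s (s.setArr a i j b) := .of_eq rfl (by simp [he.symm]) (by simp [hn.symm])

theorem Mem.extends_setWt (s : Mem) (a : WArr) (i : ℕ) (b : ℝ≥0∞) :
    Extends s (s.setWt a i b) := .of_eq rfl rfl rfl

/-- The linked list that begins at the cell `p` contains the elements `l`. -/
def IsL (s : Mem) : ℕ → List ℕ → Prop
  | p, [] => p = 0
  | p, a :: l => 0 < p ∧ p ≤ s.reg .cell ∧ s.a1 .elt p = a ∧ IsL s (s.a1 .nxt p) l

/-- The cells of a list have addresses up to the allocation pointer, and these are exactly the cells
that `Extends` freezes. -/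
theorem IsL.mono {s s' : Mem} (hs : Extends s s') :
    ∀ {l : List ℕ} {p : ℕ}, IsL s p l → IsL s' p l
  | [], _, h => h
  | _ :: _, p, ⟨h₀, h₁, h₂, h₃⟩ =>
    ⟨h₀, h₁.trans hs.cell, by rw [hs.elt p h₁, h₂], by rw [hs.nxt p h₁]; exact h₃.mono hs⟩

@[simp] theorem IsL.zero_iff {s : Mem} {l : List ℕ} : IsL s 0 l ↔ l = [] := by
  cases l <;> simp [IsL]

/-- The memory after `b` has been put in front of the list `a[i]`. -/
def Mem.pushed (s : Mem) (a : Arr) (i b : ℕ) : Mem :=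
  (((s.setReg .cell (s.reg .cell + 1)).setArr .elt (s.reg .cell + 1) 0 b).setArr .nxt
    (s.reg .cell + 1) 0 (s.a1 a i)).setArr a i 0 (s.reg .cell + 1)

/-- The expression does not refer to the list cells. -/
def Expr.noCell : Expr → Bool
  | .lit _ => true
  | .reg x => decide (x ≠ .cell)
  | .get a i j => decide (a ≠ .elt) && decide (a ≠ .nxt) && i.noCell && j.noCell
  | .add a b => a.noCell && b.noCell
  | .sub a b => a.noCell && b.noCell

theorem Expr.eval_noCell {s s' : Mem} (hr : ∀ x ≠ .cell, s'.reg x = s.reg x)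
    (ha : ∀ a, a ≠ .elt → a ≠ .nxt → s'.arr a = s.arr a) :
    ∀ {a : Expr}, a.noCell = true → a.eval s' = a.eval s
  | .lit _, _ => rfl
  | .reg x, h => hr x (by simpa [Expr.noCell] using h)
  | .get a i j, h => by
    simp only [Expr.noCell, Bool.and_eq_true, decide_eq_true_eq] at h
    simp only [Expr.eval, Expr.eval_noCell hr ha h.1.2, Expr.eval_noCell hr ha h.2,
      ha a h.1.1.1 h.1.1.2]
  | .add a b, h => by
    simp only [Expr.noCell, Bool.and_eq_true] at h
    simp only [Expr.eval, Expr.eval_noCell hr ha h.1, Expr.eval_noCell hr ha h.2]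
  | .sub a b, h => by
    simp only [Expr.noCell, Bool.and_eq_true] at h
    simp only [Expr.eval, Expr.eval_noCell hr ha h.1, Expr.eval_noCell hr ha h.2]

/-- `push` evaluates its arguments after it has moved the allocation pointer and written to the new
cell. Expressions that do not read cells have the same value then as in the initial memory. -/
theorem wp_push {a : Arr} {i b : Expr} {t s Q} (hi : i.noCell = true) (hb : b.noCell = true)
    (he : a ≠ .elt) :
    wp (push a i b) t s Q ↔ Q (t + 4) (s.pushed a (i.eval s) (b.eval s)) := by
  have h₁ : ∀ v, b.eval (s.setReg .cell v) = b.eval s := fun v =>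
    Expr.eval_noCell (s := s) (s' := s.setReg .cell v) (fun x hx => by simp [hx])
      (fun _ _ _ => rfl) hb
  have h₂ : ∀ v k w, i.eval ((s.setReg .cell v).setArr .elt k 0 w) = i.eval s := fun v k w =>
    Expr.eval_noCell (fun x hx => by simp [hx]) (fun a h _ => by simp [h]) hi
  have h₃ : ∀ v k w k' w', i.eval (((s.setReg .cell v).setArr .elt k 0 w).setArr .nxt k' 0 w')
      = i.eval s := fun v k w k' w' =>
    Expr.eval_noCell (fun x hx => by simp [hx]) (fun a h h' => by simp [h, h']) hi
  simp [push, block, Mem.pushed, h₁, h₂, h₃, he]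

@[simp] theorem Mem.reg_pushed (s : Mem) (a : Arr) (i b : ℕ) (x : Reg) :
    (s.pushed a i b).reg x = if x = .cell then s.reg .cell + 1 else s.reg x := rfl

@[simp] theorem Mem.wt_pushed (s : Mem) (a : Arr) (i b : ℕ) : (s.pushed a i b).wt = s.wt := rfl

@[simp] theorem Mem.arr_pushed (s : Mem) {a a' : Arr} (i b : ℕ) (h : a' ≠ a) (he : a' ≠ .elt)
    (hn : a' ≠ .nxt) : (s.pushed a i b).arr a' = s.arr a' := by
  simp [Mem.pushed, h, he, hn]

@[simp] theorem Mem.a1_pushed (s : Mem) {a a' : Arr} (i b : ℕ) (he : a' ≠ .elt)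
    (hn : a' ≠ .nxt) : (s.pushed a i b).a1 a' =
      if a' = a then Function.update (s.a1 a') i (s.reg .cell + 1) else s.a1 a' := by
  simp [Mem.pushed, he, hn]

theorem Mem.extends_pushed (s : Mem) {a : Arr} (i b : ℕ) (he : a ≠ .elt) (hn : a ≠ .nxt) :
    Extends s (s.pushed a i b) := by
  refine ⟨by simp, fun p hp => ?_, fun p hp => ?_⟩
  · have : p ≠ s.reg .cell + 1 := by omega
    simp [Mem.pushed, he.symm, Function.update, this]
  · have : p ≠ s.reg .cell + 1 := by omega
    simp [Mem.pushed, hn.symm, Function.update, this]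

theorem IsL.pushed {s : Mem} {a : Arr} {i b : ℕ} {l : List ℕ} (h : IsL s (s.a1 a i) l)
    (he : a ≠ .elt) (hn : a ≠ .nxt) :
    IsL (s.pushed a i b) (s.reg .cell + 1) (b :: l) := by
  refine ⟨by omega, by simp, ?_, ?_⟩
  · simp [Mem.pushed, he.symm]
  · have : (s.pushed a i b).a1 .nxt (s.reg .cell + 1) = s.a1 a i := by
      simp [Mem.pushed, hn.symm]
    rw [this]
    exact h.mono (s.extends_pushed i b he hn)

/-- The program writes to list cells only by `push`. -/
inductive Alloc : Cmd → Prop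
  | push (a : Arr) (i b : Expr) : i.noCell = true → b.noCell = true → a ≠ .elt → a ≠ .nxt →
      Alloc (push a i b)
  | skip : Alloc .skip
  | assign (x : Reg) (a : Expr) : x ≠ .cell → Alloc (.assign x a)
  | write (a : Arr) (i j b : Expr) : a ≠ .elt → a ≠ .nxt → Alloc (.write a i j b)
  | wwrite (a : WArr) (i : Expr) (b : WExpr) : Alloc (.wwrite a i b)
  | seq {c d : Cmd} : Alloc c → Alloc d → Alloc (.seq c d)
  | ite {b : Test} {c d : Cmd} : Alloc c → Alloc d → Alloc (.ite b c d)
  | loop {b : Test} {c : Cmd} : Alloc c → Alloc (.loop b c)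

/-- The single instructions of a `push` move the allocation pointer and write to `elt` and `nxt`;
only the whole command is harmless. It is therefore a leaf of the induction, settled by its
specification and determinism. -/
theorem Alloc.extends {c : Cmd} (hc : Alloc c) {s s' : Mem} {t : ℕ} (h : Exec c s t s') :
    Extends s s' := by
  induction hc generalizing s s' t with
  | push a i b hi hb he hn =>
    have : wp (RAM.push a i b) 0 s (fun _ s'' => Extends s s'') :=
      (wp_push hi hb he).2 (s.extends_pushed _ _ he hn)
    obtain ⟨t', s'', h', hQ⟩ := this
    rwa [(h.deterministic h').2]
  | skip => cases h; exact .refl _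
  | assign x a hx => cases h; exact s.extends_setReg hx _
  | write a i j b he hn => cases h; exact s.extends_setArr he hn _ _ _
  | wwrite => cases h; exact s.extends_setWt _ _ _
  | seq _ _ ih ih' => cases h with
    | seq h h' => exact (ih h).trans (ih' h')
  | ite _ _ ih ih' => cases h with
    | ite_true _ h => exact ih h
    | ite_false _ h => exact ih' h
  | @loop b c _ ih =>
    generalize hd : Cmd.loop b c = d at h
    induction h with
    | loop_true _ h _ _ ih' => cases hd; exact (ih h).trans (ih' rfl)
    | loop_false => exact .refl _
    | _ => cases hd

/-- The body only allocates, so the unread cells stay intact even if the body pushes onto lists. The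
invariant speaks of the unread remainder; it must hold for every value `q` of the pointer, which
frees it from any knowledge of addresses. -/
theorem wp_forCells {p : Reg} {h : Expr} {c : Cmd} {l : List ℕ} {t : ℕ} {s : Mem}
    {Q : ℕ → Mem → Prop} (I : List ℕ → ℕ → Mem → Prop) (hp : p ≠ .cell)
    (hc : Alloc c) (hcp : c.modReg p = false) (hl : IsL s (h.eval s) l)
    (init : I l (t + 1) (s.setReg p (h.eval s)))
    (step : ∀ a l t s, I (a :: l) t s → s.a1 .elt (s.reg p) = a →
      wp c (t + 1) s fun t' s' => ∀ q, I l (t' + 1) (s'.setReg p q))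
    (done : ∀ t s, I [] t s → Q (t + 1) s) :
    wp (forCells p h c) t s Q := by
  simp only [forCells, block, wp_seq, wp_assign]
  refine wp_loop (fun k t s => ∃ l, l.length = k ∧ I l t s ∧ IsL s (s.reg p) l) ?_ ?_ l.length _ _
    ⟨l, rfl, init, by
      simpa using hl.mono (s.extends_setReg hp _)⟩
  · rintro _ t s ⟨l, rfl, hI, hL⟩ hb
    cases l with
    | nil => simp [IsL] at hL; simp [hL] at hb
    | cons a l =>
      obtain ⟨h0, h1, h2, h3⟩ := hL
      rw [wp_seq]
      refine (step a l t s hI h2).exec fun t' s' hE hI' => ?_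
      rw [wp_assign]
      have hx := hc.extends hE
      refine ⟨l.length, by simp, l, rfl, hI' _, ?_⟩
      have : s'.reg p = s.reg p := hE.reg_eq hcp
      simp only [eval_get1, Expr.eval_reg, Mem.reg_setReg, if_true, this, hx.nxt _ h1]
      exact (h3.mono hx).mono (s'.extends_setReg hp _)
  · rintro _ t s ⟨l, rfl, hI, hL⟩ hb
    cases l with
    | nil => exact done _ _ hI
    | cons a l => exact absurd hL.1 (by simpa using hb)

/-- The upper bound is evaluated anew at every test; `hhi` makes the invariant responsible for its
being constant. -/
theorem wp_forRange {i : Reg} {lo hi : Expr} {c : Cmd} {N t : ℕ} {s : Mem}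
    {Q : ℕ → Mem → Prop} (I : ℕ → ℕ → Mem → Prop)
    (hci : c.modReg i = false) (hlo : lo.eval s ≤ N)
    (init : I (lo.eval s) (t + 1) (s.setReg i (lo.eval s)))
    (hhi : ∀ k t s, I k t s → hi.eval s = N)
    (step : ∀ k t s, I k t s → s.reg i = k → k < N →
      wp c (t + 1) s fun t' s' => I (k + 1) (t' + 1) (s'.setReg i (k + 1)))
    (done : ∀ t s, I N t s → Q (t + 1) s) :
    wp (forRange i lo hi c) t s Q := by
  simp only [forRange, block, wp_seq, wp_assign]
  refine wp_loop (fun v t s => ∃ k ≤ N, N - k = v ∧ I k t s ∧ s.reg i = k) ?_ ?_ _ _ _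
    ⟨_, hlo, rfl, init, by simp⟩
  · rintro _ t s ⟨k, hk, rfl, hI, hr⟩ hb
    simp only [Test.holds_lt, Expr.eval_reg, hr, hhi _ _ _ hI] at hb
    rw [wp_seq]
    refine (step k t s hI hr hb).exec fun t' s' hE hI' => ?_
    have : s'.reg i = k := (hE.reg_eq hci).trans hr
    rw [wp_assign]
    refine ⟨N - (k + 1), by omega, k + 1, by omega, rfl, ?_, ?_⟩
    · simpa [this] using hI'
    · simp [this]
  · rintro _ t s ⟨k, hk, rfl, hI, hr⟩ hb
    simp only [Test.holds_lt, Expr.eval_reg, hr, hhi _ _ _ hI] at hb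
    obtain rfl : k = N := by omega
    exact done _ _ hI

/-! ### Forests with cascading cuts -/

/-- The forest structure of a Fibonacci heap on the vertices `x` with `inQ x = 1`. The vertex `c`
is exempt from the requirement that a vertex which has lost a child is marked. -/
structure Forest (n : ℕ) (inQ par deg mark : ℕ → ℕ) (chd : ℕ → List ℕ) (c : ℕ) : Prop where
  rng : ∀ x, inQ x = 1 → 1 ≤ x ∧ x ≤ n
  parQ : ∀ x, par x ≠ 0 → inQ x = 1 ∧ inQ (par x) = 1 ∧ x ∈ chd (par x)
  mark_root : ∀ x, par x = 0 → mark x = 0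
  mark_le : ∀ x, mark x ≤ 1
  deg_eq : ∀ x, inQ x = 1 → deg x = ((Finset.Icc 1 n).filter fun y => par y = x).card
  -- The degree plus the mark of a child never falls below its degree at the time of linking,
  -- because losing one child sets the mark and losing a second one cuts the vertex. At that time
  -- its parent had the same degree, so the sorted sums dominate `0, 1, 2, …`.
  cnt : ∀ x j, x ≠ 0 →
    ((Finset.Icc 1 n).filter fun y => par y = x ∧ y ≠ c ∧ deg y + mark y < j).card ≤ j
  ht : ∃ ht : ℕ → ℕ, ∀ x, par x ≠ 0 → ht x < ht (par x)

/-- If `S` has `k + 1` elements, not all of them can have `g y < k`, so some `y` has `k ≤ g y`. It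
is paired with the last summand `f k` and removed; the counting hypothesis passes to subsets. -/
theorem sum_range_le_sum_of_count {α : Type*} [DecidableEq α] {f : ℕ → ℕ} (hf : Monotone f)
    {g : α → ℕ} : ∀ {S : Finset α}, (∀ j, (S.filter fun y => g y < j).card ≤ j) →
      ∑ i ∈ Finset.range S.card, f i ≤ ∑ y ∈ S, f (g y) := by
  intro S
  induction hk : S.card generalizing S with
  | zero => simp
  | succ k ih =>
    intro hS
    obtain ⟨y, hy, hgy⟩ : ∃ y ∈ S, k ≤ g y := by
      by_contra! hc
      have := hS k
      rw [Finset.filter_true_of_mem hc] at this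
      omega
    rw [Finset.sum_range_succ, ← Finset.sum_erase_add S _ hy]
    refine Nat.add_le_add (ih (by rw [Finset.card_erase_of_mem hy]; omega) fun j => ?_) (hf hgy)
    exact (Finset.card_le_card (Finset.filter_subset_filter _ (S.erase_subset y))).trans (hS j)

namespace Forest

variable {n : ℕ} {inQ par deg mark : ℕ → ℕ} {chd : ℕ → List ℕ} {c : ℕ}

theorem mem_Icc (h : Forest n inQ par deg mark chd c) {x : ℕ} (hx : par x ≠ 0) :
    x ∈ Finset.Icc 1 n := Finset.mem_Icc.2 (h.rng x (h.parQ x hx).1)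

theorem par_zero (h : Forest n inQ par deg mark chd c) : par 0 = 0 := by
  by_contra h0
  simpa using h.rng 0 (h.parQ 0 h0).1

theorem par_ne_self (h : Forest n inQ par deg mark chd c) {x : ℕ} (hx : par x ≠ 0) :
    par x ≠ x := by
  obtain ⟨ht, hht⟩ := h.ht
  intro he
  have := hht x hx
  rw [he] at this
  omega

/-- Vertices are numbered from `1`, so exempting `0` means that there is no exemption. -/
theorem weaken (h : Forest n inQ par deg mark chd 0) (c : ℕ) :
    Forest n inQ par deg mark chd c where
  __ := h
  cnt x j hx := by
    refine (Finset.card_le_card fun y hy => ?_).trans (h.cnt x j hx)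
    simp only [Finset.mem_filter, Finset.mem_Icc] at hy ⊢
    exact ⟨hy.1, hy.2.1, by omega, hy.2.2.2⟩

/-- A root is a child of no vertex, so its exemption is void. -/
theorem strengthen (h : Forest n inQ par deg mark chd c) (hc : par c = 0) :
    Forest n inQ par deg mark chd 0 where
  __ := h
  cnt x j hx := by
    refine (Finset.card_le_card fun y hy => ?_).trans (h.cnt x j hx)
    simp only [Finset.mem_filter, Finset.mem_Icc] at hy ⊢
    refine ⟨hy.1, hy.2.1, ?_, hy.2.2.2⟩
    rintro rfl
    exact hx (hy.2.1.symm.trans hc)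

theorem ht_iterate {ht : ℕ → ℕ} (hht : ∀ x, par x ≠ 0 → ht x < ht (par x)) (h0 : par 0 = 0) :
    ∀ (i : ℕ) (x : ℕ), par^[i] x ≠ 0 → ht x ≤ ht (par^[i] x)
  | 0, _, _ => le_rfl
  | i + 1, x, hx => by
    rw [Function.iterate_succ_apply] at hx ⊢
    have hp : par x ≠ 0 := by
      intro hp
      rw [hp, Function.iterate_fixed h0] at hx
      exact hx rfl
    exact (hht x hp).le.trans (ht_iterate hht h0 i _ hx)

/-- Induction on the height of `x`: the sets of descendants of its children are disjoint, do not
contain `x`, and have Fibonacci size by induction. -/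
theorem fib_le (h : Forest n inQ par deg mark chd 0) {x : ℕ} (hx : inQ x = 1) :
    Nat.fib (deg x + 2) ≤ n := by
  classical
  obtain ⟨ht, hht⟩ := h.ht
  have h0 := h.par_zero
  let desc : ℕ → Finset ℕ := fun x => (Finset.Icc 1 n).filter fun u => ∃ i, par^[i] u = x
  suffices H : ∀ k x, ht x = k → inQ x = 1 → Nat.fib (deg x + 2) ≤ (desc x).card by
    refine (H _ x rfl hx).trans ((Finset.card_filter_le _ _).trans (by simp))
  intro k
  induction k using Nat.strong_induction_on with
  | _ k ih =>
  rintro x rfl hx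
  have hx0 := h.rng x hx
  set Ch := (Finset.Icc 1 n).filter fun y => par y = x with hCh
  have mCh : ∀ y, y ∈ Ch ↔ par y = x := fun y => by
    simp only [hCh, Finset.mem_filter, and_iff_right_iff_imp]
    intro hy
    exact h.mem_Icc (by omega)
  -- If the path upwards from `u` met two different children of `x`, it would lead from the first of
  -- them through `x` down to the second, against the heights.
  have key : ∀ y y' u i j, par y = x → par y' = x → par^[i] u = y → par^[j] u = y' → i ≤ j →
      y = y' := by
    intro y y' u i j hy hy' hi hj hij
    obtain ⟨k, rfl⟩ := Nat.exists_eq_add_of_le' hij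
    rw [Function.iterate_add_apply, hi] at hj
    cases k with
    | zero => exact hj
    | succ k =>
      rw [Function.iterate_succ_apply, hy] at hj
      have h1 := ht_iterate hht h0 k x (by rw [hj]; rintro rfl; omega)
      have h2 := hht y' (by omega)
      rw [hj] at h1
      rw [hy'] at h2
      omega
  have disj : (Ch : Set ℕ).PairwiseDisjoint desc := by
    intro y hy y' hy' hne
    rw [Function.onFun, Finset.disjoint_left]
    intro u hu hu'
    simp only [desc, Finset.mem_filter] at hu hu'
    obtain ⟨-, i, hi⟩ := hu
    obtain ⟨-, j, hj⟩ := hu'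
    rw [Finset.mem_coe, mCh] at hy hy'
    rcases le_total i j with hij | hij
    · exact hne (key _ _ _ _ _ hy hy' hi hj hij)
    · exact hne (key _ _ _ _ _ hy' hy hj hi hij).symm
  have hxn : x ∉ Ch.biUnion desc := by
    simp only [Finset.mem_biUnion, not_exists, not_and]
    intro y hy hxy
    rw [mCh] at hy
    simp only [desc, Finset.mem_filter] at hxy
    obtain ⟨-, i, hi⟩ := hxy
    have h1 := ht_iterate hht h0 i x (by rw [hi]; rintro rfl; omega)
    have h2 := hht y (by omega)
    rw [hi] at h1
    rw [hy] at h2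
    omega
  have hsub : insert x (Ch.biUnion desc) ⊆ desc x := by
    intro u hu
    rw [Finset.mem_insert, Finset.mem_biUnion] at hu
    rcases hu with rfl | ⟨y, hy, hu⟩
    · exact Finset.mem_filter.2 ⟨Finset.mem_Icc.2 hx0, 0, rfl⟩
    · rw [mCh] at hy
      obtain ⟨hu, i, hi⟩ := Finset.mem_filter.1 hu
      exact Finset.mem_filter.2 ⟨hu, i + 1, by rw [Function.iterate_succ_apply', hi, hy]⟩
  have hcard := Finset.card_le_card hsub
  rw [Finset.card_insert_of_notMem hxn, Finset.card_biUnion disj] at hcard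
  refine le_trans ?_ hcard
  -- Since marks are at most `1`, the index `deg y + mark y + 1` does not exceed the index `deg y +
  -- 2` of the induction hypothesis.
  have hsum : ∑ y ∈ Ch, Nat.fib (deg y + mark y + 1) ≤ ∑ y ∈ Ch, (desc y).card := by
    refine Finset.sum_le_sum fun y hy => ?_
    rw [mCh] at hy
    have h2 := hht y (by omega)
    rw [hy] at h2
    refine le_trans (Nat.fib_mono ?_) (ih _ h2 y rfl (h.parQ y (by omega)).1)
    have := h.mark_le y
    omega
  -- The sum over the children is at least `fib 1 + … + fib (deg x) = fib (deg x + 2) - 1`, and `x`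
  -- itself supplies the missing `1`.
  have hcnt := sum_range_le_sum_of_count (f := fun i => Nat.fib (i + 1))
    (g := fun y => deg y + mark y) (S := Ch)
    (fun a b hab => Nat.fib_mono (by omega)) fun j => by
      refine (Finset.card_le_card fun y hy => ?_).trans (h.cnt x j (by omega))
      simp only [Finset.mem_filter, hCh] at hy ⊢
      refine ⟨hy.1.1, hy.1.2, ?_, hy.2⟩
      have := Finset.mem_Icc.1 hy.1.1
      omega
  rw [h.deg_eq x hx, ← hCh, Nat.fib_succ_eq_succ_sum, Finset.sum_range_succ']
  simp only [Nat.fib_zero, add_zero]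
  omega

/-- By monotonicity, `fib (k + 4) = fib (k + 2) + fib (k + 3) ≥ 2 * fib (k + 2)`. -/
theorem two_pow_le_fib : ∀ k, 2 ^ (k / 2) ≤ Nat.fib (k + 2)
  | 0 => by simp
  | 1 => by simp [Nat.fib]
  | k + 2 => by
    have h := two_pow_le_fib k
    have h1 : Nat.fib (k + 2) ≤ Nat.fib (k + 2 + 1) := Nat.fib_mono (by omega)
    rw [show (k + 2) / 2 = k / 2 + 1 by omega, pow_succ, Nat.fib_add_two (n := k + 2)]
    omega

theorem deg_le (h : Forest n inQ par deg mark chd 0) {x : ℕ} (hx : inQ x = 1) :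
    deg x ≤ 2 * Nat.log 2 n + 1 := by
  have h1 := (two_pow_le_fib (deg x)).trans (h.fib_le hx)
  have h2 := Nat.log_mono_right (b := 2) h1
  rw [Nat.log_pow (by norm_num)] at h2
  omega

theorem insert (h : Forest n inQ par deg mark chd 0) {x : ℕ} (hx : inQ x ≠ 1) (h1 : 1 ≤ x)
    (hn : x ≤ n) :
    Forest n (Function.update inQ x 1) (Function.update par x 0) (Function.update deg x 0)
      (Function.update mark x 0) (Function.update chd x []) 0 := by
  have hp : par x = 0 := by
    by_contra hp
    exact hx (h.parQ x hp).1
  have hc : ∀ y, par y ≠ 0 → par y ≠ x := by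
    rintro y hy rfl
    exact hx (h.parQ y hy).2.1
  have e1 : Function.update par x 0 = par := by rw [← hp]; exact Function.update_eq_self x par
  have e2 : Function.update mark x 0 = mark := by
    rw [← h.mark_root x hp]; exact Function.update_eq_self x mark
  rw [e1, e2]
  refine ⟨fun y hy => ?_, fun y hy => ?_, h.mark_root, h.mark_le, fun y hy => ?_, fun y j hy => ?_,
    h.ht⟩
  · by_cases e : y = x
    · subst e; exact ⟨h1, hn⟩
    · rw [Function.update_of_ne e] at hy; exact h.rng y hy
  · have e : y ≠ x := by rintro rfl; exact hy hp
    rw [Function.update_of_ne e, Function.update_of_ne (hc y hy), Function.update_of_ne (hc y hy)]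
    exact h.parQ y hy
  · by_cases e : y = x
    · subst e
      rw [Function.update_self, eq_comm, Finset.card_eq_zero, Finset.filter_eq_empty_iff]
      rintro z - hz
      exact hc z (by omega) hz
    · rw [Function.update_of_ne e] at hy ⊢; exact h.deg_eq y hy
  · refine (Finset.card_le_card fun z hz => ?_).trans (h.cnt y j hy)
    simp only [Finset.mem_filter] at hz ⊢
    have e : z ≠ x := by rintro rfl; exact hy (hz.2.1 ▸ hp)
    rw [Function.update_of_ne e] at hz
    exact hz

/-- For the count at `x`: if `j ≤ deg x`, the new child `y` is not counted, as it has the same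
degree as `x`. If `j > deg x`, all `deg x + 1` children together are at most `j`. -/
theorem link (h : Forest n inQ par deg mark chd 0) {x y : ℕ} (hx : inQ x = 1) (hy : inQ y = 1)
    (px : par x = 0) (py : par y = 0) (hxy : x ≠ y) (hd : deg x = deg y) :
    Forest n inQ (Function.update par y x) (Function.update deg x (deg x + 1))
      (Function.update mark y 0) (Function.update chd x (y :: chd x)) 0 := by
  have e2 : Function.update mark y 0 = mark := by
    rw [← h.mark_root y py]; exact Function.update_eq_self y mark
  rw [e2]
  have x0 := h.rng x hx
  have y0 := h.rng y hy
  have hset : ∀ u, u ≠ 0 → ∀ z, Function.update par y x z = u ↔ par z = u ∨ (z = y ∧ u = x) := by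
    intro u hu z
    by_cases e : z = y
    · subst e; simp [py, hu.symm, eq_comm]
    · simp [e]
  refine ⟨h.rng, fun z hz => ?_, fun z hz => ?_, h.mark_le, fun u hu => ?_, fun u j hu => ?_, ?_⟩
  · by_cases e : z = y
    · subst e; simp [hx, hy]
    · rw [Function.update_of_ne e] at hz ⊢
      refine ⟨(h.parQ z hz).1, (h.parQ z hz).2.1, ?_⟩
      have := (h.parQ z hz).2.2
      by_cases e' : par z = x
      · rw [e'] at this ⊢; simp [this]
      · rwa [Function.update_of_ne e']
  · by_cases e : z = y
    · subst e; exact h.mark_root z py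
    · rw [Function.update_of_ne e] at hz; exact h.mark_root z hz
  · have u0 := h.rng u hu
    simp only [hset u (by omega)]
    by_cases e : u = x
    · subst e
      rw [Function.update_self, Finset.filter_or, Finset.card_union_of_disjoint, ← h.deg_eq u hu]
      · congr 1
        rw [eq_comm, Finset.card_eq_one]
        refine ⟨y, ?_⟩
        ext z
        simp only [and_true, Finset.mem_filter, Finset.mem_Icc, Finset.mem_singleton]
        omega
      · rw [Finset.disjoint_filter]
        rintro z - h1 ⟨rfl, -⟩
        omega
    · rw [Function.update_of_ne e]
      simp only [e, and_false, or_false]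
      exact h.deg_eq u hu
  · have hlt : ∀ z, (Function.update par y x z = u ∧ z ≠ 0 ∧
        Function.update deg x (deg x + 1) z + mark z < j) →
        (par z = u ∧ z ≠ 0 ∧ deg z + mark z < j) ∨ (z = y ∧ u = x ∧ deg x < j) := by
      rintro z ⟨h1, h2, h3⟩
      have hle : deg z ≤ Function.update deg x (deg x + 1) z := by
        by_cases e : z = x
        · subst e; simp
        · rw [Function.update_of_ne e]
      rcases (hset u hu z).1 h1 with h1 | ⟨rfl, rfl⟩
      · exact Or.inl ⟨h1, h2, by omega⟩
      · exact Or.inr ⟨rfl, rfl, by omega⟩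
    by_cases e : u = x ∧ deg x < j
    · obtain ⟨rfl, hj⟩ := e
      refine le_trans (Finset.card_le_card (t := Insert.insert y
        ((Finset.Icc 1 n).filter fun z => par z = u)) fun z hz => ?_) ?_
      · rw [Finset.mem_filter] at hz
        rw [Finset.mem_insert, Finset.mem_filter]
        rcases hlt z hz.2 with h1 | h1
        · exact Or.inr ⟨hz.1, h1.1⟩
        · exact Or.inl h1.1
      · refine (Finset.card_insert_le _ _).trans ?_
        rw [← h.deg_eq u hx]
        omega
    · refine (Finset.card_le_card fun z hz => ?_).trans (h.cnt u j hu)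
      rw [Finset.mem_filter] at hz ⊢
      rcases hlt z hz.2 with h1 | h1
      · exact ⟨hz.1, h1⟩
      · exact absurd ⟨h1.2.1, h1.2.2⟩ e
  · obtain ⟨ht, hht⟩ := h.ht
    -- Raising the height of `x` does no harm, because `x` is a root.
    refine ⟨Function.update ht x (max (ht x) (ht y + 1)), fun z hz => ?_⟩
    by_cases e : z = y
    · subst e
      rw [Function.update_self, Function.update_self, Function.update_of_ne hxy.symm]
      omega
    · rw [Function.update_of_ne e] at hz ⊢
      have := hht z hz
      rw [Function.update_of_ne (show z ≠ x by rintro rfl; exact hz px)]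
      by_cases e' : par z = x
      · rw [e'] at this ⊢; rw [Function.update_self]; omega
      · rwa [Function.update_of_ne e']

/-- Cutting `c` from its parent `y`. -/
theorem cut (h : Forest n inQ par deg mark chd c) {y : ℕ} (hy : par c = y) (y0 : y ≠ 0) :
    Forest n inQ (Function.update par c 0) (Function.update deg y (deg y - 1))
      (Function.update mark c 0) chd y := by
  have hcy : c ≠ y := fun e => h.par_ne_self (by omega : par c ≠ 0) (hy.trans e.symm)
  have hset : ∀ u, u ≠ 0 → ∀ z, Function.update par c 0 z = u ↔ par z = u ∧ z ≠ c := by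
    intro u hu z
    by_cases e : z = c
    · subst e; simp [hu.symm]
    · simp [e]
  have hpar : ∀ z, Function.update par c 0 z ≠ 0 → Function.update par c 0 z = par z ∧ z ≠ c := by
    intro z hz
    have := (hset _ hz z).1 rfl
    exact ⟨this.1.symm, this.2⟩
  refine ⟨h.rng, fun z hz => ?_, fun z hz => ?_, fun z => ?_, fun u hu => ?_, fun u j hu => ?_, ?_⟩
  · have e := (hpar z hz).1
    rw [e] at hz ⊢
    exact h.parQ z hz
  · by_cases e : z = c
    · subst e; simp
    · rw [Function.update_of_ne e] at hz ⊢; exact h.mark_root z hz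
  · by_cases e : z = c
    · subst e; simp
    · rw [Function.update_of_ne e]; exact h.mark_le z
  · have u0 := h.rng u hu
    simp only [hset u (by omega)]
    by_cases e : u = y
    · subst e
      rw [Function.update_self, h.deg_eq u hu, ← Finset.card_erase_of_mem (a := c)]
      · congr 1
        ext z
        simp only [Finset.mem_erase, Finset.mem_filter]
        tauto
      · exact Finset.mem_filter.2 ⟨h.mem_Icc (by omega), hy⟩
    · rw [Function.update_of_ne e, h.deg_eq u hu]
      congr 1
      ext z
      simp only [Finset.mem_filter]
      constructor
      · rintro ⟨h1, h2⟩
        exact ⟨h1, h2, by rintro rfl; exact e (h2.symm.trans hy)⟩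
      · tauto
  -- The exemption passes from `c` to `y`: `c` is no longer a child of any vertex, and `y` is the
  -- only vertex whose degree has dropped.
  · refine (Finset.card_le_card fun z hz => ?_).trans (h.cnt u j hu)
    simp only [Finset.mem_filter, hset u hu] at hz ⊢
    obtain ⟨h1, ⟨h2, h3⟩, h4, h5⟩ := hz
    rw [Function.update_of_ne h4, Function.update_of_ne h3] at h5
    exact ⟨h1, h2, h3, h5⟩
  · obtain ⟨ht, hht⟩ := h.ht
    refine ⟨ht, fun z hz => ?_⟩
    have e := (hpar z hz).1
    rw [e] at hz ⊢
    exact hht z hz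

/-- Cutting `c` from its unmarked parent `y`, which is marked. -/
theorem cut_mark (h : Forest n inQ par deg mark chd c) {y : ℕ} (hy : par c = y) (y0 : y ≠ 0)
    (hm : mark y = 0) (py : par y ≠ 0) :
    Forest n inQ (Function.update par c 0) (Function.update deg y (deg y - 1))
      (Function.update (Function.update mark c 0) y 1) chd 0 := by
  have h' := h.cut hy y0
  have hcy : c ≠ y := fun e => h.par_ne_self (by omega : par c ≠ 0) (hy.trans e.symm)
  have hpy : Function.update par c 0 y ≠ 0 := by rwa [Function.update_of_ne hcy.symm]
  -- Positivity makes the truncated `deg y - 1` a true decrement, so that the new mark restores `deg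
  -- y + mark y` exactly and `y` needs no exemption.
  have hdeg : 0 < deg y := by
    rw [h.deg_eq y (hy ▸ (h.parQ c (by omega)).2.1)]
    exact Finset.card_pos.2 ⟨c, Finset.mem_filter.2 ⟨h.mem_Icc (by omega), hy⟩⟩
  refine ⟨h'.rng, h'.parQ, fun z hz => ?_, fun z => ?_, h'.deg_eq, fun u j hu => ?_, h'.ht⟩
  · have e : z ≠ y := by rintro rfl; exact hpy hz
    rw [Function.update_of_ne e]
    exact h'.mark_root z hz
  · by_cases e : z = y
    · subst e; simp
    · rw [Function.update_of_ne e]; exact h'.mark_le z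
  · refine (Finset.card_le_card fun z hz => ?_).trans (h.cnt u j hu)
    simp only [Finset.mem_filter] at hz ⊢
    obtain ⟨h1, h2, h3, h4⟩ := hz
    have hzc : z ≠ c := by rintro rfl; exact hu (by simpa using h2.symm)
    rw [Function.update_of_ne hzc] at h2
    refine ⟨h1, h2, hzc, ?_⟩
    by_cases e : z = y
    · subst e
      rw [Function.update_self, Function.update_self] at h4
      omega
    · rwa [Function.update_of_ne e, Function.update_of_ne e, Function.update_of_ne hzc] at h4

/-- Deleting the root `z`; its children become roots. -/
theorem erase (h : Forest n inQ par deg mark chd 0) {z : ℕ} (hz : inQ z = 1) (pz : par z = 0) :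
    Forest n (Function.update inQ z 0) (fun x => if par x = z then 0 else par x)
      (Function.update deg z 0) (fun x => if par x = z then 0 else mark x)
      (Function.update chd z []) 0 := by
  have z0 := h.rng z hz
  have hpar : ∀ x, (if par x = z then 0 else par x) ≠ 0 →
      (if par x = z then 0 else par x) = par x ∧ par x ≠ z ∧ par x ≠ 0 := by
    intro x
    split <;> simp_all
  have hset : ∀ u, u ≠ 0 → ∀ x, (if par x = z then 0 else par x) = u ↔ par x = u ∧ u ≠ z := by
    intro u hu x
    split <;> grind
  refine ⟨fun x hx => ?_, fun x hx => ?_, fun x hx => ?_, fun x => ?_, fun x hx => ?_,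
    fun u j hu => ?_, ?_⟩
  · by_cases e : x = z
    · subst e; simp at hx
    · rw [Function.update_of_ne e] at hx; exact h.rng x hx
  · obtain ⟨h1, h2, h3⟩ := hpar x hx
    rw [h1, Function.update_of_ne (show x ≠ z by rintro rfl; exact h3 pz), Function.update_of_ne h2,
      Function.update_of_ne h2]
    exact h.parQ x h3
  · have := h.mark_root x
    grind
  · have := h.mark_le x
    grind
  · by_cases e : x = z
    · subst e; simp at hx
    · rw [Function.update_of_ne e] at hx ⊢
      have x0 := h.rng x hx
      simp only [hset x (by omega), e, ne_eq, not_false_eq_true, and_true]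
      exact h.deg_eq x hx
  · refine (Finset.card_le_card fun x hx => ?_).trans (h.cnt u j hu)
    simp only [Finset.mem_filter, hset u hu] at hx ⊢
    obtain ⟨h1, ⟨h2, h3⟩, h4, h5⟩ := hx
    have hxz : x ≠ z := by rintro rfl; exact hu (h2.symm.trans pz)
    rw [Function.update_of_ne hxz, if_neg (by omega)] at h5
    exact ⟨h1, h2, h4, h5⟩
  · obtain ⟨ht, hht⟩ := h.ht
    refine ⟨ht, fun x hx => ?_⟩
    obtain ⟨h1, h2, h3⟩ := hpar x hx
    rw [h1]
    exact hht x h3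

end Forest

/-- A loop terminates if its invariant bounds the number of steps. -/
theorem wp_loop_of_bound {b : Test} {c : Cmd} {Q : ℕ → Mem → Prop} (I : ℕ → Mem → Prop) (T : ℕ)
    (bound : ∀ t s, I t s → t ≤ T)
    (step : ∀ t s, I t s → b.holds s → wp c (t + 1) s I)
    (done : ∀ t s, I t s → ¬ b.holds s → Q (t + 1) s) {t : ℕ} {s : Mem} (h : I t s) :
    wp (.loop b c) t s Q := by
  -- The variant is the remaining budget `T - t`; it drops because the test alone takes a step.
  refine wp_loop (fun k t s => I t s ∧ T - t = k) ?_ (fun k t s h => done t s h.1) _ _ _ ⟨h, rfl⟩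
  rintro _ t s ⟨hI, rfl⟩ hb
  have := bound t s hI
  refine (step t s hI hb).exec fun t' s' hE hI' => ?_
  have := bound _ _ hI'
  exact ⟨_, by omega, hI', rfl⟩

/-! ### Fibonacci heap operations -/

/-- The memory after `x` has been made a root. -/
def Mem.rooted (s : Mem) (x : ℕ) : Mem :=
  ((s.setArr .par x 0 0).setArr .mark x 0 0).pushed .roots 0 x

theorem wp_makeRoot {x : Reg} (hx : x ≠ .cell) {t s Q} :
    wp (makeRoot x) t s Q ↔ Q (t + 6) (s.rooted (s.reg x)) := by
  have h0 : Expr.noCell 0 = true := rfl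
  have h1 : Expr.noCell (.reg x) = true := by simp [Expr.noCell, hx]
  simp [makeRoot, block, wp_push h0 h1, Mem.rooted]

theorem Mem.reg_rooted (s : Mem) (x : ℕ) {y : Reg} (hy : y ≠ .cell) :
    (s.rooted x).reg y = s.reg y := by simp [Mem.rooted, hy]

theorem Mem.wt_rooted (s : Mem) (x : ℕ) : (s.rooted x).wt = s.wt := rfl

theorem Mem.par_rooted (s : Mem) (x : ℕ) :
    (s.rooted x).a1 .par = Function.update (s.a1 .par) x 0 := by simp [Mem.rooted]

theorem Mem.mark_rooted (s : Mem) (x : ℕ) :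
    (s.rooted x).a1 .mark = Function.update (s.a1 .mark) x 0 := by simp [Mem.rooted]

theorem Mem.a1_rooted (s : Mem) (x : ℕ) {a : Arr} (h₁ : a ≠ .par) (h₂ : a ≠ .mark)
    (h₃ : a ≠ .roots) (h₄ : a ≠ .elt) (h₅ : a ≠ .nxt) : (s.rooted x).a1 a = s.a1 a := by
  simp [Mem.rooted, *]

theorem Mem.extends_rooted (s : Mem) (x : ℕ) : Extends s (s.rooted x) :=
  ((s.extends_setArr (by decide) (by decide) _ _ _).trans
    (Mem.extends_setArr _ (by decide) (by decide) _ _ _)).trans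
    (Mem.extends_pushed _ _ _ (by decide) (by decide))

theorem IsL.rooted {s : Mem} {l : List ℕ} (h : IsL s (s.a1 .roots 0) l) (x : ℕ) :
    IsL (s.rooted x) ((s.rooted x).a1 .roots 0) (x :: l) := by
  have := IsL.pushed (s := (s.setArr .par x 0 0).setArr .mark x 0 0) (a := .roots) (i := 0)
    (b := x) (l := l) ?_ (by decide) (by decide)
  · simpa [Mem.rooted] using this
  · simpa using h.mono ((s.extends_setArr (by decide) (by decide) _ _ _).trans
      (Mem.extends_setArr _ (by decide) (by decide) _ _ _))

/-- The lists `R` of roots and `chd x` of (former) children represent a forest. -/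
structure Core (n : ℕ) (s : Mem) (c : ℕ) (R : List ℕ) (chd : ℕ → List ℕ) : Prop where
  forest : Forest n (s.a1 .inQ) (s.a1 .par) (s.a1 .deg) (s.a1 .mark) chd c
  rootsL : IsL s (s.a1 .roots 0) R
  nodup : R.Nodup
  mem : ∀ x, x ∈ R ↔ s.a1 .inQ x = 1 ∧ s.a1 .par x = 0
  chdL : ∀ x, IsL s (s.a1 .chd x) (chd x)

/-- The potential of a heap. -/
def potential (n : ℕ) (s : Mem) (R : List ℕ) (chd : ℕ → List ℕ) : ℕ :=
  -- A list entry holds 20 units for the steps spent on reading it. A root holds 60 for its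
  -- treatment in the next consolidation. A mark holds 80, namely 60 for the root that its vertex
  -- becomes when it is cut and 20 for the steps of that cut.
  60 * R.length + 80 * ∑ x ∈ Finset.Icc 1 n, s.a1 .mark x +
    20 * ∑ x ∈ Finset.Icc 1 n, (chd x).length

/-- Heap order, except for `c`. -/
def Ordered (s : Mem) (c : ℕ) : Prop :=
  ∀ x, x ≠ c → s.a1 .par x ≠ 0 → s.wt .D (s.a1 .par x) ≤ s.wt .D x

/-- `minv` is a root of minimum key, where `c` is disregarded. -/
structure MinOK (s : Mem) (c : ℕ) : Prop where
  ne_zero : ∀ x, s.a1 .inQ x = 1 → s.reg .minv ≠ 0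
  le : ∀ x, x ≠ c → s.a1 .inQ x = 1 → s.wt .D (s.reg .minv) ≤ s.wt .D x
  root : s.reg .minv ≠ 0 → s.a1 .inQ (s.reg .minv) = 1 ∧ s.a1 .par (s.reg .minv) = 0

/-- `s` contains a heap; its potential and the number `t` of steps add up to at most `T`. The key
of `c` may be too small. -/
def Heap (n : ℕ) (s : Mem) (c t T : ℕ) : Prop :=
  ∃ R chd, Core n s 0 R chd ∧ Ordered s c ∧ MinOK s c ∧ (∀ r, s.a1 .slot r = 0) ∧
    t + potential n s R chd ≤ T

theorem Core.congr {n : ℕ} {s s' : Mem} {c : ℕ} {R : List ℕ} {chd : ℕ → List ℕ}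
    (h : Core n s c R chd) (hx : Extends s s')
    (ha : ∀ a ∈ [Arr.inQ, .par, .deg, .mark, .roots, .chd], s'.a1 a = s.a1 a) :
    Core n s' c R chd := by
  simp only [List.mem_cons, List.not_mem_nil, or_false, forall_eq_or_imp, forall_eq] at ha
  obtain ⟨h1, h2, h3, h4, h5, h6⟩ := ha
  refine ⟨?_, ?_, h.nodup, ?_, ?_⟩
  · rw [h1, h2, h3, h4]; exact h.forest
  · rw [h5]; exact h.rootsL.mono hx
  · rw [h1, h2]; exact h.mem
  · rw [h6]; exact fun x => (h.chdL x).mono hx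

/-- Only keys of queued vertices matter. In particular a vertex outside the queue may get its new
label before it is enqueued. -/
theorem Heap.congr {n : ℕ} {s s' : Mem} {c t T : ℕ} (h : Heap n s c t T) (hx : Extends s s')
    (ha : ∀ a ∈ [Arr.inQ, .par, .deg, .mark, .roots, .chd, .slot], s'.a1 a = s.a1 a)
    (hm : s'.reg .minv = s.reg .minv)
    (hD : ∀ x, s.a1 .inQ x = 1 → s'.wt .D x = s.wt .D x) : Heap n s' c t T := by
  obtain ⟨R, chd, hC, hO, hM, hS, hT⟩ := h
  have hf := hC.forest
  refine ⟨R, chd, hC.congr hx fun a h => ha a (by simp at h ⊢; tauto), ?_, ?_, ?_, ?_⟩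
  · intro x hx hp
    rw [ha .par (by simp)] at hp ⊢
    rw [hD _ (hf.parQ x hp).1, hD _ (hf.parQ x hp).2.1]
    exact hO x hx hp
  · refine ⟨?_, ?_, ?_⟩ <;> rw [ha .inQ (by simp), hm]
    · exact hM.ne_zero
    · intro x hx hq
      rw [hD x hq, hD _ (hM.root (hM.ne_zero x hq)).1]
      exact hM.le x hx hq
    · rw [ha .par (by simp)]; exact hM.root
  · rw [ha .slot (by simp)]; exact hS
  · unfold potential at hT ⊢
    rwa [ha .mark (by simp)]

theorem Heap.mono {n : ℕ} {s : Mem} {c t T t' T' : ℕ} (h : Heap n s c t T)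
    (hT : t' + T ≤ t + T') : Heap n s c t' T' := by
  obtain ⟨R, chd, hC, hO, hM, hS, hT⟩ := h
  exact ⟨R, chd, hC, hO, hM, hS, by omega⟩

theorem Heap.le {n : ℕ} {s : Mem} {c t T : ℕ} (h : Heap n s c t T) : t ≤ T := by
  obtain ⟨R, chd, hC, hO, hM, hS, hT⟩ := h
  omega

theorem sum_update_add {S : Finset ℕ} {x : ℕ} (hx : x ∈ S) (f : ℕ → ℕ) (a : ℕ) :
    ∑ y ∈ S, Function.update f x a y + f x = ∑ y ∈ S, f y + a := by
  rw [Finset.sum_update_of_mem hx, ← Finset.sum_erase_add _ f hx, Finset.sdiff_singleton_eq_erase]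
  omega

theorem wp_updateMin {x : Reg} {t s} {Q : ℕ → Mem → Prop}
    (h : ∀ t' a, t' ≤ t + 2 →
      (s.reg .minv = 0 ∨ s.wt .D (s.reg x) < s.wt .D (s.reg .minv) → a = s.reg x) →
      (¬ (s.reg .minv = 0 ∨ s.wt .D (s.reg x) < s.wt .D (s.reg .minv)) → a = s.reg .minv) →
      Q t' (s.setReg .minv a)) :
    wp (updateMin x) t s Q := by
  simp only [updateMin, wp_when, Test.holds_or, Test.holds_eq, Expr.eval_reg, Expr.eval_zero,
    Test.holds_wlt, eval_dOf, wp_assign]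
  refine ⟨fun hb => h _ _ (by omega) (fun _ => rfl) (fun h' => absurd hb h'), fun hb => ?_⟩
  have : s.setReg .minv (s.reg .minv) = s := by
    unfold Mem.setReg
    congr 1
    ext y
    split <;> simp_all
  have h' := h (t + 2) (s.reg .minv) (by omega) (fun h' => absurd h' hb) fun _ => rfl
  rwa [this] at h'

/-- Of the 80 units, 60 are the potential of the new root and the rest covers the steps. Clearing
the list of former children of the vertex can only lower the potential. -/
theorem enqueue_spec {n t T : ℕ} {s : Mem} (h : Heap n s 0 t T)
    (hQ : s.a1 .inQ (s.reg .v) ≠ 1) (h1 : 1 ≤ s.reg .v) (hn : s.reg .v ≤ n) :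
    wp (enqueue .v) t s fun t' s' => Heap n s' 0 t' (T + 80) ∧
      s'.a1 .inQ = Function.update (s.a1 .inQ) (s.reg .v) 1 := by
  obtain ⟨R, chd, hC, hO, hM, hS, hT⟩ := h
  have hf := hC.forest
  have hp : s.a1 .par (s.reg .v) = 0 := by
    by_contra hp
    exact hQ (hf.parQ _ hp).1
  have hpu : ∀ x, x ≠ 0 → Function.update (s.a1 .par) (s.reg .v) 0 x = s.a1 .par x := by
    intro x hx
    by_cases e : x = s.reg .v
    · rw [e, Function.update_self, hp]
    · rw [Function.update_of_ne e]
  simp only [enqueue, block, wp_seq, wp_write1, Expr.eval_reg, Expr.eval_one, Expr.eval_zero,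
    wp_makeRoot (x := .v) (by decide), Mem.reg_setArr]
  set s1 := ((s.setArr .inQ (s.reg .v) 0 1).setArr .deg (s.reg .v) 0 0).setArr .chd (s.reg .v) 0 0
    with hs1
  have hx1 : Extends s s1 := ((s.extends_setArr (by decide) (by decide) _ _ _).trans
    (Mem.extends_setArr _ (by decide) (by decide) _ _ _)).trans
    (Mem.extends_setArr _ (by decide) (by decide) _ _ _)
  have hroots : IsL s1 (s1.a1 .roots 0) R := by simpa [hs1] using hC.rootsL.mono hx1
  have hregs : ∀ x, s1.reg x = s.reg x := fun x => rfl
  have hv : (s1.rooted (s.reg .v)).reg .v = s.reg .v := Mem.reg_rooted _ _ (by decide)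
  have hminv : (s1.rooted (s.reg .v)).reg .minv = s.reg .minv := Mem.reg_rooted _ _ (by decide)
  have hinQ : s1.a1 .inQ = Function.update (s.a1 .inQ) (s.reg .v) 1 := by simp [hs1]
  have hdeg : s1.a1 .deg = Function.update (s.a1 .deg) (s.reg .v) 0 := by simp [hs1]
  have hchd : s1.a1 .chd = Function.update (s.a1 .chd) (s.reg .v) 0 := by simp [hs1]
  have hpar : s1.a1 .par = s.a1 .par := by simp [hs1]
  have hmark : s1.a1 .mark = s.a1 .mark := by simp [hs1]
  have hslot : s1.a1 .slot = s.a1 .slot := by simp [hs1]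
  have hwt : s1.wt = s.wt := rfl
  clear_value s1
  refine wp_updateMin fun t' a ht' ha ha' => ?_
  rw [hv, hminv, Mem.wt_rooted, hwt] at ha ha'
  have hV := Finset.mem_Icc.2 ⟨h1, hn⟩
  refine ⟨⟨s.reg .v :: R, Function.update chd (s.reg .v) [], ⟨?_, ?_, ?_, ?_, ?_⟩, ?_, ⟨?_, ?_, ?_⟩, ?_, ?_⟩, ?_⟩
  · simp only [Mem.a1_setReg, Mem.par_rooted, Mem.mark_rooted]
    rw [Mem.a1_rooted, Mem.a1_rooted, hinQ, hdeg, hpar, hmark]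
    · exact hf.insert hQ h1 hn
    all_goals decide
  · exact (hroots.rooted _).mono (Mem.extends_setReg _ (by decide) _)
  · rw [List.nodup_cons]
    exact ⟨fun h => hQ ((hC.mem _).1 h).1, hC.nodup⟩
  · intro x
    simp only [Mem.a1_setReg, Mem.par_rooted, List.mem_cons]
    rw [Mem.a1_rooted, hinQ, hpar, hC.mem]
    · by_cases e : x = s.reg .v
      · subst e; simp
      · simp [e]
    all_goals decide
  · intro x
    simp only [Mem.a1_setReg]
    rw [Mem.a1_rooted, hchd]
    · by_cases e : x = s.reg .v
      · subst e; simp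
      · simp only [Function.update_of_ne e]
        exact (hC.chdL x).mono ((hx1.trans (Mem.extends_rooted _ _)).trans
          (Mem.extends_setReg _ (by decide) _))
    all_goals decide
  · intro x hx
    simp only [Mem.a1_setReg, Mem.par_rooted, Mem.wt_setReg, Mem.wt_rooted, hwt, hpar, hpu x hx]
    exact hO x hx
  · intro x hx
    simp only [Mem.reg_setReg, if_true]
    by_cases h' : s.reg .minv = 0 ∨ s.wt .D (s.reg .v) < s.wt .D (s.reg .minv)
    · rw [ha h']; omega
    · rw [ha' h']; tauto
  · intro x hx0 hx
    simp only [Mem.reg_setReg, if_true, Mem.a1_setReg, Mem.wt_setReg, Mem.wt_rooted, hwt] at hx ⊢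
    rw [Mem.a1_rooted _ _ (by decide) (by decide) (by decide) (by decide) (by decide), hinQ] at hx
    by_cases e : x = s.reg .v
    · subst e
      by_cases h' : s.reg .minv = 0 ∨ s.wt .D (s.reg .v) < s.wt .D (s.reg .minv)
      · rw [ha h']
      · rw [ha' h']; push Not at h'; exact h'.2
    · rw [Function.update_of_ne e] at hx
      by_cases h' : s.reg .minv = 0 ∨ s.wt .D (s.reg .v) < s.wt .D (s.reg .minv)
      · rw [ha h']
        rcases h' with h' | h'
        · exact absurd h' (hM.ne_zero x hx)
        · exact h'.le.trans (hM.le x hx0 hx)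
      · rw [ha' h']; exact hM.le x hx0 hx
  · simp only [Mem.reg_setReg, if_true, Mem.a1_setReg, Mem.par_rooted]
    rw [Mem.a1_rooted _ _ (by decide) (by decide) (by decide) (by decide) (by decide), hinQ, hpar]
    intro a0
    rw [hpu a a0]
    by_cases e : a = s.reg .v
    · rw [e]; simp [hp]
    · rw [Function.update_of_ne e]
      by_cases h' : s.reg .minv = 0 ∨ s.wt .D (s.reg .v) < s.wt .D (s.reg .minv)
      · exact absurd (ha h') e
      · rw [ha' h'] at a0 ⊢; exact hM.root a0
  · intro r
    simp only [Mem.a1_setReg]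
    rw [Mem.a1_rooted _ _ (by decide) (by decide) (by decide) (by decide) (by decide), hslot, hS]
  · unfold potential at hT ⊢
    have e1 : Function.update (s.a1 .mark) (s.reg .v) 0 = s.a1 .mark := by
      rw [← hf.mark_root _ hp]; exact Function.update_eq_self _ _
    have e2 : ∑ x ∈ Finset.Icc 1 n, (Function.update chd (s.reg .v) [] x).length ≤
        ∑ x ∈ Finset.Icc 1 n, (chd x).length := by
      refine Finset.sum_le_sum fun x _ => ?_
      by_cases e : x = s.reg .v
      · subst e; simp
      · rw [Function.update_of_ne e]
    simp only [Mem.a1_setReg, Mem.mark_rooted, hmark, e1, List.length_cons]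
    omega
  · simp only [Mem.a1_setReg]
    rw [Mem.a1_rooted _ _ (by decide) (by decide) (by decide) (by decide) (by decide), hinQ]

theorem Core.rooted_of {n : ℕ} {s s' : Mem} {c c' x : ℕ} {R : List ℕ} {chd : ℕ → List ℕ}
    (h : Core n s c R chd) (hx : s.a1 .inQ x = 1) (px : s.a1 .par x ≠ 0)
    (he : Extends (s.rooted x) s') (hr : s'.a1 .roots = (s.rooted x).a1 .roots)
    (hQ : s'.a1 .inQ = s.a1 .inQ) (hp : s'.a1 .par = Function.update (s.a1 .par) x 0)
    (hc : s'.a1 .chd = s.a1 .chd)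
    (hF : Forest n (s'.a1 .inQ) (s'.a1 .par) (s'.a1 .deg) (s'.a1 .mark) chd c') :
    Core n s' c' (x :: R) chd := by
  refine ⟨hF, ?_, ?_, ?_, ?_⟩
  · rw [hr]; exact (h.rootsL.rooted x).mono he
  · rw [List.nodup_cons]
    exact ⟨fun h' => px ((h.mem x).1 h').2, h.nodup⟩
  · intro u
    rw [List.mem_cons, h.mem, hQ, hp]
    by_cases e : u = x
    · subst e; simp [hx]
    · simp [e]
  · intro u
    rw [hc]
    exact (h.chdL u).mono ((s.extends_rooted x).trans he)

/-- Invariant of the cascading cuts: `y` is the parent of `c`. -/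
def Cascade (n v T : ℕ) (par₀ : ℕ → ℕ) (t : ℕ) (s : Mem) : Prop :=
  ∃ R chd, Core n s (s.reg .c) R chd ∧ s.reg .y = s.a1 .par (s.reg .c) ∧
    (s.reg .c = v ∨ s.a1 .par v = 0) ∧ (∀ x, s.a1 .par x = 0 ∨ s.a1 .par x = par₀ x) ∧
    t + potential n s R chd + 80 + (if s.reg .y = 0 then 0 else 180) ≤
      T + 80 * s.a1 .mark (s.reg .c)

/-- Cutting a marked `c` releases 80 units, which cover the new root and the steps of one round, so
the cascade is free apart from its ends. The first vertex need not be marked, and the last round may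
create a root (60) and a mark (80); these are covered by the 180 units that the invariant reserves
while `y ≠ 0`. The further 80 offset the term `80 * mark c` on exit. -/
theorem cascade_spec {n v T t : ℕ} {par₀ : ℕ → ℕ} {s : Mem} (h : Cascade n v T par₀ t s) :
    wp (.loop (.lt 0 Reg.y) (block [
        makeRoot .c,
        write1 .deg Reg.y (get1 .deg Reg.y - 1),
        .ite (.eq (get1 .mark Reg.y) 1)
          (block [
            .assign .c Reg.y,
            .assign .y (get1 .par Reg.y)])
          (block [
            when (.lt 0 (get1 .par Reg.y)) (write1 .mark Reg.y 1),
            .assign .y 0])])) t s fun t' s' =>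
      ∃ R chd, Core n s' 0 R chd ∧ s'.a1 .par v = 0 ∧
        (∀ x, s'.a1 .par x = 0 ∨ s'.a1 .par x = par₀ x) ∧
        t' + potential n s' R chd ≤ T + 1 := by
  refine wp_loop_of_bound (Cascade n v T par₀) T ?_ ?_ ?_ h
  · rintro t s ⟨R, chd, hC, -, -, -, hT⟩
    have := hC.forest.mark_le (s.reg .c)
    omega
  · rintro t s ⟨R, chd, hC, hy, hv, hpar, hT⟩ hb
    have hf := hC.forest
    simp only [Test.holds_lt, Expr.eval_zero, Expr.eval_reg] at hb
    rw [if_neg (by omega)] at hT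
    have pc : s.a1 .par (s.reg .c) ≠ 0 := by omega
    have cQ := (hf.parQ _ pc).1
    have cI := hf.mem_Icc pc
    have hyc : s.reg .y ≠ s.reg .c := by rw [hy]; exact hf.par_ne_self pc
    have yI : s.reg .y ∈ Finset.Icc 1 n := by
      rw [hy]; exact Finset.mem_Icc.2 (hf.rng _ (hf.parQ _ pc).2.1)
    simp only [block, wp_seq, wp_makeRoot (x := .c) (by decide), wp_write1, Expr.eval_reg,
      Expr.eval_sub, eval_get1, Expr.eval_one]
    have hs1y : (s.rooted (s.reg .c)).reg .y = s.reg .y := Mem.reg_rooted _ _ (by decide)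
    have hs1d : (s.rooted (s.reg .c)).a1 .deg = s.a1 .deg :=
      Mem.a1_rooted _ _ (by decide) (by decide) (by decide) (by decide) (by decide)
    rw [hs1y, hs1d]
    set s2 := (s.rooted (s.reg .c)).setArr .deg (s.reg .y) 0 (s.a1 .deg (s.reg .y) - 1) with hs2
    have h2x : Extends (s.rooted (s.reg .c)) s2 := Mem.extends_setArr _ (by decide) (by decide) _ _ _
    have h2r : ∀ x, x ≠ .cell → s2.reg x = s.reg x := fun x hx => by
      simp [hs2, Mem.reg_rooted _ _ hx]
    have h2ne : ∀ a, a ≠ .deg → s2.a1 a = (s.rooted (s.reg .c)).a1 a := fun a ha => by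
      simp [hs2, ha]
    have h2p : s2.a1 .par = Function.update (s.a1 .par) (s.reg .c) 0 := by
      rw [h2ne _ (by decide), Mem.par_rooted]
    have h2m : s2.a1 .mark = Function.update (s.a1 .mark) (s.reg .c) 0 := by
      rw [h2ne _ (by decide), Mem.mark_rooted]
    have h2q : s2.a1 .inQ = s.a1 .inQ := by
      rw [h2ne _ (by decide)]
      exact Mem.a1_rooted _ _ (by decide) (by decide) (by decide) (by decide) (by decide)
    have h2c : s2.a1 .chd = s.a1 .chd := by
      rw [h2ne _ (by decide)]
      exact Mem.a1_rooted _ _ (by decide) (by decide) (by decide) (by decide) (by decide)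
    have h2d : s2.a1 .deg = Function.update (s.a1 .deg) (s.reg .y) (s.a1 .deg (s.reg .y) - 1) := by
      simp [hs2, hs1d]
    have h2ro := h2ne .roots (by decide)
    clear_value s2
    have hsum := sum_update_add cI (s.a1 .mark) 0
    rw [← h2m] at hsum
    have hpv : s2.a1 .par v = 0 := by
      rw [h2p]
      by_cases e : v = s.reg .c
      · rw [e, Function.update_self]
      · rw [Function.update_of_ne e]
        exact hv.resolve_left (Ne.symm e)
    have hpar2 : ∀ x, s2.a1 .par x = 0 ∨ s2.a1 .par x = par₀ x := by
      intro x
      rw [h2p]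
      by_cases e : x = s.reg .c
      · rw [e, Function.update_self]; exact Or.inl rfl
      · rw [Function.update_of_ne e]; exact hpar x
    have hpy : s2.a1 .par (s.reg .y) = s.a1 .par (s.reg .y) := by
      rw [h2p, Function.update_of_ne hyc]
    have hmy : s2.a1 .mark (s.reg .y) = s.a1 .mark (s.reg .y) := by
      rw [h2m, Function.update_of_ne hyc]
    have hC2 : Core n s2 (s.reg .y) (s.reg .c :: R) chd := by
      refine hC.rooted_of cQ pc h2x h2ro h2q h2p h2c ?_
      rw [h2q, h2p, h2d, h2m]
      exact hf.cut hy.symm (by omega)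
    unfold potential at hT
    simp only [wp_ite, Test.holds_eq, eval_get1, Expr.eval_reg, h2r .y (by decide), Expr.eval_one,
      wp_seq, wp_assign, wp_when, Test.holds_lt, Expr.eval_zero, wp_write1]
    constructor
    · intro hm
      refine ⟨s.reg .c :: R, chd, ?_, ?_, ?_, hpar2, ?_⟩
      · simp only [Mem.reg_setReg, reduceCtorEq, if_true, if_false]
        exact hC2.congr ((Mem.extends_setReg _ (by decide) _).trans
          (Mem.extends_setReg _ (by decide) _)) fun a _ => rfl
      · simp [h2r .y]
      · simp [hpv]
      · simp only [Mem.reg_setReg, reduceCtorEq, if_true, if_false, potential, Mem.a1_setReg, hm,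
          List.length_cons]
        split <;> omega
    · intro hm
      have hm0 : s.a1 .mark (s.reg .y) = 0 := by
        have := hf.mark_le (s.reg .y)
        omega
      constructor
      · intro hp
        have hsum' := sum_update_add yI (s2.a1 .mark) 1
        rw [hmy, hm0] at hsum'
        refine ⟨s.reg .c :: R, chd, ?_, ?_, ?_, ?_, ?_⟩
        · simp only [Mem.reg_setReg, Mem.reg_setArr, reduceCtorEq, if_false]
          have : Core n (s2.setArr .mark (s.reg .y) 0 1) 0 (s.reg .c :: R) chd := by
            refine hC.rooted_of cQ pc (h2x.trans (Mem.extends_setArr _ (by decide) (by decide) _ _ _))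
              ?_ ?_ ?_ ?_ ?_
            · simpa using h2ro
            · simpa using h2q
            · simpa using h2p
            · simpa using h2c
            · simp only [ne_eq, reduceCtorEq, not_false_eq_true, Mem.a1_setArr_ne, Mem.a1_setArr,
                if_true, h2q, h2p, h2d, h2m]
              exact hf.cut_mark hy.symm (by omega) hm0 (by omega)
          have h3 := this.congr (Mem.extends_setReg _ (x := .y) (by decide) 0) fun a _ => rfl
          exact { h3 with forest := h3.forest.weaken _ }
        · simp [h2r .c, h2p]
        · simp [hpv]
        · simpa using hpar2
        · simp only [Mem.reg_setReg, Mem.reg_setArr, reduceCtorEq, if_true, if_false, potential,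
            Mem.a1_setReg, Mem.a1_setArr, List.length_cons]
          omega
      · intro hp
        refine ⟨s.reg .c :: R, chd, ?_, ?_, ?_, ?_, ?_⟩
        · simp only [Mem.reg_setReg, reduceCtorEq, if_false]
          have h3 := hC2.congr (Mem.extends_setReg _ (x := .y) (by decide) 0) fun a _ => rfl
          -- Here the parent `y` is a root. It lost a child and stays unmarked, but a root needs no
          -- exemption.
          refine { h3 with forest := (h3.forest.strengthen ?_).weaken _ }
          simp only [Mem.a1_setReg]
          omega
        · simp [h2r .c, h2p]
        · simp [hpv]
        · simpa using hpar2
        · simp only [Mem.reg_setReg, reduceCtorEq, if_true, potential, Mem.a1_setReg,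
            List.length_cons]
          omega
  · rintro t s ⟨R, chd, hC, hy, hv, hpar, hT⟩ hb
    simp only [Test.holds_lt, Expr.eval_zero, Expr.eval_reg] at hb
    have hf := hC.forest
    refine ⟨R, chd, { hC with forest := hf.strengthen (by omega) }, ?_, hpar, ?_⟩
    · rcases hv with rfl | hv <;> omega
    · have := hf.mark_le (s.reg .c)
      omega

/-- On entry heap order can fail only between `v` and its parent, since a smaller key of `v` suits
the children of `v`. So either `v` is cut, or that one inequality holds as well. -/
theorem decreaseKey_spec {n t T : ℕ} {s : Mem} (h : Heap n s (s.reg .v) t T)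
    (hQ : s.a1 .inQ (s.reg .v) = 1) :
    wp (decreaseKey .v) t s fun t' s' => Heap n s' 0 t' (T + 400) := by
  obtain ⟨R, chd, hC, hO, hM, hS, hT⟩ := h
  have hf := hC.forest
  have hv0 := hf.rng _ hQ
  unfold decreaseKey
  rw [block, wp_seq, wp_assign, block, wp_seq]
  simp only [eval_get1, Expr.eval_reg]
  have hF1 : Extends s (s.setReg .y (s.a1 .par (s.reg .v))) := s.extends_setReg (by decide) _
  refine wp.exec (Q := fun t' s' => ∃ R chd, Core n s' 0 R chd ∧
    (∀ x, s'.a1 .par x = 0 ∨ s'.a1 .par x = s.a1 .par x) ∧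
    (s'.a1 .par (s.reg .v) = 0 ∨ s.a1 .par (s.reg .v) ≠ 0 ∧
      s.wt .D (s.a1 .par (s.reg .v)) ≤ s.wt .D (s.reg .v)) ∧
    t' + potential n s' R chd ≤ T + 300) ?_ ?_
  · rw [wp_when]
    simp only [Test.holds_and, Test.holds_lt, Test.holds_wlt, Expr.eval_reg, Expr.eval_zero,
      eval_dOf, Mem.reg_setReg, if_true, reduceCtorEq, if_false, Mem.wt_setReg]
    constructor
    · rintro ⟨h1, h2⟩
      rw [block, wp_seq, wp_assign]
      -- The constant 263 consists of three steps already taken and the reserves 80 and 180 of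
      -- `Cascade`.
      refine (cascade_spec (n := n) (v := s.reg .v) (T := T + 263) (par₀ := s.a1 .par) ?_).mono ?_
      · refine ⟨R, chd, ?_, ?_, ?_, ?_, ?_⟩
        · have := hC.congr (hF1.trans (Mem.extends_setReg _ (x := .c) (by decide) (s.reg .v)))
            fun a _ => rfl
          simp only [Expr.eval_reg, Mem.reg_setReg, if_true, reduceCtorEq, if_false]
          exact { this with forest := this.forest.weaken _ }
        · simp
        · simp
        · intro x; right; rfl
        · simp only [potential, Mem.a1_setReg] at hT ⊢
          split <;> omega
      · rintro t' s' ⟨R', chd', hC', hp, hpar, hT'⟩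
        exact ⟨R', chd', hC', hpar, Or.inl hp, by omega⟩
    · intro hb
      refine ⟨R, chd, hC.congr hF1 fun a _ => rfl, fun x => Or.inr rfl, ?_, ?_⟩
      · simp only [Mem.a1_setReg]
        by_cases hp : s.a1 .par (s.reg .v) = 0
        · exact Or.inl hp
        · refine Or.inr ⟨hp, ?_⟩
          by_contra hlt
          exact hb ⟨by omega, not_le.1 hlt⟩
      · have e : potential n (s.setReg .y (s.a1 .par (s.reg .v))) R chd = potential n s R chd := rfl
        rw [e]
        omega
  · rintro t1 s1 hE ⟨R1, chd1, hC1, hpar1, hv1, hT1⟩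
    have hr : ∀ x ∈ [Reg.v, .minv], s1.reg x = s.reg x := by
      simp only [List.mem_cons, List.not_mem_nil, or_false, forall_eq_or_imp, forall_eq]
      exact ⟨(hE.reg_eq (by decide)).trans (by simp), (hE.reg_eq (by decide)).trans (by simp)⟩
    have hin : s1.a1 .inQ = s.a1 .inQ := hE.a1_eq (by decide)
    have hsl : s1.a1 .slot = s.a1 .slot := hE.a1_eq (by decide)
    have hD : s1.wt .D = s.wt .D := hE.wt_eq (by decide)
    have hf1 := hC1.forest
    simp only [block]
    refine wp_updateMin fun t' a ht' ha ha' => ?_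
    rw [hr .minv (by simp), hr .v (by simp), hD] at ha ha'
    have hm0 := hM.ne_zero _ hQ
    -- If `v` was not cut, its key is at least that of its parent, hence at least the old minimum.
    -- So `minv` can move to `v` only when `v` is a root.
    have hroot : a ≠ s.reg .minv → a = s.reg .v ∧ s.wt .D (s.reg .v) < s.wt .D (s.reg .minv) ∧
        s1.a1 .par (s.reg .v) = 0 := by
      intro hne
      by_cases h' : s.reg .minv = 0 ∨ s.wt .D (s.reg .v) < s.wt .D (s.reg .minv)
      · refine ⟨ha h', h'.resolve_left hm0, ?_⟩
        rcases hv1 with hv1 | ⟨hv1, hv2⟩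
        · exact hv1
        · have h3 := hM.le _ (hf.par_ne_self hv1) (hf.parQ _ hv1).2.1
          exact absurd (h3.trans hv2) (not_le.2 (h'.resolve_left hm0))
      · exact absurd (ha' h') hne
    refine ⟨R1, chd1, hC1.congr (Mem.extends_setReg _ (by decide) _) fun a _ => rfl, ?_,
      ⟨?_, ?_, ?_⟩, ?_, ?_⟩
    · intro x _ hx
      simp only [Mem.a1_setReg, Mem.wt_setReg, hD] at hx ⊢
      have hx' := (hpar1 x).resolve_left hx
      rw [hx'] at hx ⊢
      by_cases e : x = s.reg .v
      · rw [e] at hx hx' ⊢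
        rcases hv1 with hv1 | hv1
        · omega
        · exact hv1.2
      · exact hO x e hx
    · intro x _
      simp only [Mem.reg_setReg, if_true]
      by_cases e : a = s.reg .minv
      · rwa [e]
      · rw [(hroot e).1]; omega
    · intro x _ hx
      simp only [Mem.a1_setReg, Mem.wt_setReg, hD, hin, Mem.reg_setReg, if_true] at hx ⊢
      by_cases e : a = s.reg .minv
      · subst e
        by_cases e' : x = s.reg .v
        · rw [e']
          by_contra hlt
          have h1 := ha (Or.inr (not_le.1 hlt))
          rw [h1] at hlt
          exact hlt le_rfl
        · exact hM.le x e' hx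
      · obtain ⟨e1, e2, -⟩ := hroot e
        rw [e1]
        by_cases e' : x = s.reg .v
        · rw [e']
        · exact e2.le.trans (hM.le x e' hx)
    · simp only [Mem.a1_setReg, hin, Mem.reg_setReg, if_true]
      intro _
      by_cases e : a = s.reg .minv
      · rw [e]
        refine ⟨(hM.root hm0).1, ?_⟩
        rcases hpar1 (s.reg .minv) with h1 | h1
        · exact h1
        · exact h1.trans (hM.root hm0).2
      · obtain ⟨e1, -, e2⟩ := hroot e
        rw [e1]
        exact ⟨hQ, e2⟩
    · intro r
      simp only [Mem.a1_setReg, hsl, hS]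
    · have e : potential n (s1.setReg .minv a) R1 chd1 = potential n s1 R1 chd1 := rfl
      rw [e]
      omega

/-- Among the queued vertices with key at most `D x`, one of maximal height must be a root, since
its parent would also qualify. -/
theorem Forest.exists_root {n : ℕ} {inQ par deg mark : ℕ → ℕ} {chd : ℕ → List ℕ} {c : ℕ}
    (h : Forest n inQ par deg mark chd c) {D : ℕ → ℝ≥0∞}
    (hD : ∀ x, par x ≠ 0 → D (par x) ≤ D x) {x : ℕ} (hx : inQ x = 1) :
    ∃ u, inQ u = 1 ∧ par u = 0 ∧ D u ≤ D x := by
  obtain ⟨ht, hht⟩ := h.ht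
  obtain ⟨u, hu, hmax⟩ := Finset.exists_max_image
    ((Finset.Icc 1 n).filter fun u => inQ u = 1 ∧ D u ≤ D x) ht
    ⟨x, Finset.mem_filter.2 ⟨Finset.mem_Icc.2 (h.rng x hx), hx, le_rfl⟩⟩
  obtain ⟨hu0, hu1, hu2⟩ := Finset.mem_filter.1 hu
  refine ⟨u, hu1, ?_, hu2⟩
  by_contra hp
  have h1 := h.parQ u hp
  have h2 := hmax (par u) (Finset.mem_filter.2
    ⟨Finset.mem_Icc.2 (h.rng _ h1.2.1), h1.2.1, (hD u hp).trans hu2⟩)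
  have h3 := hht u hp
  omega

theorem sum_length_update {S : Finset ℕ} {x : ℕ} (hx : x ∈ S) (f : ℕ → List ℕ) (l : List ℕ) :
    ∑ y ∈ S, (Function.update f x l y).length + (f x).length =
      ∑ y ∈ S, (f y).length + l.length := by
  rw [← sum_update_add hx (fun y => (f y).length) l.length]
  congr 1
  refine Finset.sum_congr rfl fun y _ => ?_
  by_cases e : y = x
  · subst e; simp
  · simp [Function.update_of_ne e]

theorem sum_ind_update {S : Finset ℕ} {x : ℕ} (hx : x ∈ S) (f : ℕ → ℕ) (a : ℕ) :
    ∑ y ∈ S, min 1 (Function.update f x a y) + min 1 (f x) =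
      ∑ y ∈ S, min 1 (f y) + min 1 a := by
  rw [← sum_update_add hx (fun y => min 1 (f y)) (min 1 a)]
  congr 1
  refine Finset.sum_congr rfl fun y _ => ?_
  by_cases e : y = x
  · subst e; simp
  · simp [Function.update_of_ne e]

/-! ### Consolidation -/

/-- State of the consolidation: `l` is the list of unprocessed roots, `X` holds the root under
consideration, the other roots are in the table `slot`. -/
structure Cons (n z : ℕ) (s : Mem) (l X : List ℕ) (chd : ℕ → List ℕ) : Prop where
  forest : Forest n (s.a1 .inQ) (s.a1 .par) (s.a1 .deg) (s.a1 .mark) chd 0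
  chdL : ∀ x, IsL s (s.a1 .chd x) (chd x)
  order : ∀ x, s.a1 .par x ≠ 0 → s.wt .D (s.a1 .par x) ≤ s.wt .D x
  zQ : s.a1 .inQ z ≠ 1
  nodup : l.Nodup
  disj : ∀ x ∈ X, x ∉ l
  mem : ∀ x, (s.a1 .inQ x = 1 ∧ s.a1 .par x = 0) ↔
    (x ∈ X ∨ (x ∈ l ∧ x ≠ z) ∨ (x ≠ 0 ∧ ∃ r, s.a1 .slot r = x))
  slot : ∀ r, s.a1 .slot r ≠ 0 → s.a1 .deg (s.a1 .slot r) = r ∧ s.a1 .slot r ∉ l ∧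
    s.a1 .slot r ∉ X ∧ r < s.reg .top
  top : s.reg .top ≤ 2 * Nat.log 2 n + 2

/-- The potential during the consolidation. -/
def consPot (n : ℕ) (s : Mem) (l X : List ℕ) (chd : ℕ → List ℕ) : ℕ :=
  60 * l.length + 40 * X.length +
    40 * ∑ r ∈ Finset.range (2 * Nat.log 2 n + 2), min 1 (s.a1 .slot r) +
    80 * ∑ x ∈ Finset.Icc 1 n, s.a1 .mark x + 20 * ∑ x ∈ Finset.Icc 1 n, (chd x).length

/-- Here `a` is whichever of `x` and `y` has the smaller key, and `b` the other. Two roots of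
potential 40 become one, and the new list entry takes 20; the 20 units that remain pay for one round
of linking. -/
theorem Cons.link_of {n z : ℕ} {s s' : Mem} {l : List ℕ} {chd : ℕ → List ℕ} {x y a b r : ℕ}
    (h : Cons n z s l [x] chd) (hr : s.a1 .deg x = r) (hy : s.a1 .slot r = y) (y0 : y ≠ 0)
    (hab : (a = x ∧ b = y) ∨ (a = y ∧ b = x)) (hD : s.wt .D a ≤ s.wt .D b)
    (hQ' : s'.a1 .inQ = s.a1 .inQ) (hp' : s'.a1 .par = Function.update (s.a1 .par) b a)
    (hm' : s'.a1 .mark = Function.update (s.a1 .mark) b 0)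
    (hd' : s'.a1 .deg = Function.update (s.a1 .deg) a (s.a1 .deg a + 1))
    (hs' : s'.a1 .slot = Function.update (s.a1 .slot) r 0)
    (hD' : s'.wt .D = s.wt .D) (ht' : s'.reg .top = s.reg .top)
    (hc' : ∀ u, IsL s' (s'.a1 .chd u) (Function.update chd a (b :: chd a) u)) :
    Cons n z s' l [a] (Function.update chd a (b :: chd a)) ∧
      consPot n s' l [a] (Function.update chd a (b :: chd a)) + 20 = consPot n s l [x] chd := by
  have hf := h.forest
  have hsl := h.slot r (by omega)
  rw [hy] at hsl
  obtain ⟨dy, yl, yx, rt⟩ := hsl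
  have hyx : y ≠ x := by simpa using yx
  have rx := (h.mem x).2 (by simp)
  have ry := (h.mem y).2 (Or.inr (Or.inr ⟨y0, r, hy⟩))
  have hxl := h.disj x (by simp)
  have ha : (s.a1 .inQ a = 1 ∧ s.a1 .par a = 0) ∧ (s.a1 .inQ b = 1 ∧ s.a1 .par b = 0) ∧ a ≠ b ∧
      s.a1 .deg a = r ∧ s.a1 .deg b = r ∧ a ∉ l ∧ b ∉ l := by
    rcases hab with ⟨rfl, rfl⟩ | ⟨rfl, rfl⟩
    · exact ⟨rx, ry, hyx.symm, hr, dy, hxl, yl⟩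
    · exact ⟨ry, rx, hyx, dy, hr, yl, hxl⟩
  obtain ⟨ra, rb, ne, da, db, al, bl⟩ := ha
  have a0 := hf.rng a ra.1
  have b0 := hf.rng b rb.1
  refine ⟨⟨?_, hc', ?_, ?_, h.nodup, ?_, ?_, ?_, ?_⟩, ?_⟩
  · rw [hQ', hp', hd', hm']
    exact hf.link ra.1 rb.1 ra.2 rb.2 ne (da.trans db.symm)
  · intro u
    rw [hp', hD']
    by_cases e : u = b
    · subst e; rw [Function.update_self]; exact fun _ => hD
    · rw [Function.update_of_ne e]; exact h.order u
  · rw [hQ']; exact h.zQ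
  · simpa using al
  · intro u
    rw [hQ', hp', hs', List.mem_singleton]
    by_cases eb : u = b
    · subst eb
      rw [Function.update_self]
      constructor
      · rintro ⟨-, h0⟩; omega
      · rintro (h0 | h0 | ⟨-, r', hr'⟩)
        · exact absurd h0.symm ne
        · exact absurd h0.1 bl
        · by_cases er : r' = r
          · subst er; rw [Function.update_self] at hr'; omega
          · rw [Function.update_of_ne er] at hr'
            have := (h.slot r' (by omega))
            rw [hr', db] at this
            exact absurd this.1.symm er
    · rw [Function.update_of_ne eb, h.mem, List.mem_singleton]
      by_cases ea : u = a
      · subst ea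
        simp only [true_or, iff_true]
        rw [← List.mem_singleton, ← h.mem]
        exact ra
      · have hux : u ≠ x := by rcases hab with ⟨rfl, rfl⟩ | ⟨rfl, rfl⟩ <;> assumption
        have huy : u ≠ y := by rcases hab with ⟨rfl, rfl⟩ | ⟨rfl, rfl⟩ <;> assumption
        simp only [ea, hux, false_or]
        refine or_congr_right (and_congr_right fun u0 => exists_congr fun r' => ?_)
        by_cases er : r' = r
        · subst er
          rw [Function.update_self, hy]
          constructor <;> intro h0 <;> omega
        · rw [Function.update_of_ne er]
  · intro r'
    rw [hs', hd', ht', List.mem_singleton]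
    by_cases er : r' = r
    · subst er; simp
    · rw [Function.update_of_ne er]
      intro h0
      obtain ⟨h1, h2, h3, h4⟩ := h.slot r' h0
      have hne : s.a1 .slot r' ≠ a := by
        intro e
        rw [e, da] at h1
        exact er h1.symm
      rw [Function.update_of_ne hne]
      exact ⟨h1, h2, hne, h4⟩
  · rw [ht']; exact h.top
  · have hrB : r ∈ Finset.range (2 * Nat.log 2 n + 2) := by
      have := h.top
      rw [Finset.mem_range]
      omega
    have e1 := sum_ind_update hrB (s.a1 .slot) 0
    rw [← hs', hy, min_eq_left (show 1 ≤ y by omega)] at e1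
    have e2 := sum_length_update (Finset.mem_Icc.2 a0) chd (b :: chd a)
    have e3 : s'.a1 .mark = s.a1 .mark := by
      rw [hm', ← hf.mark_root b rb.2]
      exact Function.update_eq_self _ _
    simp only [consPot, e3, List.length_cons] at e2 ⊢
    omega

/-- Invariant of the repeated linking. -/
def Linking (n z T p : ℕ) (l : List ℕ) (t : ℕ) (s : Mem) : Prop :=
  ∃ chd, Cons n z s l [s.reg .x] chd ∧ s.a1 .deg (s.reg .x) = s.reg .r ∧ s.reg .p = p ∧ IsL s p l ∧
    s.a1 .roots 0 = 0 ∧ s.reg .z = z ∧ t + consPot n s l [s.reg .x] chd ≤ T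

theorem linking_spec {n z T p t : ℕ} {l : List ℕ} {s : Mem} (h : Linking n z T p l t s) :
    wp (.loop (.lt 0 (get1 .slot Reg.r)) (block [
          .assign .y (get1 .slot Reg.r),
          write1 .slot Reg.r 0,
          when (.wlt (dOf Reg.y) (dOf Reg.x)) (block [
            .assign .tmp Reg.x,
            .assign .x Reg.y,
            .assign .y Reg.tmp]),
          link,
          .assign .r (Reg.r + 1)])) t s fun t' s' =>
      Linking n z (T + 1) p l t' s' ∧ s'.a1 .slot (s'.reg .r) = 0 := by
  refine wp_loop_of_bound (Linking n z T p l) T ?_ ?_ ?_ h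
  · rintro t s ⟨chd, -, -, -, -, -, -, hT⟩
    omega
  · rintro t s ⟨chd, hC, hr, hp, hl, hroots, hz, hT⟩ hb
    simp only [Test.holds_lt, Expr.eval_zero, eval_get1, Expr.eval_reg] at hb
    set x := s.reg .x with hx
    set r := s.reg .r with hrr
    obtain ⟨y, hy⟩ : ∃ y, s.a1 .slot r = y := ⟨_, rfl⟩
    rw [hy] at hb
    rw [block, wp_seq, wp_assign, block, wp_seq, wp_write1, block, wp_seq]
    simp only [eval_get1, Expr.eval_reg, ← hrr, hy, Expr.eval_zero, Mem.reg_setReg, reduceCtorEq,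
      if_false]
    set s1 := (s.setReg .y y).setArr .slot r 0 0 with hs1
    have hx1 : Extends s s1 := (s.extends_setReg (by decide) _).trans
      (Mem.extends_setArr _ (by decide) (by decide) _ _ _)
    have ha1 : ∀ a, a ≠ .slot → s1.a1 a = s.a1 a := fun a ha => by simp [hs1, ha]
    have hs1s : s1.a1 .slot = Function.update (s.a1 .slot) r 0 := by simp [hs1]
    have hr1 : ∀ q, q ≠ .y → s1.reg q = s.reg q := fun q hq => by simp [hs1, hq]
    have hy1 : s1.reg .y = y := by simp [hs1]
    have hw1 : s1.wt = s.wt := rfl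
    clear_value s1
    refine wp.mono (Q := fun t' s' => t' ≤ t + 7 ∧ s'.a1 = s1.a1 ∧ s'.wt = s1.wt ∧
      (∀ q, q ≠ .x → q ≠ .y → q ≠ .tmp → s'.reg q = s1.reg q) ∧
      ((s'.reg .x = x ∧ s'.reg .y = y) ∨ (s'.reg .x = y ∧ s'.reg .y = x)) ∧
      s.wt .D (s'.reg .x) ≤ s.wt .D (s'.reg .y)) ?_ ?_
    · rw [wp_when]
      simp only [Test.holds_wlt, eval_dOf, Expr.eval_reg, hy1, hr1 .x (by decide), hw1, ← hx]
      constructor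
      · intro hlt
        simp only [block, wp_seq, wp_assign, Expr.eval_reg, Mem.reg_setReg, reduceCtorEq, if_false,
          if_true, hy1, hr1 .x (by decide), ← hx]
        refine ⟨by omega, rfl, hw1, ?_, by simp, hlt.le⟩
        intro q h1 h2 h3
        simp [h1, h2, h3]
      · intro hlt
        exact ⟨by omega, trivial, trivial, by simp, by simp, not_lt.1 hlt⟩
    · rintro t' s2 ⟨ht', ha2, hw2, hr2, hab, hD⟩
      have hab' := hab
      obtain ⟨a, ha⟩ : ∃ a, s2.reg .x = a := ⟨_, rfl⟩
      obtain ⟨b, hb'⟩ : ∃ b, s2.reg .y = b := ⟨_, rfl⟩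
      rw [ha, hb'] at hab hD
      have hne : a ≠ b := by
        have := (hC.slot r (by omega)).2.2.1
        rw [hy, List.mem_singleton] at this
        rcases hab with ⟨rfl, rfl⟩ | ⟨rfl, rfl⟩
        · exact Ne.symm this
        · exact this
      have h1 : ∀ x : Reg, x ≠ .cell → Expr.noCell (.reg x) = true := fun x hx => by
        simp [Expr.noCell, hx]
      have hx2 : Extends s s2 := hx1.trans (.of_eq (hr2 _ (by decide) (by decide) (by decide))
        (by rw [ha2]) (by rw [ha2]))
      simp only [block, link, wp_seq, wp_write1, wp_push (h1 .x (by decide)) (h1 .y (by decide))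
        (show Arr.chd ≠ .elt by decide), Expr.eval_reg, Expr.eval_zero, Mem.reg_setArr, ha, hb',
        eval_get1, wp_assign, Mem.reg_pushed, reduceCtorEq, if_false, Expr.eval_add, Expr.eval_one]
      set s3 := (s2.setArr .par b 0 a).setArr .mark b 0 0 with hs3
      have hx3 : Extends s s3 := (hx2.trans (Mem.extends_setArr _ (by decide) (by decide) _ _ _)).trans
        (Mem.extends_setArr _ (by decide) (by decide) _ _ _)
      have h3c : s3.a1 .chd = s.a1 .chd := by simp [hs3, ha2, ha1]
      have h3d : s3.a1 .deg = s.a1 .deg := by simp [hs3, ha2, ha1]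
      have h3p : s3.a1 .par = Function.update (s.a1 .par) b a := by simp [hs3, ha2, ha1]
      have h3m : s3.a1 .mark = Function.update (s.a1 .mark) b 0 := by simp [hs3, ha2, ha1]
      have h3q : s3.a1 .inQ = s.a1 .inQ := by simp [hs3, ha2, ha1]
      have h3s : s3.a1 .slot = Function.update (s.a1 .slot) r 0 := by simp [hs3, ha2, hs1s]
      have h3r : s3.a1 .roots = s.a1 .roots := by simp [hs3, ha2, ha1]
      have h3w : s3.wt = s.wt := by simp [hs3, hw2, hw1]
      have h3g : ∀ q, q ≠ .x → q ≠ .y → q ≠ .tmp → s3.reg q = s.reg q := fun q h1 h2 h3 => by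
        simp [hs3, hr2 q h1 h2 h3, hr1 q h2]
      have h3x : s3.reg .x = a := ha
      clear_value s3
      rw [Mem.a1_pushed _ _ _ (by decide) (by decide), if_neg (by decide), h3d]
      rw [hr2 .r (by decide) (by decide) (by decide), hr1 .r (by decide), ← hrr]
      set s4 := ((s3.pushed .chd a b).setArr .deg a 0 (s.a1 .deg a + 1)).setReg .r (r + 1) with hs4
      have h34 : Extends (s3.pushed .chd a b) s4 :=
        (Mem.extends_setArr _ (by decide) (by decide) _ _ _).trans
          (Mem.extends_setReg _ (by decide) _)
      have hp34 : Extends s3 (s3.pushed .chd a b) := s3.extends_pushed _ _ (by decide) (by decide)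
      have h4ne : ∀ a', a' ≠ .deg → a' ≠ .chd → a' ≠ .elt → a' ≠ .nxt → s4.a1 a' = s3.a1 a' := by
        intro a' h1 h2 h3 h4
        simp [hs4, h1, h2, h3, h4]
      have h4g : ∀ q, q ≠ .x → q ≠ .y → q ≠ .tmp → q ≠ .cell → q ≠ .r → s4.reg q = s.reg q := by
        intro q h1 h2 h3 h4 h5
        simp [hs4, h4, h5, h3g q h1 h2 h3]
      have h4x : s4.reg .x = a := by simp [hs4, h3x]
      have h4r : s4.reg .r = r + 1 := by simp [hs4]
      have h4d : s4.a1 .deg = Function.update (s.a1 .deg) a (s.a1 .deg a + 1) := by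
        simp [hs4, h3d]
      have h4c : s4.a1 .chd = Function.update (s.a1 .chd) a (s3.reg .cell + 1) := by
        simp [hs4, h3c]
      have h4w : s4.wt = s.wt := by simp [hs4, h3w]
      clear_value s4
      obtain ⟨hC', hpot⟩ := hC.link_of (s' := s4) hr hy (by omega) hab hD
        (by rw [h4ne _ (by decide) (by decide) (by decide) (by decide), h3q])
        (by rw [h4ne _ (by decide) (by decide) (by decide) (by decide), h3p])
        (by rw [h4ne _ (by decide) (by decide) (by decide) (by decide), h3m]) h4d
        (by rw [h4ne _ (by decide) (by decide) (by decide) (by decide), h3s])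
        (by rw [h4w]) (h4g _ (by decide) (by decide) (by decide) (by decide) (by decide)) (by
          intro u
          rw [h4c]
          by_cases e : u = a
          · subst e
            rw [Function.update_self, Function.update_self]
            refine IsL.mono h34 (IsL.pushed ?_ (by decide) (by decide))
            rw [h3c]
            exact (hC.chdL u).mono hx3
          · rw [Function.update_of_ne e, Function.update_of_ne e]
            exact (hC.chdL u).mono (hx3.trans (hp34.trans h34)))
      refine ⟨_, by rw [h4x]; exact hC', ?_, ?_, ?_, ?_, ?_, ?_⟩
      · rw [h4x, h4d, h4r, Function.update_self]
        congr 1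
        rcases hab with ⟨rfl, rfl⟩ | ⟨rfl, rfl⟩
        · exact hr
        · have := (hC.slot r (by omega)).1
          rwa [hy] at this
      · rw [h4g _ (by decide) (by decide) (by decide) (by decide) (by decide), hp]
      · exact hl.mono (hx3.trans (hp34.trans h34))
      · rw [h4ne _ (by decide) (by decide) (by decide) (by decide), h3r, hroots]
      · rw [h4g _ (by decide) (by decide) (by decide) (by decide) (by decide), hz]
      · rw [h4x]
        omega
  · rintro t s ⟨chd, hC, hr, hp, hl, hroots, hz, hT⟩ hb
    simp only [Test.holds_lt, Expr.eval_zero, eval_get1, Expr.eval_reg] at hb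
    exact ⟨⟨chd, hC, hr, hp, hl, hroots, hz, by omega⟩, by omega⟩

/-- Invariant of the main loop of the consolidation. -/
def Consolidating (n z T t : ℕ) (s : Mem) : Prop :=
  ∃ l chd, Cons n z s l [] chd ∧ IsL s (s.reg .p) l ∧ s.a1 .roots 0 = 0 ∧ s.reg .z = z ∧
    t + consPot n s l [] chd ≤ T

theorem Cons.congr {n z : ℕ} {s s' : Mem} {l X : List ℕ} {chd : ℕ → List ℕ}
    (h : Cons n z s l X chd) (hx : Extends s s') (ha : s'.a1 = s.a1)
    (hw : s'.wt = s.wt) (ht : s'.reg .top = s.reg .top) : Cons n z s' l X chd := by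
  refine ⟨?_, ?_, ?_, ?_, h.nodup, h.disj, ?_, ?_, ?_⟩
  · rw [ha]; exact h.forest
  · rw [ha]; exact fun x => (h.chdL x).mono hx
  · rw [ha, hw]; exact h.order
  · rw [ha]; exact h.zQ
  · rw [ha]; exact h.mem
  · rw [ha, ht]; exact h.slot
  · rw [ht]; exact h.top

/-- The deleted root is still in the list of roots, but it is out of the queue, so it is dropped
when it is met. -/
theorem Cons.skip {n z : ℕ} {s : Mem} {l : List ℕ} {chd : ℕ → List ℕ}
    (h : Cons n z s (z :: l) [] chd) : Cons n z s l [] chd where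
  __ := h
  nodup := (List.nodup_cons.1 h.nodup).2
  disj := by simp
  mem x := by
    rw [h.mem, List.mem_cons]
    tauto
  slot r hr := by
    have := h.slot r hr
    simp only [List.mem_cons, not_or] at this
    tauto

theorem Cons.pick {n z : ℕ} {s : Mem} {x : ℕ} {l : List ℕ} {chd : ℕ → List ℕ}
    (h : Cons n z s (x :: l) [] chd) (hx : x ≠ z) : Cons n z s l [x] chd where
  __ := h
  nodup := (List.nodup_cons.1 h.nodup).2
  disj := by simpa using (List.nodup_cons.1 h.nodup).1
  mem u := by
    rw [h.mem, List.mem_cons, List.mem_singleton]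
    have : u = x → u ≠ z := by rintro rfl; exact hx
    simp only [List.not_mem_nil, false_or]
    tauto
  slot r hr := by
    have := h.slot r hr
    simp only [List.mem_cons, not_or] at this
    simp only [List.mem_singleton]
    tauto

/-- The degree bound `deg_le` keeps the index `r` within the range summed in `consPot`, so the root
retains its 40 units when it moves from hand into the table. -/
theorem Cons.put {n z : ℕ} {s s' : Mem} {x r : ℕ} {l : List ℕ} {chd : ℕ → List ℕ}
    (h : Cons n z s l [x] chd) (hd : s.a1 .deg x = r) (hr : s.a1 .slot r = 0)
    (hs : s'.a1 .slot = Function.update (s.a1 .slot) r x)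
    (ha : ∀ a ∈ [Arr.inQ, .par, .deg, .mark, .chd], s'.a1 a = s.a1 a)
    (hx : Extends s s') (hw : s'.wt = s.wt) (ht : s'.reg .top = max (s.reg .top) (r + 1)) :
    Cons n z s' l [] chd ∧ consPot n s' l [] chd = consPot n s l [x] chd := by
  have hf := h.forest
  have rx := (h.mem x).2 (by simp)
  have x0 := hf.rng x rx.1
  have hxl := h.disj x (by simp)
  have hdeg := hf.deg_le rx.1
  simp only [List.mem_cons, List.not_mem_nil, or_false, forall_eq_or_imp, forall_eq] at ha
  obtain ⟨hQ, hp, hdg, hm, hc⟩ := ha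
  refine ⟨⟨?_, ?_, ?_, ?_, h.nodup, by simp, ?_, ?_, ?_⟩, ?_⟩
  · rw [hQ, hp, hdg, hm]; exact hf
  · rw [hc]; exact fun u => (h.chdL u).mono hx
  · rw [hp, hw]; exact h.order
  · rw [hQ]; exact h.zQ
  · intro u
    rw [hQ, hp, hs, h.mem, List.mem_singleton]
    simp only [List.not_mem_nil, false_or]
    by_cases e : u = x
    · subst e
      simp only [true_or, true_iff]
      exact Or.inr ⟨by omega, r, by simp⟩
    · simp only [e, false_or]
      refine or_congr_right (and_congr_right fun u0 => exists_congr fun r' => ?_)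
      by_cases er : r' = r
      · subst er
        rw [Function.update_self, hr]
        constructor <;> intro h0 <;> omega
      · rw [Function.update_of_ne er]
  · intro r'
    rw [hs, hdg, ht]
    by_cases er : r' = r
    · subst er
      rw [Function.update_self]
      intro _
      exact ⟨hd, hxl, by simp, by omega⟩
    · rw [Function.update_of_ne er]
      intro h0
      obtain ⟨h1, h2, -, h4⟩ := h.slot r' h0
      exact ⟨h1, h2, by simp, by omega⟩
  · rw [ht]
    have := h.top
    omega
  · have hrB : r ∈ Finset.range (2 * Nat.log 2 n + 2) := by
      rw [Finset.mem_range]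
      omega
    have e1 := sum_ind_update hrB (s.a1 .slot) x
    rw [← hs, hr, min_eq_left (show 1 ≤ x by omega)] at e1
    simp only [consPot, hm, List.length_cons, List.length_nil]
    omega

theorem consolidating_spec {n z T t : ℕ} {s : Mem} (h : Consolidating n z T t s) :
    wp (.loop (.lt 0 Reg.p) (block [
      .assign .x (eltAt .p),
      .assign .p (get1 .nxt Reg.p),
      .ite (.eq Reg.x Reg.z) .skip (block [
        .assign .r (get1 .deg Reg.x),
        .loop (.lt 0 (get1 .slot Reg.r)) (block [
          .assign .y (get1 .slot Reg.r),
          write1 .slot Reg.r 0,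
          when (.wlt (dOf Reg.y) (dOf Reg.x)) (block [
            .assign .tmp Reg.x,
            .assign .x Reg.y,
            .assign .y Reg.tmp]),
          link,
          .assign .r (Reg.r + 1)]),
        write1 .slot Reg.r Reg.x,
        when (.lt Reg.top (Reg.r + 1)) (.assign .top (Reg.r + 1))])])) t s fun t' s' =>
      ∃ chd, Cons n z s' [] [] chd ∧ s'.a1 .roots 0 = 0 ∧ t' + consPot n s' [] [] chd ≤ T + 1 := by
  refine wp_loop_of_bound (Consolidating n z T) T ?_ ?_ ?_ h
  · rintro t s ⟨l, chd, -, -, -, -, hT⟩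
    omega
  · rintro t s ⟨l, chd, hC, hl, hroots, hz, hT⟩ hb
    simp only [Test.holds_lt, Expr.eval_zero, Expr.eval_reg] at hb
    cases l with
    | nil => rw [IsL] at hl; omega
    | cons x l =>
    obtain ⟨h0, h1, h2, h3⟩ := hl
    rw [block, wp_seq, wp_assign, block, wp_seq, wp_assign, block]
    simp only [eval_eltAt, h2, eval_get1, Expr.eval_reg, Mem.reg_setReg, reduceCtorEq, if_false,
      Mem.a1_setReg]
    set s1 := (s.setReg .x x).setReg .p (s.a1 .nxt (s.reg .p)) with hs1
    have hx1 : Extends s s1 := (s.extends_setReg (by decide) _).trans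
      (Mem.extends_setReg _ (by decide) _)
    have ha1 : s1.a1 = s.a1 := rfl
    have hw1 : s1.wt = s.wt := rfl
    have ht1 : s1.reg .top = s.reg .top := by simp [hs1]
    have hx : s1.reg .x = x := by simp [hs1]
    have hp : s1.reg .p = s.a1 .nxt (s.reg .p) := by simp [hs1]
    have hz1 : s1.reg .z = z := by simp [hs1, hz]
    clear_value s1
    have hC1 := hC.congr hx1 ha1 hw1 ht1
    have hpot : consPot n s1 (x :: l) [] chd ≤ consPot n s (x :: l) [] chd := by
      simp [consPot, ha1]
    simp only [wp_ite, Test.holds_eq, Expr.eval_reg, hx, hz1]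
    constructor
    · rintro rfl
      rw [wp_skip]
      refine ⟨l, chd, hC1.skip, by rw [hp]; exact h3.mono hx1, by rw [ha1, hroots], hz1, ?_⟩
      simp only [consPot, List.length_cons] at hT hpot ⊢
      omega
    · intro hxz
      have hC2 := hC1.pick hxz
      have hT60 : 60 ≤ T := by
        simp only [consPot, List.length_cons] at hT
        omega
      rw [block, wp_seq, wp_assign, block, wp_seq]
      simp only [eval_get1, Expr.eval_reg, hx]
      -- Taking `x` in hand releases 20 units, 60 against 40. Five steps are spent so far, and 12
      -- units are set aside for the exit from the linking loop and for storing `x`.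
      refine (linking_spec (n := n) (z := z) (T := T - 12) (p := s.a1 .nxt (s.reg .p)) (l := l)
        ⟨chd, ?_, ?_, ?_, ?_, ?_, ?_, ?_⟩).mono ?_
      · simp only [Mem.reg_setReg, reduceCtorEq, if_false, hx]
        exact hC2.congr (Mem.extends_setReg _ (by decide) _) rfl rfl (by simp)
      · simp [hx]
      · simp [hp]
      · exact h3.mono (hx1.trans (Mem.extends_setReg _ (by decide) _))
      · simp [ha1, hroots]
      · simp [hz1]
      · simp only [consPot, List.length_cons, Mem.reg_setReg, reduceCtorEq, if_false, hx,
          Mem.a1_setReg, List.length_nil] at hT hpot ⊢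
        omega
      · rintro t2 s2 ⟨⟨chd2, hC2, hr2, hp2, hl2, hroots2, hz2, hT2⟩, hs2⟩
        rw [block, wp_seq, wp_write1, block, wp_when]
        simp only [Expr.eval_reg, Test.holds_lt, Expr.eval_add, Expr.eval_one, Mem.reg_setArr,
          wp_assign]
        have hx2 : Extends s2 (s2.setArr .slot (s2.reg .r) 0 (s2.reg .x)) :=
          Mem.extends_setArr _ (by decide) (by decide) _ _ _
        constructor <;> intro hlt
        · obtain ⟨hC3, hpot3⟩ := hC2.put (s' := (s2.setArr .slot (s2.reg .r) 0
            (s2.reg .x)).setReg .top (s2.reg .r + 1)) hr2 hs2 (by simp)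
            (fun a ha => by
              have : a ≠ .slot := by rintro rfl; simp at ha
              simp [this])
            (hx2.trans (Mem.extends_setReg _ (by decide) _)) rfl (by
              simp only [Mem.reg_setReg, if_true]; omega)
          refine ⟨l, chd2, hC3, ?_, by simp [hroots2], by simp [hz2], by omega⟩
          simp only [Mem.reg_setReg, Mem.reg_setArr, reduceCtorEq, if_false, hp2]
          exact hl2.mono (hx2.trans (Mem.extends_setReg _ (by decide) _))
        · obtain ⟨hC3, hpot3⟩ := hC2.put (s' := s2.setArr .slot (s2.reg .r) 0
            (s2.reg .x)) hr2 hs2 (by simp)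
            (fun a ha => by
              have : a ≠ .slot := by rintro rfl; simp at ha
              simp [this])
            hx2 rfl (by simp only [Mem.reg_setArr]; omega)
          refine ⟨l, chd2, hC3, ?_, by simp [hroots2], by simp [hz2], by omega⟩
          simp only [Mem.reg_setArr, hp2]
          exact hl2.mono hx2
  · rintro t s ⟨l, chd, hC, hl, hroots, hz, hT⟩ hb
    simp only [Test.holds_lt, Expr.eval_zero, Expr.eval_reg] at hb
    have : s.reg .p = 0 := by omega
    rw [this, IsL.zero_iff] at hl
    subst hl
    exact ⟨chd, hC, hroots, by omega⟩

/-- Invariant of the loop that rebuilds the list of roots. -/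
structure Rebuild (n T t : ℕ) (s : Mem) (R : List ℕ) (chd : ℕ → List ℕ) : Prop where
  forest : Forest n (s.a1 .inQ) (s.a1 .par) (s.a1 .deg) (s.a1 .mark) chd 0
  chdL : ∀ x, IsL s (s.a1 .chd x) (chd x)
  order : ∀ x, s.a1 .par x ≠ 0 → s.wt .D (s.a1 .par x) ≤ s.wt .D x
  rootsL : IsL s (s.a1 .roots 0) R
  nodup : R.Nodup
  mem : ∀ x, (s.a1 .inQ x = 1 ∧ s.a1 .par x = 0) ↔
    (x ∈ R ∨ (x ≠ 0 ∧ ∃ r, s.a1 .slot r = x))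
  slot : ∀ r, s.a1 .slot r ≠ 0 → s.a1 .deg (s.a1 .slot r) = r ∧ s.a1 .slot r ∉ R ∧ r < s.reg .top
  min_zero : s.reg .minv = 0 → R = []
  min_le : s.reg .minv ≠ 0 → s.reg .minv ∈ R ∧ ∀ x ∈ R, s.wt .D (s.reg .minv) ≤ s.wt .D x
  time : t + 80 * s.reg .top + potential n s R chd ≤ T

/-- Each remaining table index carries 80 units: 60 for the root that it may hold, the rest for the
steps of its round. The table is empty at the end, since occupied indices lie below `top`. -/
theorem rebuild_spec {n T t : ℕ} {s : Mem} (h : ∃ R chd, Rebuild n T t s R chd) :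
    wp (.loop (.lt 0 Reg.top) (block [
      .assign .top (Reg.top - 1),
      .assign .x (get1 .slot Reg.top),
      when (.lt 0 Reg.x) (block [
        write1 .slot Reg.top 0,
        makeRoot .x,
        updateMin .x])])) t s fun t' s' => Heap n s' 0 t' (T + 1) := by
  refine wp_loop_of_bound (fun t s => ∃ R chd, Rebuild n T t s R chd) T ?_ ?_ ?_ h
  · rintro t s ⟨R, chd, h⟩
    have := h.time
    omega
  · rintro t s ⟨R, chd, h⟩ hb
    have hf := h.forest
    simp only [Test.holds_lt, Expr.eval_zero, Expr.eval_reg] at hb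
    obtain ⟨r, hr⟩ : ∃ r, s.reg .top = r + 1 := ⟨s.reg .top - 1, by omega⟩
    obtain ⟨x, hx⟩ : ∃ x, s.a1 .slot r = x := ⟨_, rfl⟩
    rw [block, wp_seq, wp_assign, block, wp_seq, wp_assign, block, wp_when]
    simp only [Expr.eval_sub, Expr.eval_reg, hr, Expr.eval_one, Nat.add_sub_cancel, eval_get1,
      Mem.a1_setReg, Mem.reg_setReg, if_true, hx, Test.holds_lt, Expr.eval_zero]
    have hT := h.time
    rw [hr] at hT
    constructor
    · intro x0
      rw [block, wp_seq, wp_write1, block, wp_seq, wp_makeRoot (by decide), block]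
      simp only [Expr.eval_reg, Mem.reg_setReg, reduceCtorEq, if_false, if_true, Expr.eval_zero,
        Mem.reg_setArr]
      set s1 := (((s.setReg .top r).setReg .x x).setArr .slot r 0 0) with hs1
      have hx1 : Extends s s1 := ((s.extends_setReg (by decide) _).trans
        (Mem.extends_setReg _ (by decide) _)).trans
        (Mem.extends_setArr _ (by decide) (by decide) _ _ _)
      have ha1 : ∀ a, a ≠ .slot → s1.a1 a = s.a1 a := fun a ha => by simp [hs1, ha]
      have hsl1 : s1.a1 .slot = Function.update (s.a1 .slot) r 0 := by simp [hs1]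
      have hm1 : s1.reg .minv = s.reg .minv := by simp [hs1]
      have ht1 : s1.reg .top = r := by simp [hs1]
      have hxx1 : s1.reg .x = x := by simp [hs1]
      have hw1 : s1.wt = s.wt := rfl
      clear_value s1
      have rx := (h.mem x).2 (Or.inr ⟨by omega, r, hx⟩)
      have hslr := h.slot r (by omega)
      rw [hx] at hslr
      have e1 : Function.update (s.a1 .par) x 0 = s.a1 .par := by
        rw [← rx.2]; exact Function.update_eq_self _ _
      have e2 : Function.update (s.a1 .mark) x 0 = s.a1 .mark := by
        rw [← hf.mark_root _ rx.2]; exact Function.update_eq_self _ _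
      have hx2 : Extends s (s1.rooted x) := hx1.trans (Mem.extends_rooted _ _)
      have hR2 : IsL (s1.rooted x) ((s1.rooted x).a1 .roots 0) (x :: R) := by
        refine IsL.rooted ?_ x
        rw [ha1 _ (by decide)]
        exact h.rootsL.mono hx1
      have ha2 : ∀ a, a ≠ .slot → a ≠ .roots → a ≠ .elt → a ≠ .nxt →
          (s1.rooted x).a1 a = s.a1 a := by
        intro a h1 h2 h3 h4
        by_cases ep : a = .par
        · rw [ep, Mem.par_rooted, ha1 _ (by decide), e1]
        · by_cases em : a = .mark
          · rw [em, Mem.mark_rooted, ha1 _ (by decide), e2]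
          · rw [Mem.a1_rooted _ _ ep em h2 h3 h4, ha1 _ h1]
      have hsl2 : (s1.rooted x).a1 .slot = Function.update (s.a1 .slot) r 0 := by
        rw [Mem.a1_rooted _ _ (by decide) (by decide) (by decide) (by decide) (by decide), hsl1]
      have hm2 : (s1.rooted x).reg .minv = s.reg .minv := by
        rw [Mem.reg_rooted _ _ (by decide), hm1]
      have ht2 : (s1.rooted x).reg .top = r := by
        rw [Mem.reg_rooted _ _ (by decide), ht1]
      have hxx2 : (s1.rooted x).reg .x = x := by
        rw [Mem.reg_rooted _ _ (by decide), hxx1]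
      have hw2 : (s1.rooted x).wt = s.wt := by
        rw [Mem.wt_rooted, hw1]
      generalize s1.rooted x = s2 at *
      refine wp_updateMin fun t' a ht' ha ha' => ?_
      rw [hm2, hxx2, hw2] at ha ha'
      have hx3 : Extends s (s2.setReg .minv a) := hx2.trans (Mem.extends_setReg _ (by decide) _)
      refine ⟨x :: R, chd, ?_, ?_, ?_, ?_, ?_, ?_, ?_, ?_, ?_, ?_⟩
      · simp only [Mem.a1_setReg]
        rw [ha2, ha2, ha2, ha2]
        · exact hf
        all_goals decide
      · intro u
        rw [Mem.a1_setReg, ha2 _ (by decide) (by decide) (by decide) (by decide)]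
        exact (h.chdL u).mono hx3
      · rw [Mem.a1_setReg, Mem.wt_setReg, hw2, ha2 _ (by decide) (by decide) (by decide) (by decide)]
        exact h.order
      · exact hR2.mono (Mem.extends_setReg _ (by decide) _)
      · exact List.nodup_cons.2 ⟨hslr.2.1, h.nodup⟩
      · intro u
        simp only [Mem.a1_setReg]
        rw [ha2 _ (by decide) (by decide) (by decide) (by decide),
          ha2 _ (by decide) (by decide) (by decide) (by decide), hsl2, h.mem, List.mem_cons]
        by_cases e : u = x
        · subst e
          simp only [true_or, iff_true]
          exact Or.inr ⟨by omega, r, hx⟩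
        · simp only [e, false_or]
          refine or_congr_right (and_congr_right fun u0 => exists_congr fun r' => ?_)
          by_cases er : r' = r
          · subst er
            rw [Function.update_self, hx]
            constructor <;> intro h0 <;> omega
          · rw [Function.update_of_ne er]
      · intro r'
        simp only [Mem.a1_setReg, Mem.reg_setReg, reduceCtorEq, if_false, ht2]
        rw [hsl2, ha2 _ (by decide) (by decide) (by decide) (by decide)]
        by_cases er : r' = r
        · subst er; simp
        · rw [Function.update_of_ne er]
          intro h0
          obtain ⟨h1, h2, h3⟩ := h.slot r' h0
          refine ⟨h1, ?_, by omega⟩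
          rw [List.mem_cons, not_or]
          refine ⟨fun e => ?_, h2⟩
          rw [e, hslr.1] at h1
          exact er h1.symm
      · simp only [Mem.reg_setReg, if_true]
        intro a0
        by_cases h' : s.reg .minv = 0 ∨ s.wt .D x < s.wt .D (s.reg .minv)
        · have := ha h'; omega
        · have := ha' h'; push Not at h'; omega
      · simp only [Mem.reg_setReg, if_true, Mem.wt_setReg, hw2]
        intro a0
        by_cases h' : s.reg .minv = 0 ∨ s.wt .D x < s.wt .D (s.reg .minv)
        · rw [ha h']
          refine ⟨by simp, ?_⟩
          intro u hu
          rw [List.mem_cons] at hu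
          rcases hu with rfl | hu
          · exact le_rfl
          · have m0 : s.reg .minv ≠ 0 := by
              intro m0
              rw [h.min_zero m0] at hu
              simp at hu
            exact (h'.resolve_left m0).le.trans ((h.min_le m0).2 u hu)
        · rw [ha' h']
          push Not at h'
          refine ⟨List.mem_cons_of_mem _ (h.min_le h'.1).1, ?_⟩
          intro u hu
          rw [List.mem_cons] at hu
          rcases hu with rfl | hu
          · exact h'.2
          · exact (h.min_le h'.1).2 u hu
      · simp only [Mem.reg_setReg, reduceCtorEq, if_false, ht2, potential, Mem.a1_setReg,
          List.length_cons] at hT ⊢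
        rw [ha2 _ (by decide) (by decide) (by decide) (by decide)]
        omega
    · intro x0
      have hx0 : x = 0 := by omega
      have hxs : Extends s ((s.setReg .top r).setReg .x x) :=
        (s.extends_setReg (by decide) _).trans (Mem.extends_setReg _ (by decide) _)
      refine ⟨R, chd, hf, fun u => (h.chdL u).mono hxs, h.order, h.rootsL.mono hxs, h.nodup, h.mem,
        ?_, ?_, ?_, ?_⟩
      · intro r' h0
        obtain ⟨h1, h2, h3⟩ := h.slot r' h0
        refine ⟨h1, h2, ?_⟩
        simp only [Mem.reg_setReg, reduceCtorEq, if_false, if_true]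
        have : r' ≠ r := by
          rintro rfl
          exact h0 (hx.trans hx0)
        omega
      · simpa using h.min_zero
      · simpa using h.min_le
      · simp only [Mem.reg_setReg, reduceCtorEq, if_false, if_true]
        unfold potential at hT ⊢
        simp only [Mem.a1_setReg]
        omega
  · rintro t s ⟨R, chd, h⟩ hb
    simp only [Test.holds_lt, Expr.eval_zero, Expr.eval_reg] at hb
    have hsl : ∀ r, s.a1 .slot r = 0 := by
      intro r
      by_contra h0
      have := (h.slot r h0).2.2
      omega
    have hmem : ∀ x, (s.a1 .inQ x = 1 ∧ s.a1 .par x = 0) ↔ x ∈ R := by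
      intro x
      rw [h.mem]
      simp only [hsl]
      refine or_iff_left ?_
      rintro ⟨h1, -, h2⟩
      exact h1 h2.symm
    have hne : ∀ x, s.a1 .inQ x = 1 → s.reg .minv ≠ 0 ∧ s.wt .D (s.reg .minv) ≤ s.wt .D x := by
      intro x hx
      -- A minimum over the roots is a minimum over the whole queue, by heap order.
      obtain ⟨u, hu1, hu2, hu3⟩ := h.forest.exists_root h.order hx
      have hu := (hmem u).1 ⟨hu1, hu2⟩
      have m0 : s.reg .minv ≠ 0 := by
        intro m0
        rw [h.min_zero m0] at hu
        simp at hu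
      exact ⟨m0, ((h.min_le m0).2 u hu).trans hu3⟩
    refine ⟨R, chd, ⟨h.forest, h.rootsL, h.nodup, fun x => (hmem x).symm, h.chdL⟩,
      fun x _ => h.order x, ⟨fun x hx => (hne x hx).1, fun x _ hx => (hne x hx).2, fun m0 =>
      (hmem _).2 (h.min_le m0).1⟩, hsl, ?_⟩
    have := h.time
    omega

/-- The old potential of the roots pays for the linking. The new cost is `80 * top` for rebuilding
the list, where `top ≤ 2 * Nat.log 2 n + 2`, and a few single steps. -/
theorem consolidate_spec {n z T t : ℕ} {s : Mem} {R : List ℕ} {chd : ℕ → List ℕ}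
    (hf : Forest n (s.a1 .inQ) (s.a1 .par) (s.a1 .deg) (s.a1 .mark) chd 0)
    (hchd : ∀ x, IsL s (s.a1 .chd x) (chd x))
    (hO : ∀ x, s.a1 .par x ≠ 0 → s.wt .D (s.a1 .par x) ≤ s.wt .D x)
    (hz : s.reg .z = z) (zQ : s.a1 .inQ z ≠ 1) (hR : IsL s (s.a1 .roots 0) R) (hnd : R.Nodup)
    (hmem : ∀ x, (s.a1 .inQ x = 1 ∧ s.a1 .par x = 0) ↔ (x ∈ R ∧ x ≠ z))
    (hS : ∀ r, s.a1 .slot r = 0) (hT : t + potential n s R chd ≤ T) :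
    wp consolidate t s fun t' s' => Heap n s' 0 t' (T + 160 * Nat.log 2 n + 170) := by
  unfold consolidate
  rw [block, wp_seq, wp_assign, block, wp_seq, wp_assign, block, wp_seq, wp_write1, block, wp_seq]
  simp only [Expr.eval_zero, eval_get1, Mem.a1_setReg]
  have hx : Extends s (((s.setReg .top 0).setReg .p (s.a1 .roots 0)).setArr .roots 0 0 0) :=
    ((s.extends_setReg (by decide) _).trans (Mem.extends_setReg _ (by decide) _)).trans
    (Mem.extends_setArr _ (by decide) (by decide) _ _ _)
  refine (consolidating_spec (n := n) (z := z) (T := T + 3) ⟨R, chd,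
    ⟨?_, ?_, ?_, ?_, hnd, by simp, ?_, ?_, ?_⟩, ?_, ?_, ?_, ?_⟩).mono ?_
  · simpa using hf
  · simpa using fun x => (hchd x).mono hx
  · simpa using hO
  · simpa using zQ
  · intro x
    simp only [ne_eq, reduceCtorEq, not_false_eq_true, Mem.a1_setArr_ne, Mem.a1_setReg,
      List.not_mem_nil, false_or, hmem, hS]
    refine (or_iff_left ?_).symm
    rintro ⟨h1, -, h2⟩
    exact h1 h2.symm
  · simp [hS]
  · simp
  · simpa using hR.mono hx
  · simp
  · simpa using hz
  · simp only [consPot, ne_eq, reduceCtorEq, not_false_eq_true, Mem.a1_setArr_ne, Mem.a1_setReg,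
      List.length_nil, hS, potential] at hT ⊢
    simp only [Nat.zero_le, inf_of_le_right, Finset.sum_const_zero]
    omega
  · rintro t1 s1 ⟨chd1, hC, hroots, hT1⟩
    rw [block, wp_seq, wp_assign, block]
    have hx2 : Extends s1 (s1.setReg .minv 0) := s1.extends_setReg (by decide) _
    have htop := hC.top
    refine (rebuild_spec (n := n) (s := s1.setReg .minv 0) (T := T + 160 * Nat.log 2 n + 169) ⟨[], chd1, hC.forest,
      fun x => (hC.chdL x).mono hx2, hC.order, ?_, List.nodup_nil, ?_, ?_, ?_, ?_, ?_⟩).mono ?_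
    · simp [hroots]
    · intro x
      have := hC.mem x
      simp only [List.not_mem_nil, false_and, false_or] at this
      simpa using this
    · intro r hr
      obtain ⟨h1, h2, h3, h4⟩ := hC.slot r hr
      exact ⟨h1, h2, by simpa using h4⟩
    · simp
    · simp
    · simp only [Mem.reg_setReg, reduceCtorEq, if_false]
      simp only [potential, Mem.a1_setReg, consPot, List.length_nil] at hT1 ⊢
      omega
    · intro t' s' h'
      exact h'.mono (by omega)

theorem alloc_makeRoot {x : Reg} (hx : x ≠ .cell) : Alloc (makeRoot x) :=
  .seq (.write _ _ _ _ (by decide) (by decide)) (.seq (.write _ _ _ _ (by decide) (by decide))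
    (.push _ _ _ rfl (by simp [Expr.noCell, hx]) (by decide) (by decide)))

/-- Invariant of the loop that turns the children of `z` into roots: `l` is the list of entries
that have not been read. -/
def Releasing (z T : ℕ) (s₀ : Mem) (R L l : List ℕ) (t : ℕ) (s : Mem) : Prop :=
  ∃ d R', L = d ++ l ∧ IsL s (s.a1 .roots 0) R' ∧ R'.Nodup ∧
    (∀ x, x ∈ R' ↔ x ∈ R ∨ (s₀.a1 .par x = z ∧ x ∈ d)) ∧
    (∀ x, s.a1 .par x = if s₀.a1 .par x = z ∧ x ∈ d then 0 else s₀.a1 .par x) ∧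
    (∀ x, s.a1 .mark x = if s₀.a1 .par x = z ∧ x ∈ d then 0 else s₀.a1 .mark x) ∧
    (∀ a ∈ [Arr.inQ, .deg, .chd, .slot], s.a1 a = s₀.a1 a) ∧ Extends s₀ s ∧ s.wt = s₀.wt ∧
    s.reg .z = z ∧ t + 20 * l.length ≤ T

/-- A vertex may occur repeatedly in the list, if it was cut from `z` and linked to `z` again. Its
first occurrence makes it a root, after which the others are stale; so the state depends only on
membership in the part `d` already read. -/
theorem releasing_spec {z T t : ℕ} {s : Mem} {R L : List ℕ} (hz : s.reg .z = z) (z0 : z ≠ 0)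
    (hL : IsL s (s.a1 .chd z) L) (hR : IsL s (s.a1 .roots 0) R) (hnd : R.Nodup)
    (hpR : ∀ x ∈ R, s.a1 .par x = 0) (hT : t + 1 + 20 * L.length ≤ T) :
    wp (forCells .p (get1 .chd Reg.z) (block [
      .assign .x (eltAt .p),
      when (.eq (get1 .par Reg.x) Reg.z) (makeRoot .x)])) t s
      fun t' s' => ∃ t'', t' = t'' + 1 ∧ Releasing z T s R L [] t'' s' := by
  refine wp_forCells (l := L) (Releasing z T s R L) (by decide) ?_ (by decide)
    (by simpa [hz] using hL) ?_ ?_ ?_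
  · exact .seq (.assign _ _ (by decide)) (.ite (alloc_makeRoot (by decide)) .skip)
  · refine ⟨[], R, rfl, ?_, hnd, by simp, by simp, by simp, fun a _ => rfl,
      s.extends_setReg (by decide) _, rfl, by simp [hz], hT⟩
    simpa using hR.mono (s.extends_setReg (x := .p) (by decide) _)
  · rintro x l t s' ⟨d, R', hd, hR', hnd', hmem, hpar, hmark, ha, hx, hw, hz', hT'⟩ he
    rw [block, wp_seq, wp_assign, block, wp_when, wp_makeRoot (by decide)]
    simp only [eval_eltAt, he, Test.holds_eq, eval_get1, Expr.eval_reg, Mem.a1_setReg,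
      Mem.reg_setReg, if_true, reduceCtorEq, if_false, hz']
    have hx1 : Extends s' (s'.setReg .x x) := s'.extends_setReg (by decide) _
    have hparx : s'.a1 .par x = z → s.a1 .par x = z ∧ x ∉ d := by
      intro h
      rw [hpar] at h
      split at h
      · omega
      · tauto
    have hiff : ∀ u, (s.a1 .par u = z ∧ u ∈ d ++ [x]) ↔
        ((s.a1 .par u = z ∧ u ∈ d) ∨ (u = x ∧ s.a1 .par x = z)) := by
      intro u
      rw [List.mem_append, List.mem_singleton]
      constructor
      · rintro ⟨h1, h2 | rfl⟩
        · exact Or.inl ⟨h1, h2⟩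
        · exact Or.inr ⟨rfl, h1⟩
      · rintro (h | ⟨rfl, h⟩)
        · exact ⟨h.1, Or.inl h.2⟩
        · exact ⟨h, Or.inr rfl⟩
    constructor
    · intro hpx q
      obtain ⟨hp0, hxd⟩ := hparx hpx
      have hx2 := hx1.trans (Mem.extends_rooted _ x)
      have hx3 := hx2.trans (Mem.extends_setReg _ (x := .p) (by decide) q)
      refine ⟨d ++ [x], x :: R', by simp [hd], ?_, ?_, ?_, ?_, ?_, ?_, hx.trans hx3, ?_, ?_, ?_⟩
      · simp only [Mem.a1_setReg]
        refine IsL.mono (Mem.extends_setReg _ (by decide) _) ?_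
        exact IsL.rooted (by simpa using hR'.mono hx1) x
      · refine List.nodup_cons.2 ⟨?_, hnd'⟩
        rw [hmem]
        rintro (h | h)
        · exact z0 (hp0.symm.trans (hpR x h))
        · exact hxd h.2
      · intro u
        rw [hiff, List.mem_cons, hmem]
        have : u = x → (u = x ∧ s.a1 .par x = z) := fun h => ⟨h, hp0⟩
        tauto
      · intro u
        simp only [Mem.a1_setReg, Mem.par_rooted, hiff]
        by_cases e : u = x
        · subst e; simp [hp0]
        · simp [e, hpar]
      · intro u
        simp only [Mem.a1_setReg, Mem.mark_rooted, hiff]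
        by_cases e : u = x
        · subst e; simp [hp0]
        · simp [e, hmark]
      · intro a h
        rw [← ha a h]
        simp only [Mem.a1_setReg]
        have hne : a ≠ .par ∧ a ≠ .mark ∧ a ≠ .roots ∧ a ≠ .elt ∧ a ≠ .nxt := by
          refine ⟨?_, ?_, ?_, ?_, ?_⟩ <;> rintro rfl <;> simp at h
        rw [Mem.a1_rooted _ _ hne.1 hne.2.1 hne.2.2.1 hne.2.2.2.1 hne.2.2.2.2]
        rfl
      · simpa [Mem.wt_rooted] using hw
      · simp [Mem.reg_rooted, hz']
      · simp only [List.length_cons] at hT'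
        omega
    · intro hpx q
      have hx3 := hx1.trans (Mem.extends_setReg _ (x := .p) (by decide) q)
      have hiff' : ∀ u, (s.a1 .par u = z ∧ u ∈ d ++ [x]) ↔ (s.a1 .par u = z ∧ u ∈ d) := by
        intro u
        rw [hiff]
        refine or_iff_left_of_imp ?_
        rintro ⟨rfl, h⟩
        refine ⟨h, ?_⟩
        by_contra hud
        rw [hpar, if_neg (by tauto)] at hpx
        exact hpx h
      refine ⟨d ++ [x], R', by simp [hd], hR'.mono hx3, hnd', ?_, ?_, ?_, ha, hx.trans hx3, hw, ?_,
        ?_⟩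
      · simpa only [hiff'] using hmem
      · simpa only [hiff', Mem.a1_setReg] using hpar
      · simpa only [hiff', Mem.a1_setReg] using hmark
      · simp [hz']
      · simp only [List.length_cons] at hT'
        omega
  · intro t s' h
    exact ⟨t, rfl, h⟩

/-- Reading the children of `z` is paid for by the list entries that disappear. At most `2 * Nat.log
2 n + 1` of them are true children, and as new roots they contribute `120 * Nat.log 2 n + 60`; the
consolidation adds `160 * Nat.log 2 n + 170`. -/
theorem dequeue_spec {n t T : ℕ} {s : Mem} (h : Heap n s 0 t T) (hm : s.reg .minv ≠ 0) :
    wp dequeue t s fun t' s' => Heap n s' 0 t' (T + 280 * Nat.log 2 n + 280) ∧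
      s'.reg .z = s.reg .minv ∧
      s'.a1 .inQ = Function.update (s.a1 .inQ) (s.reg .minv) 0 := by
  obtain ⟨R, chd, hC, hO, hM, hS, hT⟩ := h
  have hf := hC.forest
  obtain ⟨z, hz⟩ : ∃ z, s.reg .minv = z := ⟨_, rfl⟩
  rw [hz] at hm ⊢
  obtain ⟨zQ, zp⟩ := hM.root (by omega)
  rw [hz] at zQ zp
  have zI := Finset.mem_Icc.2 (hf.rng z zQ)
  unfold dequeue
  rw [block, wp_seq, wp_assign, block, wp_seq, wp_write1, block, wp_seq]
  simp only [Expr.eval_reg, Expr.eval_zero, hz, Mem.reg_setReg, if_true]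
  set s1 := (s.setReg .z z).setArr .inQ z 0 0 with hs1
  have hx1 : Extends s s1 := (s.extends_setReg (by decide) _).trans
    (Mem.extends_setArr _ (by decide) (by decide) _ _ _)
  have ha1 : ∀ a, a ≠ .inQ → s1.a1 a = s.a1 a := fun a ha => by simp [hs1, ha]
  have hq1 : s1.a1 .inQ = Function.update (s.a1 .inQ) z 0 := by simp [hs1]
  have hz1 : s1.reg .z = z := by simp [hs1]
  have hw1 : s1.wt = s.wt := rfl
  clear_value s1
  refine (releasing_spec (z := z) (T := t + 4 + 20 * (chd z).length) (s := s1) (R := R)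
    (L := chd z) hz1 (by omega) ?_ ?_ hC.nodup ?_ (by omega)).mono ?_
  · rw [ha1 _ (by decide)]; exact (hC.chdL z).mono hx1
  · rw [ha1 _ (by decide)]; exact hC.rootsL.mono hx1
  · rw [ha1 _ (by decide)]; exact fun x hx => ((hC.mem x).1 hx).2
  · rintro _ s2 ⟨t2, rfl, d, R2, hd, hR2, hnd2, hmem2, hpar2, hmark2, ha2, hx2, hw2, hz2, hT2⟩
    rw [List.append_nil] at hd
    subst hd
    simp only [ha1 .par (by decide), ha1 .mark (by decide)] at hmem2 hpar2 hmark2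
    -- Every true child occurs in the list, so after it has been read in full membership is no
    -- restriction.
    have hch : ∀ x, (s.a1 .par x = z ∧ x ∈ chd z) ↔ s.a1 .par x = z := by
      intro x
      refine and_iff_left_of_imp fun hx => ?_
      have := (hf.parQ x (by omega)).2.2
      rwa [hx] at this
    simp only [hch] at hmem2 hpar2 hmark2
    simp only [List.mem_cons, List.not_mem_nil, or_false, forall_eq_or_imp, forall_eq] at ha2
    obtain ⟨hq2, hd2, hc2, hsl2⟩ := ha2
    rw [block, wp_seq, wp_write1, block, wp_seq, wp_write1, block]
    simp only [Expr.eval_reg, Expr.eval_zero, Mem.reg_setArr, hz2]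
    set s3 := (s2.setArr .chd z 0 0).setArr .deg z 0 0 with hs3
    have hx3 : Extends s2 s3 := (Mem.extends_setArr _ (by decide) (by decide) _ _ _).trans
      (Mem.extends_setArr _ (by decide) (by decide) _ _ _)
    have hq3 : s3.a1 .inQ = Function.update (s.a1 .inQ) z 0 := by simp [hs3, hq2, hq1]
    have hd3 : s3.a1 .deg = Function.update (s.a1 .deg) z 0 := by simp [hs3, hd2, ha1]
    have hc3 : s3.a1 .chd = Function.update (s.a1 .chd) z 0 := by simp [hs3, hc2, ha1]
    have hsl3 : s3.a1 .slot = s.a1 .slot := by simp [hs3, hsl2, ha1]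
    have hp3 : s3.a1 .par = fun x => if s.a1 .par x = z then 0 else s.a1 .par x := by
      ext x; simp [hs3, hpar2]
    have hm3 : s3.a1 .mark = fun x => if s.a1 .par x = z then 0 else s.a1 .mark x := by
      ext x; simp [hs3, hmark2]
    have hr3 : s3.a1 .roots = s2.a1 .roots := by simp [hs3]
    have hw3 : s3.wt = s.wt := by simp [hs3, hw2, hw1]
    have hz3 : s3.reg .z = z := by simp [hs3, hz2]
    clear_value s3
    have hxs := hx1.trans (hx2.trans hx3)
    refine (consolidate_spec (n := n) (z := z) (s := s3) (R := R2)
      (chd := Function.update chd z []) (T := T + 120 * Nat.log 2 n + 67) ?_ ?_ ?_ hz3 ?_ ?_ hnd2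
      ?_ ?_ ?_).exec ?_
    · rw [hq3, hp3, hd3, hm3]
      exact hf.erase zQ zp
    · intro x
      rw [hc3]
      by_cases e : x = z
      · subst e; simp
      · simp only [Function.update_of_ne e]
        exact (hC.chdL x).mono hxs
    · intro x
      rw [hp3, hw3]
      by_cases e : s.a1 .par x = z
      · simp [e]
      · simp only [e, if_false]
        intro hx
        exact hO x (by rintro rfl; exact hx hf.par_zero) hx
    · rw [hq3]; simp
    · rw [hr3]; exact hR2.mono hx3
    · intro x
      rw [hq3, hp3, hmem2, hC.mem]
      by_cases e : x = z
      · subst e; simp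
      · simp only [Function.update_of_ne e]
        by_cases e' : s.a1 .par x = z
        · have := (hf.parQ x (by omega)).1
          simp [e', this, e]
        · simp [e', e]
    · rw [hsl3]; exact hS
    · have hlen : R2.length ≤ R.length + (2 * Nat.log 2 n + 1) := by
        have hsub : R2.toFinset ⊆ R.toFinset ∪ (Finset.Icc 1 n).filter fun x => s.a1 .par x = z := by
          intro x hx
          rw [List.mem_toFinset, hmem2] at hx
          rw [Finset.mem_union, List.mem_toFinset, Finset.mem_filter]
          rcases hx with hx | hx
          · exact Or.inl hx
          · exact Or.inr ⟨hf.mem_Icc (by omega), hx⟩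
        have h1 := (Finset.card_le_card hsub).trans (Finset.card_union_le _ _)
        rw [List.toFinset_card_of_nodup hnd2, List.toFinset_card_of_nodup hC.nodup,
          ← hf.deg_eq z zQ] at h1
        have := hf.deg_le zQ
        omega
      have hmk : ∑ x ∈ Finset.Icc 1 n, s3.a1 .mark x ≤ ∑ x ∈ Finset.Icc 1 n, s.a1 .mark x := by
        refine Finset.sum_le_sum fun x _ => ?_
        rw [hm3]
        dsimp only
        split <;> omega
      have hcl := sum_length_update zI chd []
      simp only [potential, List.length_nil] at hT hcl ⊢
      omega
    · intro t' s' hE h'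
      refine ⟨h'.mono (by omega), ?_, ?_⟩
      · rw [hE.reg_eq (by decide), hz3]
      · rw [hE.a1_eq (by decide), hq3]

end RAM

namespace WHypergraph

variable {n m : ℕ} (H : WHypergraph n m)

/-- This is not the case `x = u` of the triangle inequality: hyperpaths are nonempty, so `H.dist u
u` need not vanish. -/
theorem dist_le_weight {u v : Fin n} {j : Fin m} (hu : u ∈ H.edge j) (hv : v ∈ H.edge j) :
    H.dist u v ≤ H.weight j := by
  refine (iInf_le _ ⟨[j], List.isChain_singleton j, by simp, hu, hv⟩).trans ?_
  simp

theorem dist_le_dist_add {u v x : Fin n} {j : Fin m} (hx : x ∈ H.edge j) (hv : v ∈ H.edge j) :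
    H.dist u v ≤ H.dist u x + H.weight j := by
  unfold dist
  rw [ENNReal.iInf_add]
  refine le_iInf fun L => ?_
  obtain ⟨L, hc, hne, hh, hl⟩ := L
  have hL : H.IsHyperpath u v (L ++ [j]) := by
    refine ⟨?_, by simp, ?_, by simpa using hv⟩
    rotate_left
    · rwa [List.head_append_of_ne_nil hne]
    rw [List.isChain_append]
    refine ⟨hc, List.isChain_singleton j, ?_⟩
    intro a ha b hb
    rw [List.getLast?_eq_some_getLast hne, Option.mem_some] at ha
    simp only [List.head?_cons, Option.mem_some] at hb
    subst ha hb
    exact ⟨x, Finset.mem_inter.2 ⟨hl, hx⟩⟩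
  exact (iInf_le _ ⟨L ++ [j], hL⟩).trans (by simp)

/-- Weak duality: the inequalities are added along the hyperpath, passing from one hyperedge to the
next through a common vertex. -/
theorem le_dist {f : Fin n → ℝ≥0∞} {u : Fin n} (hu : f u = 0)
    (hf : ∀ j, ∀ x ∈ H.edge j, ∀ v ∈ H.edge j, f v ≤ f x + H.weight j) (v : Fin n) :
    f v ≤ H.dist u v := by
  refine le_iInf fun L => ?_
  obtain ⟨L, hc, hne, hh, hl⟩ := L
  suffices ∀ (L : List (Fin m)) (x : Fin n),
      L.IsChain (fun i j => (H.edge i ∩ H.edge j).Nonempty) → ∀ h : L ≠ [],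
      x ∈ H.edge (L.head h) → v ∈ H.edge (L.getLast h) →
      f v ≤ f x + (L.map fun j => (H.weight j : ℝ≥0∞)).sum by
    simpa [hu] using this L u hc hne hh hl
  clear hl hh hne hc L
  intro L
  induction L with
  | nil => intro x _ h; exact absurd rfl h
  | cons j L ih =>
    intro x hc _ hx hv
    cases L with
    | nil => simpa using hf j x hx v hv
    | cons k L =>
      rw [List.isChain_cons_cons] at hc
      obtain ⟨y, hy⟩ := hc.1
      rw [Finset.mem_inter] at hy
      have h1 := ih y hc.2 (by simp) hy.2 (by simpa using hv)
      have h2 := hf j x hx y hy.1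
      rw [List.map_cons, List.sum_cons, ← add_assoc]
      exact h1.trans (by gcongr)

/-- The list of the numbers of the vertices of a hyperedge. -/
def verts (j : Fin m) : List ℕ := ((H.edge j).sort (· ≤ ·)).map fun v : Fin n => (v : ℕ) + 1

@[simp] theorem length_verts (j : Fin m) : (H.verts j).length = (H.edge j).card := by
  simp [verts]

theorem mem_verts {j : Fin m} {x : ℕ} : x ∈ H.verts j ↔ ∃ v ∈ H.edge j, (v : ℕ) + 1 = x := by
  simp [verts]

theorem succ_mem_verts {j : Fin m} {v : Fin n} : (v : ℕ) + 1 ∈ H.verts j ↔ v ∈ H.edge j := by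
  rw [mem_verts]
  constructor
  · rintro ⟨u, hu, he⟩
    rwa [← Fin.ext (Nat.succ_injective he)]
  · exact fun h => ⟨v, h, rfl⟩

theorem nodup_verts (j : Fin m) : (H.verts j).Nodup :=
  ((H.edge j).sort_nodup _).map fun _ _ h => Fin.ext (Nat.succ_injective h)

end WHypergraph

/-! ### Memory contents that represent the input -/

namespace RAM

variable {n m : ℕ}

/-- `s` contains the input. -/
structure HasInput (H : WHypergraph n m) (src : Fin n) (s : Mem) : Prop where
  reg_n : s.reg .n = n
  reg_m : s.reg .m = m
  reg_src : s.reg .src = src + 1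
  card : ∀ j : Fin m, s.a1 .card (j + 1) = (H.edge j).card
  vert : ∀ (j : Fin m) k, s.arr .vert (j + 1) k = (H.verts j).getD k 0
  wt : ∀ j : Fin m, s.wt .w (j + 1) = H.weight j

theorem hasInput_input (H : WHypergraph n m) (src : Fin n) : HasInput H src (input H src) := by
  refine ⟨rfl, rfl, rfl, fun j => ?_, fun j k => ?_, fun j => ?_⟩
  · simp [input, Mem.a1]
  · simp only [input, WHypergraph.verts, List.bind_eq_flatMap, List.pure_def, ← List.map_eq_flatMap,
      List.map_map]
    simp
    rfl
  · simp [input]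

theorem HasInput.congr {H : WHypergraph n m} {src : Fin n} {s s' : Mem} (h : HasInput H src s)
    (hr : ∀ x ∈ [Reg.n, .m, .src], s'.reg x = s.reg x)
    (ha : ∀ a ∈ [Arr.card, .vert], s'.arr a = s.arr a) (hw : s'.wt .w = s.wt .w) :
    HasInput H src s' := by
  simp only [List.mem_cons, List.not_mem_nil, or_false, forall_eq_or_imp, forall_eq] at hr ha
  refine ⟨hr.1.trans h.reg_n, hr.2.1.trans h.reg_m, hr.2.2.trans h.reg_src, fun j => ?_, fun j k => ?_,
    fun j => ?_⟩
  · rw [← h.card, Mem.a1, ha.1]; rfl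
  · rw [← h.vert, ha.2]
  · rw [← h.wt, hw]

/-- The program does not modify the input. -/
def Cmd.keepsInput (c : Cmd) : Bool :=
  !(c.modReg .n) && !(c.modReg .m) && !(c.modReg .src) && !(c.modArr .card) &&
    !(c.modArr .vert) && !(c.modWt .w)

theorem HasInput.exec {H : WHypergraph n m} {src : Fin n} {s s' : Mem} (h : HasInput H src s)
    {c : Cmd} {t : ℕ} (hE : Exec c s t s') (hc : c.keepsInput = true) : HasInput H src s' := by
  simp only [Cmd.keepsInput, Bool.and_eq_true, Bool.not_eq_true'] at hc
  obtain ⟨⟨⟨⟨⟨h1, h2⟩, h3⟩, h4⟩, h5⟩, h6⟩ := hc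
  refine h.congr ?_ ?_ (hE.wt_eq h6)
  · simp only [List.mem_cons, List.not_mem_nil, or_false, forall_eq_or_imp, forall_eq]
    exact ⟨hE.reg_eq h1, hE.reg_eq h2, hE.reg_eq h3⟩
  · simp only [List.mem_cons, List.not_mem_nil, or_false, forall_eq_or_imp, forall_eq]
    exact ⟨hE.arr_eq h4, hE.arr_eq h5⟩

/-! ### Dijkstra's algorithm -/

/-- Invariant of Dijkstra's algorithm; `F` is the set of vertices that have been dequeued. -/
structure Labels (H : WHypergraph n m) (src : Fin n) (s : Mem) (F : Finset ℕ) : Prop where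
  input : HasInput H src s
  zero : s.wt .D (src + 1) = 0
  sound : ∀ v : Fin n, v ≠ src → H.dist src v ≤ s.wt .D (v + 1)
  fin : ∀ x ∈ Finset.Icc 1 n, s.wt .D x ≠ ∞ → x ∈ F ∨ s.a1 .inQ x = 1
  sub : F ⊆ Finset.Icc 1 n
  disj : ∀ x ∈ F, s.a1 .inQ x ≠ 1
  mono : ∀ f ∈ F, ∀ x, s.a1 .inQ x = 1 → s.wt .D f ≤ s.wt .D x

/-- The labels in `s'` are at most those in `s`, and equal to them on `F`. -/
def Improves (F : Finset ℕ) (s s' : Mem) : Prop :=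
  (∀ x, s'.wt .D x ≤ s.wt .D x) ∧ ∀ f ∈ F, s'.wt .D f = s.wt .D f

theorem Improves.trans {F : Finset ℕ} {s s' s'' : Mem} (h : Improves F s s')
    (h' : Improves F s' s'') : Improves F s s'' :=
  ⟨fun x => (h'.1 x).trans (h.1 x), fun f hf => (h'.2 f hf).trans (h.2 f hf)⟩

theorem Improves.of_eq {F : Finset ℕ} {s s' : Mem} (h : s'.wt .D = s.wt .D) : Improves F s s' :=
  ⟨fun x => by rw [h], fun f _ => by rw [h]⟩

/-- The expression `a` is evaluated again after the write to `P`, hence `ha'`. The bound 420 covers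
both outcomes, a decrease of a key and an insertion. -/
theorem relax_spec {H : WHypergraph n m} {src : Fin n} {s : Mem} {F : Finset ℕ} {t T : ℕ}
    {a : Expr} {z v : Fin n} {j : Fin m} (hL : Labels H src s F) (hH : Heap n s 0 t T)
    (hz : s.reg .z = z + 1) (hzF : (z : ℕ) + 1 ∈ F) (hF : ∀ f ∈ F, s.wt .D f ≤ s.wt .D (z + 1))
    (hv : s.reg .v = v + 1) (ha : a.eval s = j + 1)
    (ha' : ∀ s' : Mem, s'.reg = s.reg → (∀ b, b ≠ .P → s'.arr b = s.arr b) → a.eval s' = j + 1)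
    (hzj : z ∈ H.edge j) (hvj : v ∈ H.edge j) :
    wp (relax a) t s fun t' s' => Labels H src s' F ∧ Heap n s' 0 t' (T + 420) ∧
      s'.wt .D (v + 1) ≤ s'.wt .D (z + 1) + H.weight j ∧ Improves F s s' := by
  unfold relax
  rw [wp_when]
  simp only [Test.holds_wlt, WExpr.eval_add, eval_dOf, eval_wOf, Expr.eval_reg, hz, hv, ha,
    hL.input.wt j]
  have hvI : (v : ℕ) + 1 ∈ Finset.Icc 1 n := Finset.mem_Icc.2 ⟨by omega, by omega⟩
  constructor
  · intro hlt
    -- Labels on `F` are at most `D z` and weights are nonnegative, so vertices of `F` are never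
    -- improved.
    have hvF : (v : ℕ) + 1 ∉ F := fun h => (not_lt.2 ((hF _ h).trans le_self_add)) hlt
    have hvs : v ≠ src := by
      rintro rfl
      rw [hL.zero] at hlt
      simp at hlt
    have hds : H.dist src v ≤ s.wt .D (z + 1) + H.weight j := by
      -- The label of the source is `0`, which may be below `H.dist src src`; soundness at the
      -- source is replaced by the one-edge hyperpath.
      by_cases e : z = src
      · subst e
        exact (H.dist_le_weight hzj hvj).trans le_add_self
      · exact (H.dist_le_dist_add hzj hvj).trans (by gcongr; exact hL.sound z e)
    rw [block, wp_seq, wp_wwrite, block, wp_seq, wp_write1, block, wp_seq, wp_write1, block]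
    simp only [WExpr.eval_add, eval_dOf, eval_wOf, Expr.eval_reg, hz, hv, ha, hL.input.wt j,
      Mem.reg_setWt, Mem.reg_setArr]
    set d := s.wt .D (z + 1) + H.weight j with hd
    rw [ha' (((s.setWt .D (v + 1) d).setArr .P (v + 1) 0 (z + 1))) rfl (fun b hb => by simp [hb])]
    set s1 := (((s.setWt .D (v + 1) d).setArr .P (v + 1) 0 (z + 1)).setArr .E (v + 1) 0 (j + 1))
      with hs1
    have hx1 : Extends s s1 := ((s.extends_setWt _ _ _).trans
      (Mem.extends_setArr _ (by decide) (by decide) _ _ _)).trans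
      (Mem.extends_setArr _ (by decide) (by decide) _ _ _)
    have hr1 : s1.reg = s.reg := rfl
    have ha1 : ∀ b, b ≠ .P → b ≠ .E → s1.a1 b = s.a1 b := fun b h1 h2 => by simp [hs1, h1, h2]
    have hab1 : ∀ b, b ≠ .P → b ≠ .E → s1.arr b = s.arr b := fun b h1 h2 => by simp [hs1, h1, h2]
    have hD1 : s1.wt .D = Function.update (s.wt .D) (v + 1) d := by simp [hs1]
    have hw1 : s1.wt .w = s.wt .w := by simp [hs1]
    clear_value s1
    have hin1 : HasInput H src s1 := hL.input.congr (fun x _ => by rw [hr1]) (fun b hb =>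
      hab1 b (by rintro rfl; simp at hb) (by rintro rfl; simp at hb)) hw1
    have himp : Improves F s s1 := by
      constructor
      · intro x
        rw [hD1]
        by_cases e : x = v + 1
        · subst e; rw [Function.update_self]; exact hlt.le
        · rw [Function.update_of_ne e]
      · intro f hf
        rw [hD1, Function.update_of_ne (by rintro rfl; exact hvF hf)]
    have hzv : (z : ℕ) + 1 ≠ v + 1 := fun e => hvF (e ▸ hzF)
    have hQ1 : s1.a1 .inQ = s.a1 .inQ := ha1 _ (by decide) (by decide)
    -- The part common to both branches: after either heap operation, the queue is the old one
    -- together with `v`.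
    have fresh : ∀ t' s', s'.wt = s1.wt → HasInput H src s' → Heap n s' 0 t' (T + 420) →
        (∀ x, s'.a1 .inQ x = 1 ↔ s.a1 .inQ x = 1 ∨ x = v + 1) →
        Labels H src s' F ∧ Heap n s' 0 t' (T + 420) ∧
        s'.wt .D (v + 1) ≤ s'.wt .D (z + 1) + H.weight j ∧ Improves F s s' := by
      intro t' s' hw' hin' hH' hQ'
      refine ⟨⟨hin', ?_, ?_, ?_, hL.sub, ?_, ?_⟩, hH', ?_, himp.trans (.of_eq (by rw [hw']))⟩
      · rw [hw', hD1, Function.update_of_ne, hL.zero]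
        intro e
        exact hvs (Fin.ext (by omega))
      · intro u hu
        rw [hw', hD1]
        by_cases e : (u : ℕ) + 1 = v + 1
        · rw [e, Function.update_self]
          have : u = v := Fin.ext (by omega)
          rwa [this]
        · rw [Function.update_of_ne e]; exact hL.sound u hu
      · intro x hx
        rw [hw', hD1, hQ']
        by_cases e : x = v + 1
        · simp [e]
        · rw [Function.update_of_ne e]
          intro h
          rcases hL.fin x hx h with h | h
          · exact Or.inl h
          · exact Or.inr (Or.inl h)
      · intro x hx
        rw [ne_eq, hQ']
        rintro (h | rfl)
        · exact hL.disj x hx h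
        · exact hvF hx
      · intro f hf x hx
        rw [hw', himp.2 f hf, hD1]
        by_cases e : x = v + 1
        · rw [e, Function.update_self]
          exact (hF f hf).trans le_self_add
        · rw [Function.update_of_ne e]
          exact hL.mono f hf x (((hQ' x).1 hx).resolve_right e)
      · rw [hw', himp.2 _ hzF, hD1, Function.update_self]
    simp only [wp_ite, Test.holds_eq, eval_get1, Expr.eval_reg, Expr.eval_one, hr1, hv, hQ1]
    constructor
    · intro hq
      have hH1 : Heap n s1 (v + 1) (t + 5) (T + 5) := by
        obtain ⟨R, chd, hC, hO, hM, hS, hT⟩ := hH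
        have hf := hC.forest
        have hle := himp.1
        have hD : ∀ x, x ≠ (v : ℕ) + 1 → s1.wt .D x = s.wt .D x := fun x hx => by
          rw [hD1, Function.update_of_ne hx]
        refine ⟨R, chd, hC.congr hx1 fun a ha => ha1 a (by rintro rfl; simp at ha)
          (by rintro rfl; simp at ha), ?_, ⟨?_, ?_, ?_⟩, ?_, ?_⟩
        · intro x hxv hp
          rw [ha1 _ (by decide) (by decide)] at hp ⊢
          rw [hD x hxv]
          exact (hle _).trans (hO x (by rintro rfl; exact hp hf.par_zero) hp)
        · rw [hQ1, hr1]; exact hM.ne_zero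
        · intro x hxv hq
          rw [hQ1] at hq
          rw [hr1, hD x hxv]
          exact (hle _).trans (hM.le x (by rintro rfl; have := hf.rng 0 hq; omega) hq)
        · rw [hQ1, hr1, ha1 _ (by decide) (by decide)]; exact hM.root
        · rw [ha1 _ (by decide) (by decide)]; exact hS
        · unfold potential at hT ⊢
          rw [ha1 _ (by decide) (by decide)]
          omega
      refine (decreaseKey_spec (n := n) (T := T + 5) (by rwa [hr1, hv]) (by rw [hr1, hv, hQ1, hq])).exec ?_
      intro t' s' hE hH'
      refine fresh _ _ ?_ (hin1.exec hE (by decide)) (hH'.mono (by omega)) ?_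
      · ext b x
        cases b
        · rw [hE.wt_eq (by decide)]
        · rw [hE.wt_eq (by decide)]
      · intro x
        rw [hE.a1_eq (by decide), hQ1]
        refine (or_iff_left_of_imp ?_).symm
        rintro rfl
        exact hq
    · intro hq
      have hH1 : Heap n s1 0 (t + 5) (T + 5) := by
        refine (hH.mono (t' := t + 5) (T' := T + 5) (by omega)).congr hx1 ?_ (by rw [hr1]) ?_
        · exact fun a ha => ha1 a (by rintro rfl; simp at ha) (by rintro rfl; simp at ha)
        · intro x hx
          rw [hD1, Function.update_of_ne]
          rintro rfl
          exact hq hx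
      refine (enqueue_spec hH1 (by rw [hr1, hv, hQ1]; exact hq) (by rw [hr1, hv]; omega)
        (by rw [hr1, hv]; omega)).exec ?_
      rintro t' s' hE ⟨hH', hQ'⟩
      refine fresh _ _ ?_ (hin1.exec hE (by decide)) (hH'.mono (by omega)) ?_
      · ext b x
        cases b
        · rw [hE.wt_eq (by decide)]
        · rw [hE.wt_eq (by decide)]
      · intro x
        rw [hQ', hQ1, hr1, hv]
        by_cases e : x = v + 1
        · simp [e]
        · simp [e]
  · intro hlt
    exact ⟨hL, hH.mono (by omega), not_lt.1 hlt, .of_eq rfl⟩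

/-- The memory that is used by the heap is zero. -/
structure Fresh (s : Mem) : Prop where
  a1 : ∀ a ∈ [Arr.inQ, .par, .deg, .mark, .chd, .roots, .slot], ∀ x, s.a1 a x = 0
  minv : s.reg .minv = 0

theorem Fresh.heap {s : Mem} (h : Fresh s) (n t : ℕ) : Heap n s 0 t t := by
  obtain ⟨ha, hm⟩ := h
  simp only [List.mem_cons, List.not_mem_nil, or_false, forall_eq_or_imp, forall_eq] at ha
  obtain ⟨h1, h2, h3, h4, h5, h6, h7⟩ := ha
  refine ⟨[], fun _ => [], ⟨⟨?_, ?_, ?_, ?_, ?_, ?_, fun _ => 0, ?_⟩, ?_, ?_, ?_, ?_⟩, ?_,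
    ⟨?_, ?_, ?_⟩, h7, ?_⟩
  · simp [h1]
  · simp [h2]
  · simp [h4]
  · simp [h4]
  · simp [h1]
  · intro x j hx
    simp [h2, hx.symm]
  · simp [h2]
  · simp [h6]
  · simp
  · simp [h1]
  · simp [h5]
  · intro x; simp [h2]
  · simp [h1]
  · simp [h1]
  · simp [hm]
  · simp [potential, h4]

theorem initSource_spec {H : WHypergraph n m} {src : Fin n} {s : Mem} {t : ℕ}
    (hin : HasInput H src s) (hf : Fresh s) :
    wp initSource t s fun t' s' => Labels H src s' ∅ ∧ Heap n s' 0 t' (t + 3 * n + 84) := by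
  unfold initSource
  rw [block, wp_seq]
  refine wp_forRange (N := n + 1) (fun k t' s' => t' + 2 = t + 3 * k ∧ s'.arr = s.arr ∧
    (∀ x, x ≠ .v → s'.reg x = s.reg x) ∧ s'.wt .w = s.wt .w ∧
    ∀ x, 1 ≤ x → x < k → s'.wt .D x = ∞) (by decide) (by simp) ?_ ?_ ?_ ?_
  · refine ⟨?_, rfl, fun x hx => by simp [hx], rfl, ?_⟩
    · simp only [Expr.eval_one]
    · intro x h1 h2
      simp only [Expr.eval_one] at h2
      omega
  · rintro k t' s' ⟨-, -, hr, -⟩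
    simp [hr .n (by decide), hin.reg_n]
  · rintro k t' s' ⟨ht, ha, hr, hw, hD⟩ hk hkN
    rw [wp_wwrite]
    refine ⟨by omega, by simp [ha], fun x hx => by simp [hx, hr x hx], by simp [hw], ?_⟩
    intro x h1 h2
    simp only [Mem.wt_setReg, Mem.wt_setWt, if_true, Expr.eval_reg, hk, WExpr.eval_infty]
    by_cases e : x = k
    · rw [e, Function.update_self]
    · rw [Function.update_of_ne e]; exact hD x h1 (by omega)
  · rintro t1 s1 ⟨ht, ha, hr, hw, hD⟩
    rw [block, wp_seq, wp_assign, block, wp_seq, wp_wwrite, block]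
    simp only [Expr.eval_reg, hr .src (by decide), hin.reg_src, Mem.reg_setReg, if_true,
      WExpr.eval_zero]
    set s2 := (s1.setReg .v (src + 1)).setWt .D (src + 1) 0 with hs2
    have ha2 : s2.arr = s.arr := by simp [hs2, ha]
    have hr2 : ∀ x, x ≠ .v → s2.reg x = s.reg x := fun x hx => by simp [hs2, hx, hr x hx]
    have hv2 : s2.reg .v = src + 1 := by simp [hs2]
    have hw2 : s2.wt .w = s.wt .w := by simp [hs2, hw]
    have hD2 : s2.wt .D = Function.update (s1.wt .D) (src + 1) 0 := by simp [hs2]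
    clear_value s2
    have hf2 : Fresh s2 := by
      refine ⟨fun a ha x => ?_, ?_⟩
      · rw [Mem.a1, ha2]; exact hf.a1 a ha x
      · rw [hr2 _ (by decide), hf.minv]
    have hin2 : HasInput H src s2 := hin.congr (fun x hx => hr2 x (by rintro rfl; simp at hx))
      (fun a _ => by rw [ha2]) hw2
    have hq2 : ∀ x, s2.a1 .inQ x = 0 := hf2.a1 .inQ (by simp)
    refine (enqueue_spec (n := n) (hf2.heap n _) ?_ ?_ ?_).exec ?_
    · rw [hq2]; decide
    · omega
    · omega
    · rintro t' s' hE ⟨hH, hQ⟩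
      have hD' : s'.wt .D = s2.wt .D := hE.wt_eq (by decide)
      refine ⟨⟨hin2.exec hE (by decide), ?_, ?_, ?_, by simp, by simp, by simp⟩, hH.mono (by omega)⟩
      · simp [hD', hD2]
      · intro v hv
        have : (v : ℕ) + 1 ≠ src + 1 := fun e => hv (Fin.ext (by omega))
        rw [hD', hD2, Function.update_of_ne this, hD _ (by omega) (by omega)]
        exact le_top
      · intro x hx
        rw [Finset.mem_Icc] at hx
        rw [hD', hD2, hQ, hv2]
        by_cases e : x = src + 1
        · simp [e]
        · rw [Function.update_of_ne e, hD x hx.1 (by omega)]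
          simp

/-- All hyperedges at vertices in `F` have been scanned. -/
def Relaxed (H : WHypergraph n m) (s : Mem) (F : Finset ℕ) : Prop :=
  ∀ z : Fin n, (z : ℕ) + 1 ∈ F → ∀ j, z ∈ H.edge j → ∀ v ∈ H.edge j,
    s.wt .D (v + 1) ≤ s.wt .D (z + 1) + H.weight j

/-- The right-hand side is frozen because `z` lies in `F`, and the left-hand side can only decrease.
-/
theorem Relaxed.improves {H : WHypergraph n m} {s s' : Mem} {F : Finset ℕ} (h : Relaxed H s F)
    {F' : Finset ℕ} (hF : F ⊆ F') (hs : Improves F' s s') : Relaxed H s' F := by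
  intro z hz j hzj v hvj
  rw [hs.2 _ (hF hz)]
  exact (hs.1 _).trans (h z hz j hzj v hvj)

/-- `P` collects whatever data the scan relies on, such as its lists, and `scan z` bounds the
amortised cost of scanning `z`. The budget of the invariant grows by the cost of each vertex that
enters `F`; as `F` stays within `1, …, n`, this also proves termination. -/
theorem dijkstra_loop_spec {H : WHypergraph n m} {src : Fin n} {body : Cmd} {P : Mem → Prop}
    {scan : ℕ → ℕ} (hP : ∀ t s s', Exec dequeue s t s' → P s → P s')
    (hbody : ∀ (z : Fin n) F t T s, Labels H src s F → P s → Heap n s 0 t T →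
      s.reg .z = z + 1 → (z : ℕ) + 1 ∈ F → (∀ f ∈ F, s.wt .D f ≤ s.wt .D (z + 1)) →
      wp body t s fun t' s' => Labels H src s' F ∧ P s' ∧ Heap n s' 0 t' (T + scan (z + 1)) ∧
        Improves F s s' ∧ ∀ j, z ∈ H.edge j → ∀ v ∈ H.edge j,
          s'.wt .D (v + 1) ≤ s'.wt .D (z + 1) + H.weight j)
    {t T : ℕ} {s : Mem} (hL : Labels H src s ∅) (hPs : P s) (hH : Heap n s 0 t T) :
    wp (.loop (.lt 0 Reg.minv) (.seq dequeue body)) t s fun t' s' =>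
      t' ≤ T + 1 + ∑ z ∈ Finset.Icc 1 n, (280 * Nat.log 2 n + 281 + scan z) ∧
      ∀ v : Fin n, v ≠ src → s'.wt .D (v + 1) = H.dist src v := by
  set cost : ℕ → ℕ := fun z => 280 * Nat.log 2 n + 281 + scan z with hcost
  have hsub : ∀ F ⊆ Finset.Icc 1 n, ∑ z ∈ F, cost z ≤ ∑ z ∈ Finset.Icc 1 n, cost z := fun F hF =>
    Finset.sum_le_sum_of_subset hF
  refine wp_loop_of_bound (fun t s => ∃ F, Labels H src s F ∧ P s ∧ Relaxed H s F ∧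
    Heap n s 0 t (T + ∑ z ∈ F, cost z)) (T + ∑ z ∈ Finset.Icc 1 n, cost z) ?_ ?_ ?_
    ⟨∅, hL, hPs, by intro z hz; simp at hz, by simpa using hH⟩
  · rintro t s ⟨F, hL, -, -, hH⟩
    have := hH.le
    have := hsub F hL.sub
    omega
  · rintro t s ⟨F, hL, hPs, hR, hH⟩ hb
    simp only [Test.holds_lt, Expr.eval_zero, Expr.eval_reg] at hb
    rw [wp_seq]
    have hMin : MinOK s 0 := by obtain ⟨R, chd, -, -, hM, -⟩ := hH; exact hM
    have hrng : ∀ x, s.a1 .inQ x = 1 → 1 ≤ x ∧ x ≤ n := by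
      obtain ⟨R, chd, hC, -⟩ := hH; exact hC.forest.rng
    obtain ⟨zQ, -⟩ := hMin.root (by omega)
    obtain ⟨z, hz⟩ : ∃ z : Fin n, s.reg .minv = z + 1 := by
      have := hrng _ zQ
      exact ⟨⟨s.reg .minv - 1, by omega⟩, by simp; omega⟩
    -- A dequeued vertex never returns to the queue, so each vertex is charged at most once.
    have hzF : (z : ℕ) + 1 ∉ F := fun h => hL.disj _ h (hz ▸ zQ)
    refine (dequeue_spec (hH.mono (t' := t + 1) (T' := T + ∑ z ∈ F, cost z + 1) (by omega))
      (by omega)).exec ?_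
    rintro t' s1 hE ⟨hH1, hz1, hQ1⟩
    rw [hz] at hz1 hQ1
    have hD1 : s1.wt .D = s.wt .D := hE.wt_eq (by decide)
    have hle : ∀ f ∈ insert ((z : ℕ) + 1) F, s1.wt .D f ≤ s1.wt .D (z + 1) := by
      intro f hf
      rw [Finset.mem_insert] at hf
      rw [hD1]
      rcases hf with rfl | hf
      · exact le_rfl
      · exact hL.mono f hf _ (hz ▸ zQ)
    have hL1 : Labels H src s1 (insert ((z : ℕ) + 1) F) := by
      refine ⟨hL.input.exec hE (by decide), by rw [hD1]; exact hL.zero, by rw [hD1]; exact hL.sound,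
        ?_, ?_, ?_, ?_⟩
      · intro x hx
        rw [hD1, hQ1, Finset.mem_insert]
        intro h
        by_cases e : x = z + 1
        · exact Or.inl (Or.inl e)
        · rw [Function.update_of_ne e]
          rcases hL.fin x hx h with h | h
          · exact Or.inl (Or.inr h)
          · exact Or.inr h
      · exact Finset.insert_subset (Finset.mem_Icc.2 ⟨by omega, by omega⟩) hL.sub
      · intro x hx
        rw [hQ1]
        by_cases e : x = z + 1
        · simp [e]
        · rw [Function.update_of_ne e]
          exact hL.disj x ((Finset.mem_insert.1 hx).resolve_left e)
      · intro f hf x hx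
        have hx' : s.a1 .inQ x = 1 := by
          rw [hQ1] at hx
          by_cases e : x = z + 1
          · simp [e] at hx
          · rwa [Function.update_of_ne e] at hx
        refine (hle f hf).trans ?_
        rw [hD1, ← hz]
        exact hMin.le x (by have := hrng x hx'; omega) hx'
    refine (hbody z _ _ _ s1 hL1 (hP _ _ _ hE hPs) hH1 hz1 (Finset.mem_insert_self _ _) hle).mono ?_
    rintro t'' s2 ⟨hL2, hP2, hH2, himp, hrel⟩
    refine ⟨_, hL2, hP2, ?_, hH2.mono ?_⟩
    · intro u hu
      rw [Finset.mem_insert] at hu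
      rcases hu with hu | hu
      · obtain rfl : u = z := Fin.ext (by omega)
        exact hrel
      · refine Relaxed.improves (F := F) ?_ (Finset.subset_insert _ _) himp u hu
        intro x hx
        rw [hD1]
        exact hR x hx
    · rw [Finset.sum_insert hzF]
      simp only [hcost]
      omega
  · rintro t s ⟨F, hL, -, hR, hH⟩ hb
    have hMin : MinOK s 0 := by obtain ⟨R, chd, -, -, hM, -⟩ := hH; exact hM
    simp only [Test.holds_lt, Expr.eval_zero, Expr.eval_reg] at hb
    constructor
    · have h1 := hH.le
      have h2 := hsub F hL.sub
      change t + 1 ≤ T + 1 + ∑ z ∈ Finset.Icc 1 n, cost z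
      omega
    · intro v hv
      refine le_antisymm ?_ (hL.sound v hv)
      -- The final labels form a feasible labelling: a vertex with finite label has been scanned,
      -- since the queue is empty.
      refine H.le_dist (f := fun v => s.wt .D (v + 1)) hL.zero ?_ v
      intro j x hx v hv
      by_cases e : s.wt .D (x + 1) = ∞
      · rw [e, top_add]; exact le_top
      · rcases hL.fin _ (Finset.mem_Icc.2 ⟨by omega, by omega⟩) e with h | h
        · exact hR x h j hx v hv
        · exact absurd (hMin.ne_zero _ h) (by omega)

theorem sum_comp_update {S : Finset ℕ} {x : ℕ} (hx : x ∈ S) {α : Type*} (φ : α → ℕ) (f : ℕ → α)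
    (l : α) :
    ∑ y ∈ S, φ (Function.update f x l y) + φ (f x) = ∑ y ∈ S, φ (f y) + φ l := by
  rw [← sum_update_add hx (fun y => φ (f y)) (φ l)]
  congr 1
  refine Finset.sum_congr rfl fun y _ => ?_
  by_cases e : y = x
  · subst e; simp
  · simp [Function.update_of_ne e]

theorem Heap.setReg {s : Mem} {c t T : ℕ} (h : Heap n s c t T) {x : Reg} (hx : x ≠ .cell)
    (hm : x ≠ .minv) (a : ℕ) : Heap n (s.setReg x a) c t T :=
  h.congr (s.extends_setReg hx a) (fun _ _ => rfl) (by simp [hm.symm]) fun _ _ => rfl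

theorem HasInput.setReg {H : WHypergraph n m} {src : Fin n} {s : Mem} (h : HasInput H src s)
    {x : Reg} (hx : x ∉ [Reg.n, .m, .src]) (a : ℕ) : HasInput H src (s.setReg x a) := by
  refine h.congr (fun y hy => ?_) (fun _ _ => rfl) rfl
  have : y ≠ x := by rintro rfl; exact hx hy
  simp [this]

theorem Labels.setReg {H : WHypergraph n m} {src : Fin n} {s : Mem} {F : Finset ℕ}
    (h : Labels H src s F) {x : Reg} (hx : x ∉ [Reg.n, .m, .src]) (a : ℕ) :
    Labels H src (s.setReg x a) F :=
  ⟨h.input.setReg hx a, h.zero, h.sound, h.fin, h.sub, h.disj, h.mono⟩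

/-- State while the hyperedges at `z` are scanned, when the pairs in `S` have been treated. -/
structure Scan (H : WHypergraph n m) (src : Fin n) (F : Finset ℕ) (z : Fin n) (s₀ : Mem)
    (P : Mem → Prop) (S : Fin m → Fin n → Prop) (T t : ℕ) (s : Mem) : Prop where
  labels : Labels H src s F
  prop : P s
  heap : Heap n s 0 t T
  improves : Improves F s₀ s
  reg_z : s.reg .z = z + 1
  mem_F : (z : ℕ) + 1 ∈ F
  le_F : ∀ f ∈ F, s.wt .D f ≤ s.wt .D (z + 1)
  done : ∀ j v, S j v → s.wt .D (v + 1) ≤ s.wt .D (z + 1) + H.weight j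

theorem Scan.setReg {H : WHypergraph n m} {src : Fin n} {F : Finset ℕ} {z : Fin n} {s₀ s : Mem}
    {P : Mem → Prop} {S : Fin m → Fin n → Prop} {T t : ℕ} (h : Scan H src F z s₀ P S T t s)
    {x : Reg} (hx : x ∉ [Reg.n, .m, .src, .cell, .minv, .z]) (a : ℕ) (hP : P (s.setReg x a)) :
    Scan H src F z s₀ P S T t (s.setReg x a) := by
  simp only [List.mem_cons, not_or] at hx
  refine ⟨h.labels.setReg (by simp; tauto) a, hP, h.heap.setReg hx.2.2.2.1 hx.2.2.2.2.1 a,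
    h.improves, ?_, h.mem_F, h.le_F, h.done⟩
  simp [Ne.symm hx.2.2.2.2.2.1, h.reg_z]

theorem Scan.mono {H : WHypergraph n m} {src : Fin n} {F : Finset ℕ} {z : Fin n} {s₀ s : Mem}
    {P : Mem → Prop} {S S' : Fin m → Fin n → Prop} {T t T' t' : ℕ}
    (h : Scan H src F z s₀ P S T t s) (hT : t' + T ≤ t + T') (hS : ∀ j v, S' j v → S j v) :
    Scan H src F z s₀ P S' T' t' s :=
  { h with heap := h.heap.mono hT, done := fun j v hjv => h.done j v (hS j v hjv) }

theorem Scan.relax {H : WHypergraph n m} {src : Fin n} {F : Finset ℕ} {z v : Fin n} {s₀ s : Mem}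
    {P : Mem → Prop} {S : Fin m → Fin n → Prop} {T t : ℕ} {j : Fin m} {a : Expr}
    (h : Scan H src F z s₀ P S T t s) (hP : ∀ t s s', Exec (relax a) s t s' → P s → P s')
    (hz : (relax a).modReg .z = false) (hv : s.reg .v = v + 1) (ha : a.eval s = j + 1)
    (ha' : ∀ s' : Mem, s'.reg = s.reg → (∀ b, b ≠ .P → s'.arr b = s.arr b) → a.eval s' = j + 1)
    (hzj : z ∈ H.edge j) (hvj : v ∈ H.edge j) :
    wp (relax a) t s fun t' s' =>
      Scan H src F z s₀ P (fun j' v' => S j' v' ∨ j' = j ∧ v' = v) (T + 420) t' s' := by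
  refine (relax_spec h.labels h.heap h.reg_z h.mem_F h.le_F hv ha ha' hzj hvj).exec ?_
  rintro t' s' hE ⟨hL, hH, hle, himp⟩
  refine ⟨hL, hP _ _ _ hE h.prop, hH, h.improves.trans himp, (hE.reg_eq hz).trans h.reg_z,
    h.mem_F, ?_, ?_⟩
  · intro f hf
    rw [himp.2 f hf, himp.2 _ h.mem_F]
    exact h.le_F f hf
  · rintro j' v' (hS | ⟨rfl, rfl⟩)
    · rw [himp.2 _ h.mem_F]
      exact (himp.1 _).trans (h.done j' v' hS)
    · exact hle

/-! ### The heap operations only allocate new list cells -/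

theorem alloc_updateMin {x : Reg} : Alloc (updateMin x) :=
  .ite (.assign _ _ (by decide)) .skip

theorem alloc_enqueue : Alloc (enqueue .v) :=
  .seq (.write _ _ _ _ (by decide) (by decide)) (.seq (.write _ _ _ _ (by decide) (by decide))
    (.seq (.write _ _ _ _ (by decide) (by decide)) (.seq (alloc_makeRoot (by decide))
      alloc_updateMin)))

theorem alloc_decreaseKey : Alloc (decreaseKey .v) :=
  .seq (.assign _ _ (by decide)) (.seq (.ite (.seq (.assign _ _ (by decide)) (.loop
    (.seq (alloc_makeRoot (by decide)) (.seq (.write _ _ _ _ (by decide) (by decide))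
      (.ite (.seq (.assign _ _ (by decide)) (.assign _ _ (by decide)))
        (.seq (.ite (.write _ _ _ _ (by decide) (by decide)) .skip)
          (.assign _ _ (by decide)))))))) .skip) alloc_updateMin)

theorem alloc_link : Alloc link :=
  .seq (.write _ _ _ _ (by decide) (by decide)) (.seq (.write _ _ _ _ (by decide) (by decide))
    (.seq (.push _ _ _ rfl rfl (by decide) (by decide)) (.write _ _ _ _ (by decide) (by decide))))

theorem alloc_consolidate : Alloc consolidate :=
  .seq (.assign _ _ (by decide)) (.seq (.assign _ _ (by decide))
    (.seq (.write _ _ _ _ (by decide) (by decide)) (.seq (.loop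
      (.seq (.assign _ _ (by decide)) (.seq (.assign _ _ (by decide)) (.ite .skip
        (.seq (.assign _ _ (by decide)) (.seq (.loop (.seq (.assign _ _ (by decide))
          (.seq (.write _ _ _ _ (by decide) (by decide)) (.seq (.ite
            (.seq (.assign _ _ (by decide)) (.seq (.assign _ _ (by decide))
              (.assign _ _ (by decide)))) .skip) (.seq alloc_link (.assign _ _ (by decide)))))))
          (.seq (.write _ _ _ _ (by decide) (by decide))
            (.ite (.assign _ _ (by decide)) .skip))))))))
      (.seq (.assign _ _ (by decide)) (.loop (.seq (.assign _ _ (by decide))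
        (.seq (.assign _ _ (by decide)) (.ite (.seq (.write _ _ _ _ (by decide) (by decide))
          (.seq (alloc_makeRoot (by decide)) alloc_updateMin)) .skip))))))))

theorem alloc_forCells {p : Reg} {h : Expr} {c : Cmd} (hp : p ≠ .cell) (hc : Alloc c) :
    Alloc (forCells p h c) :=
  .seq (.assign _ _ hp) (.loop (.seq hc (.assign _ _ hp)))

theorem alloc_forRange {p : Reg} {lo hi : Expr} {c : Cmd} (hp : p ≠ .cell) (hc : Alloc c) :
    Alloc (forRange p lo hi c) :=
  .seq (.assign _ _ hp) (.loop (.seq hc (.assign _ _ hp)))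

theorem alloc_dequeue : Alloc dequeue :=
  .seq (.assign _ _ (by decide)) (.seq (.write _ _ _ _ (by decide) (by decide))
    (.seq (alloc_forCells (by decide) (.seq (.assign _ _ (by decide))
      (.ite (alloc_makeRoot (by decide)) .skip)))
    (.seq (.write _ _ _ _ (by decide) (by decide)) (.seq (.write _ _ _ _ (by decide) (by decide))
      alloc_consolidate))))

theorem alloc_relax {a : Expr} : Alloc (relax a) :=
  .ite (.seq (.wwrite _ _ _) (.seq (.write _ _ _ _ (by decide) (by decide))
    (.seq (.write _ _ _ _ (by decide) (by decide)) (.ite alloc_decreaseKey alloc_enqueue)))) .skip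

theorem alloc_initSource : Alloc initSource :=
  .seq (alloc_forRange (by decide) (.wwrite _ _ _)) (.seq (.assign _ _ (by decide))
    (.seq (.wwrite _ _ _) alloc_enqueue))

/-! ### Gallo's algorithm -/

/-- The lists `inc[x]` contain the elements `L x`. -/
def Lists (a : Arr) (L : ℕ → List ℕ) (s : Mem) : Prop := ∀ x, IsL s (s.a1 a x) (L x)

theorem Lists.congr {a : Arr} {L : ℕ → List ℕ} {s s' : Mem} (h : Lists a L s) (hx : Extends s s')
    (ha : s'.a1 a = s.a1 a) : Lists a L s' := by
  intro x
  rw [ha]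
  exact (h x).mono hx

theorem Lists.exec {a : Arr} {L : ℕ → List ℕ} {s s' : Mem} (h : Lists a L s) {c : Cmd} {t : ℕ}
    (hE : Exec c s t s') (hc : Alloc c) (ha : c.modArr a = false) : Lists a L s' :=
  h.congr (hc.extends hE) (hE.a1_eq ha)

theorem Lists.pushed {a : Arr} {L : ℕ → List ℕ} {s : Mem} (h : Lists a L s) (x b : ℕ)
    (he : a ≠ .elt) (hn : a ≠ .nxt) :
    Lists a (Function.update L x (b :: L x)) (s.pushed a x b) := by
  intro y
  rw [Mem.a1_pushed _ _ _ he hn, if_pos rfl]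
  by_cases e : y = x
  · subst e
    simpa using (h y).pushed he hn
  · simpa [e] using (h y).mono (s.extends_pushed x b he hn)

theorem gallo_body_spec {H : WHypergraph n m} {src : Fin n} {L : ℕ → List ℕ} {card : ℕ → ℕ}
    (hcard : ∀ j : Fin m, card (j + 1) = (H.edge j).card)
    (hL : ∀ x e, e ∈ L x ↔ ∃ j : Fin m, e = j + 1 ∧ x ∈ H.verts j)
    {z : Fin n} {F : Finset ℕ} {t T : ℕ} {s : Mem}
    (h : Scan H src F z s (Lists .inc L) (fun _ _ => False) T t s) :
    wp (forCells .q (get1 .inc Reg.z) (block [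
        .assign .e (eltAt .q),
        forRange .k 0 (get1 .card Reg.e) (block [
          .assign .v (.get .vert Reg.e Reg.k),
          relax Reg.e])])) t s fun t' s' =>
      Scan H src F z s (Lists .inc L) (fun j v => z ∈ H.edge j ∧ v ∈ H.edge j)
        (T + ((L (z + 1)).map fun e => 10 + 430 * card e).sum + 2) t' s' := by
  refine wp_forCells (l := L (z + 1)) (fun l t' s' => ∃ d, L (z + 1) = d ++ l ∧
    Scan H src F z s (Lists .inc L) (fun j v => (j : ℕ) + 1 ∈ d ∧ v ∈ H.edge j)
      (T + (d.map fun e => 10 + 430 * card e).sum + 1) t' s')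
    (by decide) ?_ (by decide) ?_ ?_ ?_ ?_
  · exact .seq (.assign _ _ (by decide)) (alloc_forRange (by decide)
      (.seq (.assign _ _ (by decide)) alloc_relax))
  · simpa [h.reg_z] using h.prop (z + 1)
  · refine ⟨[], rfl, ?_⟩
    refine (h.setReg (by decide) _ ?_).mono (by simp; omega) (by simp)
    exact h.prop.congr (s.extends_setReg (by decide) _) rfl
  · rintro e l t1 s1 ⟨d, hd, h1⟩ he
    obtain ⟨j, rfl, hj⟩ := (hL (z + 1) e).1 (by simp [hd])
    rw [H.succ_mem_verts] at hj
    rw [block, wp_seq, wp_assign, block]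
    simp only [eval_eltAt, he]
    refine wp_forRange (N := (H.edge j).card) (fun k t' s' => s'.reg .e = j + 1 ∧
      Scan H src F z s (Lists .inc L) (fun j' v' => ((j' : ℕ) + 1 ∈ d ∧ v' ∈ H.edge j') ∨
        j' = j ∧ (v' : ℕ) + 1 ∈ (H.verts j).take k)
      (T + (d.map fun e => 10 + 430 * card e).sum + 4 + 430 * k) t' s') (by decide) (by simp)
      ?_ ?_ ?_ ?_
    · refine ⟨by simp, ?_⟩
      refine ((h1.setReg (x := .e) (by decide) (j + 1) ?_).setReg (by decide) _ ?_).mono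
        (by simp; omega) (by simp)
      · exact h1.prop.congr (s1.extends_setReg (by decide) _) rfl
      · exact h1.prop.congr ((s1.extends_setReg (by decide) _).trans
          (Mem.extends_setReg _ (by decide) _)) rfl
    · rintro k t' s' ⟨he', h'⟩
      simp [he', h'.labels.input.card]
    · rintro k t2 s2 ⟨he2, h2⟩ hk2 hk
      rw [block, wp_seq, wp_assign, block]
      simp only [Expr.eval_get, Expr.eval_reg, he2, hk2, h2.labels.input.vert]
      have hlen : k < (H.verts j).length := by simpa using hk
      rw [List.getD_eq_getElem _ _ hlen]
      obtain ⟨v, hv, hve⟩ := (H.mem_verts (j := j)).1 (List.getElem_mem hlen)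
      rw [← hve]
      have h3 := h2.setReg (x := .v) (by decide) ((v : ℕ) + 1)
        (h2.prop.congr (s2.extends_setReg (by decide) _) rfl)
      refine (Scan.relax (a := .reg .e) (j := j) (v := v)
        (h3.mono (t' := t2 + 1 + 1) (T' := T + (d.map fun e => 10 + 430 * card e).sum + 6 + 430 * k)
        (by omega) fun _ _ h => h) ?_ (by decide) (by simp) (by simp [he2]) ?_ hj hv).exec ?_
      · intro t s s' hE hP
        exact hP.exec hE alloc_relax (by decide)
      · intro s' hr _
        simp [hr, he2]
      · rintro t' s' hE h4
        have hes : s'.reg .e = j + 1 := by rw [hE.reg_eq (by decide)]; simp [he2]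
        refine ⟨by simp [hes], (h4.setReg (by decide) _ ?_).mono (by omega) ?_⟩
        · exact h4.prop.congr (Mem.extends_setReg _ (by decide) _) rfl
        · rintro j' v' (h | ⟨rfl, h⟩)
          · exact Or.inl (Or.inl h)
          · rw [List.take_succ_eq_append_getElem hlen, List.mem_append, List.mem_singleton,
              ← hve] at h
            rcases h with h | h
            · exact Or.inl (Or.inr ⟨rfl, h⟩)
            · exact Or.inr ⟨rfl, Fin.ext (by omega)⟩
    · rintro t' s' ⟨he', h'⟩ q
      refine ⟨d ++ [(j : ℕ) + 1], by simp [hd], ?_⟩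
      have hlj : (H.verts j).take (H.edge j).card = H.verts j := by
        rw [← H.length_verts, List.take_length]
      rw [hlj] at h'
      refine (h'.setReg (by decide) _ ?_).mono ?_ ?_
      · exact h'.prop.congr (Mem.extends_setReg _ (by decide) _) rfl
      · simp only [List.map_append, List.sum_append, List.map_cons, List.sum_cons, List.map_nil,
          List.sum_nil, hcard]
        omega
      · rintro j' v' ⟨hj', hv'⟩
        rw [List.mem_append, List.mem_singleton] at hj'
        rcases hj' with hj' | hj'
        · exact Or.inl ⟨hj', hv'⟩
        · obtain rfl : j' = j := Fin.ext (by omega)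
          exact Or.inr ⟨rfl, H.succ_mem_verts.2 hv'⟩
  · rintro t' s' ⟨d, hd, h'⟩
    rw [List.append_nil] at hd
    subst hd
    refine h'.mono (by omega) fun j v hj => ⟨?_, hj.2⟩
    rw [hL]
    exact ⟨j, rfl, H.succ_mem_verts.2 hj.1⟩

/-- The lists of the hyperedges at the vertices, as computed by Gallo's algorithm. -/
theorem incLists_spec {H : WHypergraph n m} {src : Fin n} {s : Mem} {t : ℕ} (g : ℕ → ℕ)
    (hin : HasInput H src s) (hinc : ∀ x, s.a1 .inc x = 0) :
    wp (forRange .e 1 (Reg.m + 1)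
      (forRange .k 0 (get1 .card Reg.e)
        (push .inc (.get .vert Reg.e Reg.k) Reg.e))) t s fun t' s' =>
      t' ≤ t + 2 + ∑ j : Fin m, (5 + 6 * (H.edge j).card) ∧
      ∃ L, Lists .inc L s' ∧ (∀ x e, e ∈ L x ↔ ∃ j : Fin m, e = j + 1 ∧ x ∈ H.verts j) ∧
        ∑ x ∈ Finset.Icc 1 n, ((L x).map g).sum = ∑ j : Fin m, (H.edge j).card * g (j + 1) := by
  have hnc : ∀ x : Reg, x ≠ .cell → Expr.noCell (.reg x) = true := fun x hx => by
    simp [Expr.noCell, hx]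
  have hsum : ∀ f : ℕ → ℕ, ∑ i ∈ Finset.Ico 1 (m + 1), f i = ∑ j : Fin m, f (j + 1) := by
    intro f
    rw [Finset.sum_Ico_eq_sum_range, Nat.add_sub_cancel, Finset.sum_range]
    exact Finset.sum_congr rfl fun j _ => by rw [add_comm]
  have hpc : (Expr.get .vert (.reg .e) (.reg .k)).noCell = true := by decide
  have hcard : ∀ j : Fin m, s.a1 .card (j + 1) = (H.edge j).card := hin.card
  refine wp_forRange (N := m + 1) (fun k t' s' => 1 ≤ k ∧ HasInput H src s' ∧
    t' ≤ t + 1 + ∑ i ∈ Finset.Ico 1 k, (5 + 6 * s.a1 .card i) ∧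
    ∃ L, Lists .inc L s' ∧ (∀ x e, e ∈ L x ↔ ∃ j : Fin m, e = j + 1 ∧ e < k ∧ x ∈ H.verts j) ∧
      ∑ x ∈ Finset.Icc 1 n, ((L x).map g).sum = ∑ i ∈ Finset.Ico 1 k, s.a1 .card i * g i)
    (by decide) (by simp) ?_ ?_ ?_ ?_
  · refine ⟨by simp, hin.setReg (by decide) _, by simp, fun _ => [], ?_, ?_, by simp⟩
    · intro x
      simp [hinc]
    · intro x e
      simp only [List.not_mem_nil, Expr.eval_one, false_iff]
      rintro ⟨j, rfl, h, -⟩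
      omega
  · rintro k t' s' ⟨-, h, -⟩
    simp [h.reg_m]
  · rintro k t1 s1 ⟨hk1, hin1, ht1, L, hL, hmem, hs⟩ hke hkm
    obtain ⟨j, rfl⟩ : ∃ j : Fin m, k = j + 1 := ⟨⟨k - 1, by omega⟩, by simp; omega⟩
    refine wp_forRange (N := (H.edge j).card) (fun i t' s' => HasInput H src s' ∧
      s'.reg .e = j + 1 ∧
      t' ≤ t + 3 + ∑ i ∈ Finset.Ico 1 ((j : ℕ) + 1), (5 + 6 * s.a1 .card i) + 6 * i ∧
      ∃ L, Lists .inc L s' ∧ (∀ x e, e ∈ L x ↔ (∃ j' : Fin m, e = j' + 1 ∧ e < j + 1 ∧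
        x ∈ H.verts j') ∨ (e = j + 1 ∧ x ∈ (H.verts j).take i)) ∧
      ∑ x ∈ Finset.Icc 1 n, ((L x).map g).sum =
        ∑ i ∈ Finset.Ico 1 ((j : ℕ) + 1), s.a1 .card i * g i + i * g (j + 1))
      (by decide) (by simp) ?_ ?_ ?_ ?_
    · refine ⟨hin1.setReg (by decide) _, by simp [hke], by simp; omega, L,
        hL.congr (s1.extends_setReg (by decide) _) rfl, ?_, by simpa using hs⟩
      intro x e
      simp [hmem]
    · rintro i t' s' ⟨h, he, -⟩
      simp [he, h.card]
    · rintro i t2 s2 ⟨hin2, he2, ht2, L2, hL2, hmem2, hs2⟩ hi2 hi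
      have hlen : i < (H.verts j).length := by simpa using hi
      rw [wp_push hpc (hnc _ (by decide)) (by decide)]
      simp only [Expr.eval_get, Expr.eval_reg, he2, hi2, hin2.vert]
      rw [List.getD_eq_getElem _ _ hlen]
      obtain ⟨v, hv, hve⟩ := (H.mem_verts (j := j)).1 (List.getElem_mem hlen)
      have hxI : (H.verts j)[i] ∈ Finset.Icc 1 n := by
        rw [← hve, Finset.mem_Icc]
        omega
      have hxn : (H.verts j)[i] ∉ (H.verts j).take i := by
        intro h
        obtain ⟨i', hi', he⟩ := List.getElem_of_mem h
        rw [List.getElem_take, (H.nodup_verts j).getElem_inj_iff] at he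
        rw [List.length_take] at hi'
        omega
      have htake := List.take_succ_eq_append_getElem hlen
      generalize (H.verts j)[i] = x at *
      refine ⟨?_, ?_, ?_, Function.update L2 x (((j : ℕ) + 1) :: L2 x), ?_, ?_, ?_⟩
      · refine (hin2.congr (s' := s2.pushed .inc x (j + 1)) ?_ ?_ rfl).setReg (by decide) _
        · intro y hy
          have : y ≠ .cell := by rintro rfl; simp at hy
          simp [this]
        · intro a ha
          rw [Mem.arr_pushed]
          all_goals (rintro rfl; simp at ha)
      · simp [he2]
      · omega
      · exact (hL2.pushed x _ (by decide) (by decide)).congr (Mem.extends_setReg _ (by decide) _) rfl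
      · intro y e
        rw [htake, List.mem_append, List.mem_singleton]
        by_cases ey : y = x
        · subst ey
          rw [Function.update_self, List.mem_cons, hmem2]
          constructor
          · rintro (h | h | h)
            exacts [Or.inr ⟨h, Or.inr rfl⟩, Or.inl h, Or.inr ⟨h.1, Or.inl h.2⟩]
          · rintro (h | h)
            exacts [Or.inr (Or.inl h), Or.inl h.1]
        · rw [Function.update_of_ne ey, hmem2]
          simp only [ey, or_false]
      · have := sum_comp_update hxI (fun l : List ℕ => (l.map g).sum) L2 (((j : ℕ) + 1) :: L2 x)
        simp only [List.map_cons, List.sum_cons] at this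
        rw [add_mul, one_mul]
        omega
    · rintro t' s' ⟨h, he, ht', L', hL', hmem', hs'⟩
      have hlj : (H.verts j).take (H.edge j).card = H.verts j := by
        rw [← H.length_verts, List.take_length]
      rw [hlj] at hmem'
      refine ⟨by omega, h.setReg (by decide) _, ?_, L',
        hL'.congr (Mem.extends_setReg _ (by decide) _) rfl, ?_, ?_⟩
      · rw [Finset.sum_Ico_succ_top (by omega), hcard]
        omega
      · intro x e
        rw [hmem']
        constructor
        · rintro (⟨j', h1, h2, h3⟩ | ⟨h1, h2⟩)
          · exact ⟨j', h1, by omega, h3⟩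
          · exact ⟨j, h1, by omega, h2⟩
        · rintro ⟨j', rfl, h2, h3⟩
          by_cases e : (j' : ℕ) = j
          · obtain rfl := Fin.ext e
            exact Or.inr ⟨rfl, h3⟩
          · exact Or.inl ⟨j', rfl, by omega, h3⟩
      · rw [Finset.sum_Ico_succ_top (by omega), hs', hcard]
  · rintro t' s' ⟨-, h, ht', L, hL, hmem, hs⟩
    rw [hsum] at ht' hs
    simp only [hcard] at ht' hs
    refine ⟨by omega, L, hL, fun x e => ?_, hs⟩
    rw [hmem]
    constructor
    · rintro ⟨j, h1, -, h3⟩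
      exact ⟨j, h1, h3⟩
    · rintro ⟨j, h1, h3⟩
      exact ⟨j, h1, by omega, h3⟩

theorem gallo_spec (H : WHypergraph n m) (src : Fin n) :
    ∃ t s', Exec gallo (input H src) t s' ∧
      t ≤ 280 * (n * Nat.log 2 n) + 400 * n + 500 * H.Phi ∧
      ∀ v : Fin n, v ≠ src → s'.wt .D (v + 1) = H.dist src v := by
  have hin := hasInput_input H src
  have hfresh : Fresh (input H src) := by
    refine ⟨fun a ha x => ?_, rfl⟩
    cases a <;> first | rfl | simp at ha
  set card := (input H src).a1 .card with hcard
  suffices h : wp gallo 0 (input H src) fun t s' =>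
      t ≤ 280 * (n * Nat.log 2 n) + 400 * n + 500 * H.Phi ∧
      ∀ v : Fin n, v ≠ src → s'.wt .D (v + 1) = H.dist src v by
    obtain ⟨t, s', hE, h1, h2⟩ := h
    exact ⟨t, s', hE, by omega, h2⟩
  unfold gallo
  rw [block, wp_seq]
  -- The weight given to `e` is the cost of scanning it once. Since `e` is in the lists of `|e|`
  -- vertices, the total is a sum of `|e| * (10 + 430 * |e|)`, at most `440 * Φ`.
  refine (incLists_spec (fun e => 10 + 430 * card e) hin (fun _ => rfl)).exec ?_
  rintro t1 s1 hE1 ⟨ht1, L, hL1, hmem, hsum⟩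
  have hin1 := hin.exec hE1 (by decide)
  have hfresh1 : Fresh s1 := by
    refine ⟨fun a ha x => ?_, (hE1.reg_eq (by decide)).trans rfl⟩
    rw [hE1.a1_eq]
    · exact hfresh.a1 a ha x
    · simp only [List.mem_cons, List.not_mem_nil, or_false] at ha
      rcases ha with rfl | rfl | rfl | rfl | rfl | rfl | rfl <;> decide
  rw [block, wp_seq]
  refine (initSource_spec hin1 hfresh1).exec ?_
  rintro t2 s2 hE2 ⟨hL2, hH2⟩
  have hlists := hL1.exec hE2 alloc_initSource (by decide)
  refine (dijkstra_loop_spec (P := Lists .inc L)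
    (scan := fun z => ((L z).map fun e => 10 + 430 * card e).sum + 2) ?_ ?_ hL2 hlists hH2).mono ?_
  · intro t s s' hE hP
    exact hP.exec hE alloc_dequeue (by decide)
  · intro z F t T s hL hP hH hz hzF hle
    refine (gallo_body_spec (card := card) hin.card hmem ⟨hL, hP, hH, .of_eq rfl, hz, hzF, hle,
      fun _ _ h => h.elim⟩).mono ?_
    intro t' s' h'
    exact ⟨h'.labels, h'.prop, h'.heap, h'.improves, fun j hj v hv => h'.done j v ⟨hj, hv⟩⟩
  · rintro t3 s3 ⟨ht3, hD⟩
    refine ⟨?_, hD⟩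
    have hcards : ∀ j : Fin m, card (j + 1) = (H.edge j).card := hin.card
    simp only [Finset.sum_add_distrib, Finset.sum_const, Nat.card_Icc, Nat.add_sub_cancel,
      smul_eq_mul, hsum, hcards] at ht3
    have h1 : ∑ j : Fin m, (5 + 6 * (H.edge j).card) ≤ 11 * H.Phi := by
      rw [WHypergraph.Phi, Finset.mul_sum]
      refine Finset.sum_le_sum fun j _ => ?_
      have := (H.edge_nonempty j).card_pos
      nlinarith
    have h2 : ∑ j : Fin m, (H.edge j).card * (10 + 430 * (H.edge j).card) ≤ 440 * H.Phi := by
      rw [WHypergraph.Phi, Finset.mul_sum]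
      refine Finset.sum_le_sum fun j _ => ?_
      have := (H.edge_nonempty j).card_pos
      nlinarith
    have h3 : 1 ≤ n := by have := src.isLt; omega
    have h4 : n * (280 * Nat.log 2 n) = 280 * (n * Nat.log 2 n) := by ring
    omega

/-! ### Dijkstra's algorithm in the underlying graph -/

/-- The lists `L x` of neighbours and the hyperedges `best[x, y]` represent the underlying graph, as
far as it is determined by the pairs of vertices `x`, `y` of hyperedges `j` with `S j x y`. -/
structure Graph (H : WHypergraph n m) (s : Mem) (L : ℕ → List ℕ) (S : Fin m → ℕ → ℕ → Prop) :
    Prop where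
  lists : Lists .adj L s
  mem : ∀ x y, y ∈ L x ↔ s.arr .best x y ≠ 0
  best : ∀ x y, s.arr .best x y ≠ 0 →
    ∃ j : Fin m, s.arr .best x y = j + 1 ∧ x ∈ H.verts j ∧ y ∈ H.verts j
  le : ∀ j x y, S j x y → x ≠ y → s.arr .best x y ≠ 0 ∧
    ∀ j' : Fin m, s.arr .best x y = j' + 1 → H.weight j' ≤ H.weight j

theorem Graph.mono {H : WHypergraph n m} {s s' : Mem} {L : ℕ → List ℕ}
    {S S' : Fin m → ℕ → ℕ → Prop} (h : Graph H s L S) (hx : Extends s s')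
    (ha : s'.a1 .adj = s.a1 .adj) (hb : s'.arr .best = s.arr .best)
    (hS : ∀ j x y, S' j x y → x ≠ y → S j x y) : Graph H s' L S' :=
  ⟨h.lists.congr hx ha, by rw [hb]; exact h.mem, by rw [hb]; exact h.best, by
    rw [hb]; exact fun j x y h' hne => h.le j x y (hS j x y h' hne) hne⟩

/-- Only the hyperedges recorded in `B` are relaxed; the inequalities for the other hyperedges at
`z` are derived afterwards from the minimality of `best`. -/
theorem dijkstra_body_spec {H : WHypergraph n m} {src : Fin n} {L : ℕ → List ℕ} {B : ℕ → ℕ → ℕ}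
    (hLB : ∀ x, ∀ y ∈ L x, ∃ j : Fin m, B x y = j + 1 ∧ x ∈ H.verts j ∧ y ∈ H.verts j)
    {z : Fin n} {F : Finset ℕ} {t T : ℕ} {s : Mem}
    (h : Scan H src F z s (fun s => Lists .adj L s ∧ s.arr .best = B) (fun _ _ => False) T t s) :
    wp (forCells .q (get1 .adj Reg.z) (block [
        .assign .v (eltAt .q),
        relax (.get .best Reg.z Reg.v)])) t s fun t' s' =>
      Scan H src F z s (fun s => Lists .adj L s ∧ s.arr .best = B)
        (fun j v => (v : ℕ) + 1 ∈ L (z + 1) ∧ B (z + 1) (v + 1) = j + 1)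
        (T + 430 * (L (z + 1)).length + 2) t' s' := by
  refine wp_forCells (l := L (z + 1)) (fun l t' s' => ∃ d, L (z + 1) = d ++ l ∧
    Scan H src F z s (fun s => Lists .adj L s ∧ s.arr .best = B)
      (fun j v => (v : ℕ) + 1 ∈ d ∧ B (z + 1) (v + 1) = j + 1)
      (T + 430 * d.length + 1) t' s')
    (by decide) ?_ (by decide) ?_ ?_ ?_ ?_
  · exact .seq (.assign _ _ (by decide)) alloc_relax
  · simpa [h.reg_z] using h.prop.1 (z + 1)
  · refine ⟨[], rfl, ?_⟩
    refine (h.setReg (by decide) _ ⟨?_, h.prop.2⟩).mono (by simp; omega) (by simp)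
    exact h.prop.1.congr (s.extends_setReg (by decide) _) rfl
  · rintro y l t1 s1 ⟨d, hd, h1⟩ he
    obtain ⟨j, hB, hzj, hvj⟩ := hLB (z + 1) y (by simp [hd])
    obtain ⟨v, hv, rfl⟩ := H.mem_verts.1 hvj
    rw [H.succ_mem_verts] at hzj
    rw [block, wp_seq, wp_assign, block]
    simp only [eval_eltAt, he]
    have h2 := h1.setReg (x := .v) (by decide) ((v : ℕ) + 1)
      ⟨h1.prop.1.congr (s1.extends_setReg (by decide) _) rfl, h1.prop.2⟩
    have hz1 := h1.reg_z
    have hb1 := h1.prop.2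
    refine (Scan.relax (j := j) (v := v) (h2.mono (t' := t1 + 1 + 1)
      (T' := T + 430 * d.length + 3) (by omega) fun _ _ h => h) ?_ (by decide) (by simp)
      (by simp [hz1, hb1, hB]) ?_ hzj hv).mono ?_
    · rintro t s s' hE ⟨hP, hP'⟩
      exact ⟨hP.exec hE alloc_relax (by decide), (hE.arr_eq (by decide)).trans hP'⟩
    · intro s' hr ha
      simp [hr, ha .best (by decide), hz1, hb1, hB]
    · intro t' s' h' q
      refine ⟨d ++ [(v : ℕ) + 1], by simp [hd], (h'.setReg (by decide) _ ?_).mono ?_ ?_⟩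
      · exact ⟨h'.prop.1.congr (Mem.extends_setReg _ (by decide) _) rfl, h'.prop.2⟩
      · simp only [List.length_append, List.length_singleton]
        omega
      · rintro j' v' ⟨hv', hB'⟩
        rw [List.mem_append, List.mem_singleton] at hv'
        rcases hv' with hv' | hv'
        · exact Or.inl ⟨hv', hB'⟩
        · obtain rfl : v' = v := Fin.ext (by omega)
          exact Or.inr ⟨Fin.ext (by omega), rfl⟩
  · rintro t' s' ⟨d, hd, h'⟩
    rw [List.append_nil] at hd
    subst hd
    exact h'.mono (by omega) fun j v hj => hj

theorem dijkstra_spec {H : WHypergraph n m} {src : Fin n} {s : Mem} {L : ℕ → List ℕ} {t : ℕ}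
    (hin : HasInput H src s) (hf : Fresh s)
    (hG : Graph H s L fun j x y => x ∈ H.verts j ∧ y ∈ H.verts j) :
    wp dijkstra t s fun t' s' =>
      t' ≤ t + 280 * (n * Nat.log 2 n) + 400 * n + 430 * ∑ x ∈ Finset.Icc 1 n, (L x).length ∧
      ∀ v : Fin n, v ≠ src → s'.wt .D (v + 1) = H.dist src v := by
  unfold dijkstra
  rw [block, wp_seq]
  refine (initSource_spec hin hf).exec ?_
  rintro t2 s2 hE2 ⟨hL2, hH2⟩
  have hlists := hG.lists.exec hE2 alloc_initSource (by decide)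
  have hbest : s2.arr .best = s.arr .best := hE2.arr_eq (by decide)
  refine (dijkstra_loop_spec (P := fun s' => Lists .adj L s' ∧ s'.arr .best = s.arr .best)
    (scan := fun z => 430 * (L z).length + 2) ?_ ?_ hL2 ⟨hlists, hbest⟩ hH2).mono ?_
  · rintro t s s' hE ⟨hP, hP'⟩
    exact ⟨hP.exec hE alloc_dequeue (by decide), (hE.arr_eq (by decide)).trans hP'⟩
  · intro z F t T s1 hL hP hH hz hzF hle
    refine (dijkstra_body_spec (B := s.arr .best) (fun x y hy => hG.best x y ((hG.mem x y).1 hy))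
      ⟨hL, hP, hH, .of_eq rfl, hz, hzF, hle, fun _ _ h => h.elim⟩).mono ?_
    intro t' s' h'
    refine ⟨h'.labels, h'.prop, h'.heap, h'.improves, fun j hj v hv => ?_⟩
    -- The graph has no loops, but for `v = z` the inequality is trivial.
    by_cases e : v = z
    · subst e; exact le_self_add
    · obtain ⟨h1, h2⟩ := hG.le j (z + 1) (v + 1) ⟨H.succ_mem_verts.2 hj, H.succ_mem_verts.2 hv⟩
        (fun h => e (Fin.ext (by omega)))
      obtain ⟨j', hj', -⟩ := hG.best _ _ h1
      refine (h'.done j' v ⟨(hG.mem _ _).2 h1, hj'⟩).trans ?_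
      gcongr
      exact h2 j' hj'
  · rintro t3 s3 ⟨ht3, hD⟩
    refine ⟨?_, hD⟩
    simp only [Finset.sum_add_distrib, Finset.sum_const, Nat.card_Icc, Nat.add_sub_cancel,
      smul_eq_mul, ← Finset.mul_sum] at ht3
    have h3 : 1 ≤ n := by have := src.isLt; omega
    have h4 : n * (280 * Nat.log 2 n) = 280 * (n * Nat.log 2 n) := by ring
    omega

/-! ### The underlying graph, by a scan of all pairs -/

@[simp] theorem Mem.arr_setArr_apply (s : Mem) (a : Arr) (i j b i' j' : ℕ) :
    (s.setArr a i j b).arr a i' j' = if i' = i ∧ j' = j then b else s.arr a i' j' := by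
  simp [Mem.setArr]

/-- The last inequality says that the lists grow by no more than the number of steps taken. Thus a
time bound for the construction also bounds the number of neighbours that Dijkstra's algorithm will
scan. -/
theorem graph_step_spec {H : WHypergraph n m} {src : Fin n} {s : Mem} {L : ℕ → List ℕ}
    {S : Fin m → ℕ → ℕ → Prop} {t i j : ℕ} {k : Fin m} (hin : HasInput H src s)
    (hG : Graph H s L S) (he : s.reg .e = k + 1) (hi : s.reg .i = i) (hj : s.reg .j = j)
    (hil : i < (H.verts k).length) (hjl : j < (H.verts k).length) :
    wp (block [
          .assign .x (.get .vert Reg.e Reg.i),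
          .assign .y (.get .vert Reg.e Reg.j),
          .ite (.eq Reg.x Reg.y) .skip
            (.ite (.eq (.get .best Reg.x Reg.y) 0)
              (block [
                .write .best Reg.x Reg.y Reg.e,
                push .adj Reg.x Reg.y])
              (when (.wlt (wOf Reg.e) (wOf (.get .best Reg.x Reg.y)))
                (.write .best Reg.x Reg.y Reg.e)))]) t s fun t' s' =>
      t' ≤ t + 9 ∧ ∃ L', Graph H s' L' (fun k' x y => S k' x y ∨
        k' = k ∧ x = (H.verts k)[i] ∧ y = (H.verts k)[j]) ∧
        t + ∑ x ∈ Finset.Icc 1 n, (L' x).length ≤ t' + ∑ x ∈ Finset.Icc 1 n, (L x).length := by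
  have hnc : ∀ x : Reg, x ≠ .cell → Expr.noCell (.reg x) = true := fun x hx => by
    simp [Expr.noCell, hx]
  have hxk := List.getElem_mem hil
  have hyk := List.getElem_mem hjl
  simp only [block, wp_seq, wp_assign, Expr.eval_get, Expr.eval_reg, he, hi, hj, Mem.arr_setReg,
    Mem.reg_setReg, reduceCtorEq, if_false, hin.vert, List.getD_eq_getElem _ _ hil,
    List.getD_eq_getElem _ _ hjl]
  generalize (H.verts k)[i] = x at *
  generalize (H.verts k)[j] = y at *
  have hxI : x ∈ Finset.Icc 1 n := by
    obtain ⟨v, hv, rfl⟩ := H.mem_verts.1 hxk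
    rw [Finset.mem_Icc]
    omega
  set s1 := (s.setReg .x x).setReg .y y with hs1
  have hx1 : Extends s s1 := (s.extends_setReg (by decide) _).trans
    (Mem.extends_setReg _ (by decide) _)
  have hr1 : ∀ q, q ≠ .x → q ≠ .y → s1.reg q = s.reg q := fun q h1 h2 => by simp [hs1, h1, h2]
  have hxr : s1.reg .x = x := by simp [hs1]
  have hyr : s1.reg .y = y := by simp [hs1]
  have hw1 : s1.wt = s.wt := rfl
  have hb1 : s1.arr .best = s.arr .best := rfl
  have hG1 : Graph H s1 L S := hG.mono hx1 rfl rfl fun _ _ _ h _ => h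
  clear_value s1
  simp only [wp_ite, Test.holds_eq, Expr.eval_reg, hxr, hyr, wp_skip, Expr.eval_get, Expr.eval_zero,
    wp_seq, wp_write, wp_push (hnc _ (show Reg.x ≠ .cell by decide))
    (hnc _ (show Reg.y ≠ .cell by decide)) (show Arr.adj ≠ .elt by decide), wp_when, Test.holds_wlt,
    eval_wOf, hr1 .e (by decide) (by decide), he, hw1, hb1, Mem.reg_setArr]
  constructor
  · rintro rfl
    refine ⟨by omega, L, hG1.mono (.refl _) rfl rfl ?_, by omega⟩
    rintro k' x' y' (h | ⟨rfl, rfl, rfl⟩) hne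
    · exact h
    · exact absurd rfl hne
  · intro hxy
    constructor
    · intro hb
      refine ⟨by omega, Function.update L x (y :: L x), ⟨?_, ?_, ?_, ?_⟩, ?_⟩
      · exact (hG1.lists.congr (Mem.extends_setArr _ (by decide) (by decide) _ _ _)
          (by simp)).pushed x y (by decide) (by decide)
      · intro x' y'
        rw [Mem.arr_pushed _ _ _ (by decide) (by decide) (by decide), Mem.arr_setArr_apply, hb1]
        by_cases ex : x' = x
        · subst ex
          rw [Function.update_self, List.mem_cons, hG.mem]
          by_cases ey : y' = y <;> simp [ey]
        · rw [Function.update_of_ne ex, hG.mem]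
          simp [ex]
      · intro x' y'
        rw [Mem.arr_pushed _ _ _ (by decide) (by decide) (by decide), Mem.arr_setArr_apply, hb1]
        split
        · rename_i h
          intro _
          exact ⟨k, rfl, by rw [h.1]; exact hxk, by rw [h.2]; exact hyk⟩
        · exact hG.best x' y'
      · intro k' x' y' hS hne
        rw [Mem.arr_pushed _ _ _ (by decide) (by decide) (by decide), Mem.arr_setArr_apply, hb1]
        by_cases e : x' = x ∧ y' = y
        · rw [if_pos e]
          refine ⟨by omega, fun j' hj' => ?_⟩
          obtain rfl : k = j' := Fin.ext (by omega)
          rcases hS with hS | ⟨rfl, -, -⟩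
          · have := (hG.le k' x' y' hS hne).1
            rw [e.1, e.2] at this
            exact absurd hb this
          · exact le_rfl
        · rw [if_neg e]
          rcases hS with hS | ⟨-, h1, h2⟩
          · exact hG.le k' x' y' hS hne
          · exact absurd ⟨h1, h2⟩ e
      · have := sum_length_update hxI L (y :: L x)
        rw [List.length_cons] at this
        omega
    · intro hb
      obtain ⟨j₀, hj₀, hxj, hyj⟩ := hG.best x y hb
      rw [hj₀, hin.wt, hin.wt]
      simp only [ENNReal.coe_lt_coe]
      constructor
      · intro hlt
        refine ⟨by omega, L, ⟨?_, ?_, ?_, ?_⟩, by omega⟩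
        · exact hG1.lists.congr (Mem.extends_setArr _ (by decide) (by decide) _ _ _) (by simp)
        · intro x' y'
          rw [Mem.arr_setArr_apply, hb1, hG.mem]
          split
          · rename_i h
            rw [h.1, h.2]
            simp [hb]
          · rfl
        · intro x' y'
          rw [Mem.arr_setArr_apply, hb1]
          split
          · rename_i h
            intro _
            exact ⟨k, rfl, by rw [h.1]; exact hxk, by rw [h.2]; exact hyk⟩
          · exact hG.best x' y'
        · intro k' x' y' hS hne
          rw [Mem.arr_setArr_apply, hb1]
          by_cases e : x' = x ∧ y' = y
          · rw [if_pos e]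
            refine ⟨by omega, fun j' hj' => ?_⟩
            obtain rfl : k = j' := Fin.ext (by omega)
            rcases hS with hS | ⟨rfl, -, -⟩
            · obtain ⟨rfl, rfl⟩ := e
              exact hlt.le.trans ((hG.le k' x' y' hS hne).2 j₀ hj₀)
            · exact le_rfl
          · rw [if_neg e]
            rcases hS with hS | ⟨-, h1, h2⟩
            · exact hG.le k' x' y' hS hne
            · exact absurd ⟨h1, h2⟩ e
      · intro hlt
        refine ⟨by omega, L, ⟨hG1.lists, by rw [hb1]; exact hG.mem, by rw [hb1]; exact hG.best, ?_⟩,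
          by omega⟩
        intro k' x' y' hS hne
        rw [hb1]
        rcases hS with hS | ⟨rfl, rfl, rfl⟩
        · exact hG.le k' x' y' hS hne
        · refine ⟨hb, fun j' hj' => ?_⟩
          obtain rfl : j₀ = j' := Fin.ext (by omega)
          exact not_lt.1 hlt

/-- State of the computation of the underlying graph; `u` bounds the number of steps. -/
def Building (H : WHypergraph n m) (src : Fin n) (S : Fin m → ℕ → ℕ → Prop) (u t : ℕ) (s : Mem) :
    Prop :=
  HasInput H src s ∧ t ≤ u ∧
    ∃ L, Graph H s L S ∧ ∑ x ∈ Finset.Icc 1 n, (L x).length ≤ t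

theorem Building.mono {H : WHypergraph n m} {src : Fin n} {S S' : Fin m → ℕ → ℕ → Prop}
    {u t u' t' : ℕ} {s : Mem} (h : Building H src S u t s) (ht : t ≤ t') (hu : t' + u ≤ t + u')
    (hS : ∀ j x y, S' j x y → x ≠ y → S j x y) : Building H src S' u' t' s := by
  obtain ⟨h1, h2, L, h3, h4⟩ := h
  exact ⟨h1, by omega, L, h3.mono (.refl _) rfl rfl hS, by omega⟩

theorem Building.setReg {H : WHypergraph n m} {src : Fin n} {S : Fin m → ℕ → ℕ → Prop}
    {u t : ℕ} {s : Mem} (h : Building H src S u t s) {x : Reg}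
    (hx : x ∉ [Reg.n, .m, .src, .cell]) (a : ℕ) : Building H src S u t (s.setReg x a) := by
  obtain ⟨h1, h2, L, h3, h4⟩ := h
  simp only [List.mem_cons, not_or] at hx
  exact ⟨h1.setReg (by simp; tauto) a, h2, L,
    h3.mono (s.extends_setReg hx.2.2.2.1 a) rfl rfl fun _ _ _ h _ => h, h4⟩

/-- A hyperedge with `c ≥ 1` vertices takes at most `5 + c * (5 + 11 * c) ≤ 21 * c ^ 2` steps. -/
theorem underlyingGraph_spec {H : WHypergraph n m} {src : Fin n} {s : Mem}
    (hin : HasInput H src s) (hadj : ∀ x, s.a1 .adj x = 0) (hbest : ∀ x y, s.arr .best x y = 0) :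
    wp underlyingGraph 0 s fun t' s' =>
      Building H src (fun j x y => x ∈ H.verts j ∧ y ∈ H.verts j) (2 + 21 * H.Phi) t' s' := by
  have htake : ∀ k : Fin m, (H.verts k).take (H.edge k).card = H.verts k := by
    intro k
    rw [← H.length_verts, List.take_length]
  have hB0 : Building H src (fun _ _ _ => False) 0 0 s := by
    refine ⟨hin, le_rfl, fun _ => [], ⟨?_, by simp [hbest], by simp [hbest], by simp⟩, by simp⟩
    intro x
    simp [hadj]
  set cost : ℕ → ℕ := fun e => 5 + s.a1 .card e * (5 + 11 * s.a1 .card e) with hcost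
  unfold underlyingGraph
  rw [block]
  refine wp_forRange (N := m + 1) (fun k t' s' => 1 ≤ k ∧
    Building H src (fun j x y => (j : ℕ) + 1 < k ∧ x ∈ H.verts j ∧ y ∈ H.verts j)
      (1 + ∑ e ∈ Finset.Ico 1 k, cost e) t' s') (by decide) (by simp) ?_ ?_ ?_ ?_
  · exact ⟨by simp, (hB0.setReg (by decide) _).mono (by omega) (by simp) (by simp)⟩
  · rintro k t' s' ⟨-, h, -⟩
    simp [h.reg_m]
  · rintro k t1 s1 ⟨hk1, h1⟩ hke hkm
    obtain ⟨k, rfl⟩ : ∃ j : Fin m, k = j + 1 := ⟨⟨k - 1, by omega⟩, by simp; omega⟩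
    set u1 := 1 + ∑ e ∈ Finset.Ico 1 ((k : ℕ) + 1), cost e with hu1
    refine wp_forRange (N := (H.edge k).card) (fun i t' s' => s'.reg .e = k + 1 ∧
      Building H src (fun j x y => ((j : ℕ) + 1 < k + 1 ∧ x ∈ H.verts j ∧ y ∈ H.verts j) ∨
        j = k ∧ x ∈ (H.verts k).take i ∧ y ∈ H.verts k)
      (u1 + 2 + i * (5 + 11 * (H.edge k).card)) t' s') (by decide) (by simp) ?_ ?_ ?_ ?_
    · refine ⟨by simp [hke], (h1.setReg (by decide) _).mono (by omega) (by simp; omega) ?_⟩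
      rintro j x y (h | ⟨-, h, -⟩) -
      · exact h
      · simp at h
    · rintro i t' s' ⟨he, h, -⟩
      simp [he, h.card]
    · rintro i t2 s2 ⟨he2, h2⟩ hi2 hi
      have hil : i < (H.verts k).length := by simpa using hi
      refine wp_forRange (N := (H.edge k).card) (fun j t' s' => s'.reg .e = k + 1 ∧
        s'.reg .i = i ∧
        Building H src (fun j' x y => (((j' : ℕ) + 1 < k + 1 ∧ x ∈ H.verts j' ∧ y ∈ H.verts j') ∨
          j' = k ∧ x ∈ (H.verts k).take i ∧ y ∈ H.verts k) ∨
          j' = k ∧ x = (H.verts k)[i] ∧ y ∈ (H.verts k).take j)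
        (u1 + 4 + i * (5 + 11 * (H.edge k).card) + 11 * j) t' s') (by decide) (by simp) ?_ ?_ ?_ ?_
      · refine ⟨by simp [he2], by simp [hi2], (h2.setReg (by decide) _).mono (by omega)
          (by simp; omega) ?_⟩
        rintro j x y (h | ⟨-, -, h⟩) -
        · exact h
        · simp at h
      · rintro j t' s' ⟨he, -, h, -⟩
        simp [he, h.card]
      · rintro j t3 s3 ⟨he3, hi3, hin3, ht3, L3, hG3, hs3⟩ hj3 hj
        have hjl : j < (H.verts k).length := by simpa using hj
        refine (graph_step_spec hin3 hG3 he3 hi3 hj3 hil hjl).exec ?_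
        rintro t4 s4 hE ⟨ht4, L4, hG4, hs4⟩
        refine ⟨?_, ?_, (Building.setReg (S := _) (u := u1 + 4 + i * (5 + 11 * (H.edge k).card) +
          11 * j + 10) (t := t3 + 1 + t4) ⟨hin3.exec hE (by decide), ?_, L4, hG4, ?_⟩
          (by decide) _).mono ?_ ?_ ?_⟩
        · simp [hE.reg_eq (show Cmd.modReg .e _ = false by decide), he3]
        · simp [hE.reg_eq (show Cmd.modReg .i _ = false by decide), hi3]
        · omega
        · omega
        · omega
        · omega
        · rintro j' x y h hne
          rw [List.take_succ_eq_append_getElem hjl] at h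
          simp only [List.mem_append, List.mem_singleton] at h
          rcases h with h | ⟨h1, h2, h3 | h3⟩
          · exact Or.inl (Or.inl h)
          · exact Or.inl (Or.inr ⟨h1, h2, h3⟩)
          · exact Or.inr ⟨h1, h2, h3⟩
      · rintro t' s' ⟨he, hi', h⟩
        rw [htake] at h
        refine ⟨by simp [he], (h.setReg (by decide) _).mono (by omega) ?_ ?_⟩
        · rw [add_mul, one_mul]
          omega
        · rintro j' x y h hne
          rw [List.take_succ_eq_append_getElem hil] at h
          simp only [List.mem_append, List.mem_singleton] at h
          rcases h with h | ⟨h1, h2 | h2, h3⟩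
          · exact Or.inl (Or.inl h)
          · exact Or.inl (Or.inr ⟨h1, h2, h3⟩)
          · exact Or.inr ⟨h1, h2, h3⟩
    · rintro t' s' ⟨he, h⟩
      rw [htake] at h
      refine ⟨by omega, (h.setReg (by decide) _).mono (by omega) ?_ ?_⟩
      · rw [Finset.sum_Ico_succ_top (by omega)]
        simp only [hcost, hin.card] at hu1 ⊢
        omega
      · rintro j' x y ⟨h1, h2, h3⟩ -
        by_cases e : j' = k
        · subst e
          exact Or.inr ⟨rfl, h2, h3⟩
        · refine Or.inl ⟨?_, h2, h3⟩
          have : (j' : ℕ) ≠ k := fun h => e (Fin.ext h)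
          omega
  · rintro t' s' ⟨-, h⟩
    refine h.mono (by omega) ?_ ?_
    · have : ∑ e ∈ Finset.Ico 1 (m + 1), cost e ≤ 21 * H.Phi := by
        rw [Finset.sum_Ico_eq_sum_range, Nat.add_sub_cancel, Finset.sum_range, WHypergraph.Phi,
          Finset.mul_sum]
        refine Finset.sum_le_sum fun j _ => ?_
        rw [add_comm 1]
        simp only [hcost, hin.card]
        have := (H.edge_nonempty j).card_pos
        nlinarith
      omega
    · rintro j x y ⟨h1, h2⟩ -
      exact ⟨by omega, h1, h2⟩

/-- The adjacency lists have at most as many entries as steps were taken to build them, so scanning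
them costs `430` times the bound `2 + 21 * Φ`. -/
theorem drsp_spec (H : WHypergraph n m) (src : Fin n) :
    ∃ t s', Exec drsp (input H src) t s' ∧
      t ≤ 280 * (n * Nat.log 2 n) + 2000 * n + 10000 * H.Phi ∧
      ∀ v : Fin n, v ≠ src → s'.wt .D (v + 1) = H.dist src v := by
  have hin := hasInput_input H src
  suffices h : wp drsp 0 (input H src) fun t s' =>
      t ≤ 280 * (n * Nat.log 2 n) + 2000 * n + 10000 * H.Phi ∧
      ∀ v : Fin n, v ≠ src → s'.wt .D (v + 1) = H.dist src v by
    obtain ⟨t, s', hE, h1, h2⟩ := h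
    exact ⟨t, s', hE, by omega, h2⟩
  unfold drsp
  rw [block, wp_seq]
  refine (underlyingGraph_spec hin (fun _ => rfl) fun _ _ => rfl).exec ?_
  rintro t1 s1 hE1 ⟨hin1, ht1, L, hG, hs⟩
  have hfresh1 : Fresh s1 := by
    refine ⟨fun a ha x => ?_, (hE1.reg_eq (by decide)).trans rfl⟩
    simp only [List.mem_cons, List.not_mem_nil, or_false] at ha
    rcases ha with rfl | rfl | rfl | rfl | rfl | rfl | rfl <;>
      exact congrFun (hE1.a1_eq (by decide)) x
  refine (dijkstra_spec hin1 hfresh1 hG).mono ?_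
  rintro t2 s2 ⟨ht2, hD⟩
  have h3 : 1 ≤ n := by have := src.isLt; omega
  exact ⟨by omega, hD⟩

end RAM

/-! ### Faces of a simplicial complex -/

namespace WHypergraph

variable {n m : ℕ} {H : WHypergraph n m}

theorem pairwise_verts (j : Fin m) : (H.verts j).Pairwise (· < ·) := by
  refine (H.edge j).sortedLT_sort.pairwise.map _ ?_
  intro a b h
  exact Nat.succ_lt_succ h

theorem verts_ne_nil (j : Fin m) : H.verts j ≠ [] := by
  rw [← List.length_pos_iff, length_verts]
  exact (H.edge_nonempty j).card_pos

theorem verts_injective (hH : H.IsSimplicialComplex) : Function.Injective H.verts := by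
  intro i j h
  refine hH.1 (Finset.ext fun v => ?_)
  rw [← H.succ_mem_verts, h, H.succ_mem_verts]

/-- Every nonempty part of a face is a face. -/
theorem exists_verts_eq (hH : H.IsSimplicialComplex) {e : Fin m} {l : List ℕ} (hl : l ≠ [])
    (h : l.Sublist (H.verts e)) : ∃ g : Fin m, H.verts g = l := by
  obtain ⟨x, hx⟩ := List.exists_mem_of_ne_nil l hl
  obtain ⟨v, hv, rfl⟩ := H.mem_verts.1 (h.subset hx)
  set T := (H.edge e).filter fun v : Fin n => (v : ℕ) + 1 ∈ l
  obtain ⟨g, hg⟩ := (hH.2 ⟨e, rfl⟩).2 (show T ≤ H.edge e from Finset.filter_subset _ _)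
    ⟨v, Finset.mem_filter.2 ⟨hv, hx⟩⟩
  refine ⟨g, (pairwise_verts g).eq_of_mem_iff ((pairwise_verts e).sublist h) fun y => ?_⟩
  rw [H.mem_verts, hg]
  constructor
  · rintro ⟨u, hu, rfl⟩
    exact (Finset.mem_filter.1 hu).2
  · intro hy
    obtain ⟨u, hu, rfl⟩ := H.mem_verts.1 (h.subset hy)
    exact ⟨u, Finset.mem_filter.2 ⟨hu, hy⟩, rfl⟩

/-- Adding to `f` one vertex of `j` outside `f` gives a face between them. This is what makes the
recursion over codimension one see every hyperedge above `f`. -/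
theorem exists_eraseIdx (hH : H.IsSimplicialComplex) {f j : Fin m} (h : H.edge f ⊂ H.edge j) :
    ∃ e : Fin m, (H.edge e).card = (H.edge f).card + 1 ∧ H.edge e ⊆ H.edge j ∧
      ∃ i < (H.edge e).card, H.verts f = (H.verts e).eraseIdx i := by
  obtain ⟨v, hvj, hvf⟩ := Finset.exists_of_ssubset h
  have hsub : insert v (H.edge f) ⊆ H.edge j := Finset.insert_subset hvj h.1
  obtain ⟨e, he⟩ := (hH.2 ⟨j, rfl⟩).2 (show insert v (H.edge f) ≤ H.edge j from hsub)
    (Finset.insert_nonempty _ _)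
  refine ⟨e, by rw [he, Finset.card_insert_of_notMem hvf], he ▸ hsub, ?_⟩
  have hve : (v : ℕ) + 1 ∈ H.verts e := H.succ_mem_verts.2 (by rw [he]; exact Finset.mem_insert_self _ _)
  obtain ⟨i, hi, hie⟩ := List.getElem_of_mem hve
  refine ⟨i, by simpa using hi, ?_⟩
  refine (pairwise_verts f).eq_of_mem_iff ((pairwise_verts e).sublist (List.eraseIdx_sublist _ _))
    fun y => ?_
  rw [← (H.nodup_verts e).erase_getElem i hi, hie, (H.nodup_verts e).mem_erase_iff,
    H.mem_verts, H.mem_verts, he]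
  constructor
  · rintro ⟨u, hu, rfl⟩
    refine ⟨?_, u, Finset.mem_insert_of_mem hu, rfl⟩
    intro h
    exact hvf (Fin.ext (Nat.succ_injective h) ▸ hu)
  · rintro ⟨hy, u, hu, rfl⟩
    refine ⟨u, (Finset.mem_insert.1 hu).resolve_left ?_, rfl⟩
    rintro rfl
    exact hy rfl

end WHypergraph

/-! ### The trie of faces and their faces of codimension one -/

namespace RAM

variable {n m : ℕ}

/-- `x` is the number of the face with the list of vertices `l`; the number `0` stands for the empty
set. -/
def IsNum (H : WHypergraph n m) (l : List ℕ) (x : ℕ) : Prop :=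
  (l = [] ∧ x = 0) ∨ ∃ g : Fin m, x = g + 1 ∧ H.verts g = l

theorem IsNum.inj {H : WHypergraph n m} {l l' : List ℕ} {x : ℕ} (h : IsNum H l x)
    (h' : IsNum H l' x) : l = l' := by
  rcases h with ⟨rfl, rfl⟩ | ⟨g, rfl, rfl⟩ <;> rcases h' with ⟨rfl, h⟩ | ⟨g', h, rfl⟩
  · rfl
  · omega
  · omega
  · rw [show g = g' from Fin.ext (by omega)]

theorem IsNum.ne_nil {H : WHypergraph n m} {l : List ℕ} {x : ℕ} (h : IsNum H l x) (hl : l ≠ []) :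
    ∃ g : Fin m, x = g + 1 ∧ H.verts g = l :=
  h.resolve_left fun h => hl h.1

/-- The entries of `child` and `sub` are correct for the faces `f` with `P f`. -/
structure Trie (H : WHypergraph n m) (P : Fin m → Prop) (s : Mem) : Prop where
  child : ∀ f x l v, P f → H.verts f = l ++ [v] → IsNum H l x → s.arr .child x v = f + 1
  sub : ∀ f i, P f → i < (H.edge f).card →
    IsNum H ((H.verts f).eraseIdx i) (s.arr .sub (f + 1) i)

theorem Trie.mono {H : WHypergraph n m} {P P' : Fin m → Prop} {s s' : Mem} (h : Trie H P s)
    (hc : s'.arr .child = s.arr .child) (hs : s'.arr .sub = s.arr .sub) (hP : ∀ f, P' f → P f) :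
    Trie H P' s' :=
  ⟨by rw [hc]; exact fun f x l v hf => h.child f x l v (hP f hf),
    by rw [hs]; exact fun f i hf => h.sub f i (hP f hf)⟩

/-- Walking down the trie along the vertices of `e` except the last reaches the number of `e`
without its last vertex, called `node`. For an earlier position `i`, deleting that vertex from `e`
amounts to deleting it from `node` and appending the last vertex again, which is one lookup in `sub`
and one in `child`. All faces consulted have fewer vertices than `e`. -/
theorem face_step_spec {H : WHypergraph n m} (hH : H.IsSimplicialComplex) {src : Fin n} {s : Mem}
    {P : Fin m → Prop} {t : ℕ} {e : Fin m} (hin : HasInput H src s)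
    (hk : s.reg .k = (H.edge e).card) (hq : s.a1 .elt (s.reg .q) = e + 1) (hT : Trie H P s)
    (hP : ∀ f, (H.edge f).card < (H.edge e).card → P f) :
    wp (block [
        .assign .e (eltAt .q),
        .assign .node 0,
        forRange .i 0 (Reg.k - 1)
          (.assign .node (.get .child Reg.node (.get .vert Reg.e Reg.i))),
        .assign .last (.get .vert Reg.e (Reg.k - 1)),
        .write .child Reg.node Reg.last Reg.e,
        .write .sub Reg.e (Reg.k - 1) Reg.node,
        forRange .i 0 (Reg.k - 1)
          (.write .sub Reg.e Reg.i (.get .child (.get .sub Reg.node Reg.i) Reg.last))]) t s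
      fun t' s' => t' ≤ t + 3 + 6 * (H.edge e).card ∧ Trie H (fun f => P f ∨ f = e) s' := by
  obtain ⟨K, hK⟩ : ∃ K, (H.edge e).card = K + 1 :=
    ⟨_, (Nat.succ_pred_eq_of_pos (H.edge_nonempty e).card_pos).symm⟩
  have hlen : (H.verts e).length = K + 1 := by simp [hK]
  have hcard : ∀ f l, H.verts f = l → (H.edge f).card = l.length := by
    rintro f _ rfl
    simp
  rw [hK] at hk
  rw [block, wp_seq, wp_assign, block, wp_seq, wp_assign, block, wp_seq]
  simp only [eval_eltAt, hq, Expr.eval_zero]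
  refine wp_forRange (N := K) (fun i t' s' => t' = t + 3 + 3 * i ∧ s'.arr = s.arr ∧ s'.wt = s.wt ∧
    (∀ x, x ≠ .e → x ≠ .node → x ≠ .i → s'.reg x = s.reg x) ∧ s'.reg .e = e + 1 ∧
    IsNum H ((H.verts e).take i) (s'.reg .node)) (by decide) (by simp) ?_ ?_ ?_ ?_
  · refine ⟨by simp, rfl, rfl, fun x h1 h2 h3 => by simp [h1, h2, h3], by simp, by simp [IsNum]⟩
  · rintro i t' s' ⟨-, -, -, hr, -⟩
    simp [hr .k (by decide) (by decide) (by decide), hk]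
  · rintro i t1 s1 ⟨ht1, ha1, hw1, hr1, he1, hn1⟩ hi1 hi
    have hil : i < (H.verts e).length := by omega
    rw [wp_assign]
    refine ⟨by omega, by simp [ha1], by simp [hw1],
      fun x h1 h2 h3 => by simp [h2, h3, hr1 x h1 h2 h3], by simp [he1], ?_⟩
    have htake := List.take_succ_eq_append_getElem hil
    obtain ⟨g, hg⟩ := WHypergraph.exists_verts_eq hH (e := e) (l := (H.verts e).take (i + 1))
      (by simp [WHypergraph.verts_ne_nil]) (List.take_sublist _ _)
    have hPg : P g := hP g (by rw [hcard g _ hg, hK, List.length_take]; omega)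
    simp only [Expr.eval_get, Expr.eval_reg, he1, hi1, ha1, hin.vert,
      List.getD_eq_getElem _ _ hil, Mem.reg_setReg, reduceCtorEq, if_false, if_true]
    rw [hT.child g _ _ _ hPg (hg.trans htake) hn1]
    exact Or.inr ⟨g, rfl, hg⟩
  · rintro t1 s1 ⟨ht1, ha1, hw1, hr1, he1, hn1⟩
    have hKl : K < (H.verts e).length := by omega
    have hk1 : s1.reg .k = K + 1 := by rw [hr1 .k (by decide) (by decide) (by decide), hk]
    rw [block, wp_seq, wp_assign, block, wp_seq, wp_write, block, wp_seq, wp_write, block]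
    simp only [Expr.eval_get, Expr.eval_reg, he1, ha1, hin.vert, Expr.eval_sub, Expr.eval_one, hk1,
      Nat.add_sub_cancel, List.getD_eq_getElem _ _ hKl, Mem.reg_setReg, reduceCtorEq, if_false,
      if_true, Mem.reg_setArr]
    have hverts : H.verts e = (H.verts e).take K ++ [(H.verts e)[K]] := by
      rw [← List.take_succ_eq_append_getElem hKl, ← hlen, List.take_length]
    have herase : ∀ i < K, (H.verts e).eraseIdx i =
        ((H.verts e).take K).eraseIdx i ++ [(H.verts e)[K]] := by
      intro i hi
      conv_lhs => rw [hverts]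
      rw [List.eraseIdx_append_of_lt_length (by rw [List.length_take]; omega)]
    have heraseK : (H.verts e).eraseIdx K = (H.verts e).take K := by
      conv_lhs => rw [hverts]
      rw [List.eraseIdx_append_of_length_le (by rw [List.length_take]; omega)]
      simp [hlen]
    generalize (H.verts e)[K] = v at *
    set s2 := ((s1.setReg .last v).setArr .child (s1.reg .node) v (e + 1)).setArr .sub (e + 1) K
      (s1.reg .node) with hs2
    -- The new entry cannot spoil an old one: a number determines the list of vertices of its
    -- prefix, and together with the last vertex this determines the face.
    have hT2 : (∀ f x l v, P f ∨ f = e → H.verts f = l ++ [v] → IsNum H l x →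
        s2.arr .child x v = f + 1) := by
      intro f x l u hf hfl hx
      simp only [hs2, Mem.arr_setArr_ne _ (show Arr.child ≠ .sub by decide), Mem.arr_setArr_apply,
        Mem.arr_setReg, ha1]
      split
      · rename_i h
        obtain ⟨rfl, rfl⟩ := h
        have := hx.inj hn1
        rw [WHypergraph.verts_injective hH (hfl.trans (this ▸ hverts.symm))]
      · rename_i h
        rcases hf with hf | rfl
        · exact hT.child f x l u hf hfl hx
        · exfalso
          rw [hverts] at hfl
          obtain ⟨h1, h2⟩ := List.append_inj' hfl rfl
          simp only [List.cons.injEq, and_true] at h2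
          subst h1 h2
          rcases hx with ⟨h3, rfl⟩ | ⟨g, rfl, h3⟩ <;> rcases hn1 with ⟨h4, h5⟩ | ⟨g', h5, h4⟩
          · exact h ⟨h5.symm, rfl⟩
          · exact WHypergraph.verts_ne_nil _ (h4.trans h3)
          · exact WHypergraph.verts_ne_nil _ (h3.trans h4)
          · rw [WHypergraph.verts_injective hH (h3.trans h4.symm)] at h
            exact h ⟨h5.symm, rfl⟩
    refine wp_forRange (N := K) (fun i t' s' => t' = t + 8 + 3 * K + 3 * i ∧
      (∀ x, x ≠ .i → s'.reg x = s2.reg x) ∧ s'.arr .child = s2.arr .child ∧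
      ∀ f i', P f ∨ f = e ∧ (i' < i ∨ i' = K) → i' < (H.edge f).card →
        IsNum H ((H.verts f).eraseIdx i') (s'.arr .sub (f + 1) i')) (by decide) (by simp) ?_ ?_ ?_ ?_
    · refine ⟨by simp; omega, fun x hx => by simp [hx], rfl, ?_⟩
      intro f i' hf hi'
      simp only [Mem.arr_setReg, hs2, Mem.arr_setArr_apply]
      split
      · rename_i h
        obtain rfl : f = e := Fin.ext (by omega)
        rwa [h.2, heraseK]
      · rename_i h
        rcases hf with hf | ⟨rfl, hf | rfl⟩
        · simpa [ha1] using hT.sub f i' hf hi'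
        · simp at hf
        · exact absurd ⟨rfl, rfl⟩ h
    · rintro i t' s' ⟨-, hr, -⟩
      simp [hr .k (by decide), hs2, hk1]
    · rintro i t3 s3 ⟨ht3, hr3, hc3, hs3⟩ hi3 hi
      have hne : (H.verts e).take K ≠ [] := by
        rw [← List.length_pos_iff, List.length_take]
        omega
      obtain ⟨g, hg, hgl⟩ := hn1.ne_nil hne
      have hgc : (H.edge g).card = K := by
        rw [hcard g _ hgl, List.length_take]
        omega
      obtain ⟨h, hh⟩ := WHypergraph.exists_verts_eq hH (e := e) (l := (H.verts e).eraseIdx i)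
        (by rw [herase i hi]; simp) (List.eraseIdx_sublist _ _)
      have hhc : (H.edge h).card < (H.edge e).card := by
        rw [hcard h _ hh, List.length_eraseIdx, hK, hlen, if_pos (by omega)]
        omega
      have hsub := hs3 g i (Or.inl (hP g (by omega))) (by omega)
      rw [hgl] at hsub
      have hchild := hT2 h _ _ _ (Or.inl (hP h hhc)) (hh.trans (herase i hi)) hsub
      rw [wp_write]
      simp only [Expr.eval_get, Expr.eval_reg, hr3 .e (by decide), hr3 .node (by decide),
        hr3 .last (by decide), hi3, hc3]
      have he2 : s2.reg .e = e + 1 := by simp [hs2, he1]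
      have hn2 : s2.reg .node = g + 1 := by simp [hs2, hg]
      have hl2 : s2.reg .last = v := by simp [hs2]
      rw [he2, hn2, hl2, hchild]
      refine ⟨by omega, fun x hx => by simp [hx, hr3 x hx], by simp [hc3], ?_⟩
      intro f i' hf hi'
      simp only [Mem.arr_setReg, Mem.arr_setArr_apply]
      split
      · rename_i hfi
        obtain rfl : f = e := Fin.ext (by omega)
        rw [hfi.2]
        exact Or.inr ⟨h, rfl, hh⟩
      · rename_i hfi
        refine hs3 f i' ?_ hi'
        rcases hf with hf | ⟨rfl, hf⟩
        · exact Or.inl hf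
        · refine Or.inr ⟨rfl, ?_⟩
          have : i' ≠ i := fun h => hfi ⟨rfl, h⟩
          omega
    · rintro t3 s3 ⟨ht3, hr3, hc3, hs3⟩
      refine ⟨by omega, ?_, ?_⟩
      · rw [hc3]
        exact hT2
      · rintro f i (hf | rfl) hi
        · exact hs3 f i (Or.inl hf) hi
        · exact hs3 f i (Or.inr ⟨rfl, by omega⟩) hi

/-- `B k` lists the hyperedges with `k` vertices. -/
def IsBuckets (H : WHypergraph n m) (B : ℕ → List ℕ) : Prop :=
  ∀ k e, e ∈ B k ↔ ∃ j : Fin m, e = j + 1 ∧ (H.edge j).card = k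

theorem card_edge_mem_Icc (H : WHypergraph n m) (j : Fin m) : (H.edge j).card ∈ Finset.Icc 1 n :=
  Finset.mem_Icc.2 ⟨(H.edge_nonempty j).card_pos, by simpa using (H.edge j).card_le_univ⟩

/-- The weight `g` is arbitrary so that the cost of treating the faces bucket by bucket can be
summed over all faces at once. -/
theorem buckets_spec {H : WHypergraph n m} {src : Fin n} {s : Mem} {t : ℕ} (g : ℕ → ℕ)
    (hin : HasInput H src s) (hb : ∀ x, s.a1 .bucket x = 0) (hz : s.reg .size = 0) :
    wp (forRange .e 1 (Reg.m + 1) (block [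
      write1 .cheap Reg.e Reg.e,
      push .bucket (get1 .card Reg.e) Reg.e,
      when (.lt Reg.size (get1 .card Reg.e)) (.assign .size (get1 .card Reg.e))])) t s fun t' s' =>
      t' ≤ t + 2 + 9 * m ∧ HasInput H src s' ∧
      ∃ B, Lists .bucket B s' ∧ IsBuckets H B ∧
        ∑ x ∈ Finset.Icc 1 n, ((B x).map g).sum = ∑ j : Fin m, g (j + 1) ∧
        (∀ j : Fin m, s'.a1 .cheap (j + 1) = j + 1) ∧
        (∀ j : Fin m, (H.edge j).card ≤ s'.reg .size) ∧ s'.reg .size ≤ n := by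
  have hsum : ∀ f : ℕ → ℕ, ∑ i ∈ Finset.Ico 1 (m + 1), f i = ∑ j : Fin m, f (j + 1) := by
    intro f
    rw [Finset.sum_Ico_eq_sum_range, Nat.add_sub_cancel, Finset.sum_range]
    exact Finset.sum_congr rfl fun j _ => by rw [add_comm]
  refine wp_forRange (N := m + 1) (fun k t' s' => 1 ≤ k ∧ t' + 8 ≤ t + 9 * k ∧ HasInput H src s' ∧
    ∃ B, Lists .bucket B s' ∧
      (∀ c e, e ∈ B c ↔ ∃ j : Fin m, e = j + 1 ∧ e < k ∧ (H.edge j).card = c) ∧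
      ∑ x ∈ Finset.Icc 1 n, ((B x).map g).sum = ∑ i ∈ Finset.Ico 1 k, g i ∧
      (∀ j : Fin m, (j : ℕ) + 1 < k → s'.a1 .cheap (j + 1) = j + 1) ∧
      (∀ j : Fin m, (j : ℕ) + 1 < k → (H.edge j).card ≤ s'.reg .size) ∧ s'.reg .size ≤ n)
    (by decide) (by simp) ?_ ?_ ?_ ?_
  · refine ⟨by simp, by simp, hin.setReg (by decide) _, fun _ => [], ?_, ?_, by simp, ?_, ?_,
      by simp [hz]⟩
    · intro x
      simp [hb]
    · intro c e
      simp only [List.not_mem_nil, Expr.eval_one, false_iff]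
      rintro ⟨j, rfl, h, -⟩
      omega
    · intro j hj
      simp at hj
    · intro j hj
      simp at hj
  · rintro k t' s' ⟨-, -, h, -⟩
    simp [h.reg_m]
  · rintro k t1 s1 ⟨hk1, ht1, hin1, B, hB, hmem, hs, hc, hle, hsize⟩ hke hkm
    obtain ⟨j, rfl⟩ : ∃ j : Fin m, k = j + 1 := ⟨⟨k - 1, by omega⟩, by simp; omega⟩
    have hcI := card_edge_mem_Icc H j
    rw [block, wp_seq, wp_write1, block, wp_seq, wp_push (by decide) (by decide) (by decide), block]
    simp only [Expr.eval_reg, hke, eval_get1, Mem.reg_setArr]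
    rw [Mem.a1_setArr_ne _ (by decide), hin1.card]
    set c := (H.edge j).card with hcdef
    set s2 := (s1.setArr .cheap (j + 1) 0 (j + 1)).pushed .bucket c (j + 1) with hs2
    have hr2 : ∀ x, x ≠ .cell → s2.reg x = s1.reg x := fun x hx => by simp [hs2, hx]
    have ha2 : ∀ a, a ≠ .cheap → a ≠ .bucket → a ≠ .elt → a ≠ .nxt → s2.arr a = s1.arr a :=
      fun a h1 h2 h3 h4 => by simp [hs2, h1, h2, h3, h4]
    have hin2 : HasInput H src s2 := hin1.congr
      (fun x hx => hr2 x (by rintro rfl; simp at hx))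
      (fun a ha => ha2 a (by rintro rfl; simp at ha) (by rintro rfl; simp at ha)
        (by rintro rfl; simp at ha) (by rintro rfl; simp at ha)) rfl
    have hB2 : Lists .bucket (Function.update B c (((j : ℕ) + 1) :: B c)) s2 :=
      (hB.congr (Mem.extends_setArr _ (by decide) (by decide) _ _ _) (by simp)).pushed c (j + 1)
        (by decide) (by decide)
    have hmem2 : ∀ c' e, e ∈ Function.update B c (((j : ℕ) + 1) :: B c) c' ↔
        ∃ j' : Fin m, e = j' + 1 ∧ e < j + 1 + 1 ∧ (H.edge j').card = c' := by
      intro c' e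
      have hj : (∃ j' : Fin m, e = j' + 1 ∧ e < j + 1 + 1 ∧ (H.edge j').card = c') ↔
          (e = j + 1 ∧ c' = c) ∨ ∃ j' : Fin m, e = j' + 1 ∧ e < j + 1 ∧ (H.edge j').card = c' := by
        constructor
        · rintro ⟨j', rfl, h2, h3⟩
          by_cases e : (j' : ℕ) = j
          · obtain rfl := Fin.ext e
            exact Or.inl ⟨rfl, h3.symm⟩
          · exact Or.inr ⟨j', rfl, by omega, h3⟩
        · rintro (⟨rfl, rfl⟩ | ⟨j', h1, h2, h3⟩)
          · exact ⟨j, rfl, by omega, rfl⟩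
          · exact ⟨j', h1, by omega, h3⟩
      rw [hj]
      by_cases ec : c' = c
      · subst ec
        rw [Function.update_self, List.mem_cons, hmem]
        simp
      · rw [Function.update_of_ne ec, hmem]
        simp [ec]
    have hsum2 : ∑ x ∈ Finset.Icc 1 n, ((Function.update B c (((j : ℕ) + 1) :: B c) x).map g).sum =
        ∑ i ∈ Finset.Ico 1 ((j : ℕ) + 1 + 1), g i := by
      have := sum_comp_update hcI (fun l : List ℕ => (l.map g).sum) B (((j : ℕ) + 1) :: B c)
      simp only [List.map_cons, List.sum_cons] at this
      rw [Finset.sum_Ico_succ_top (by omega)]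
      omega
    have hc2 : ∀ j' : Fin m, (j' : ℕ) + 1 < j + 1 + 1 → s2.a1 .cheap (j' + 1) = j' + 1 := by
      intro j' hj'
      simp only [hs2, Mem.a1_pushed _ _ _ (show Arr.cheap ≠ .elt by decide)
        (show Arr.cheap ≠ .nxt by decide), reduceCtorEq, if_false, Mem.a1_setArr, if_true]
      by_cases e : (j' : ℕ) + 1 = j + 1
      · rw [e, Function.update_self]
      · rw [Function.update_of_ne e]
        exact hc j' (by omega)
    rw [Finset.mem_Icc] at hcI
    clear_value s2
    rw [wp_when]
    simp only [Test.holds_lt, Expr.eval_reg, eval_get1, hr2 .size (by decide), hr2 .e (by decide),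
      hke, hin2.card, ← hcdef, wp_assign]
    constructor
    · intro hlt
      refine ⟨by omega, by omega, (hin2.setReg (by decide) _).setReg (by decide) _, _,
        hB2.congr ((s2.extends_setReg (by decide) _).trans (Mem.extends_setReg _ (by decide) _)) rfl,
        hmem2, hsum2, hc2, ?_, by simp; omega⟩
      intro j' hj'
      simp only [Mem.reg_setReg, reduceCtorEq, if_false, if_true]
      by_cases e : (j' : ℕ) = j
      · obtain rfl := Fin.ext e
        exact le_rfl
      · exact (hle j' (by omega)).trans hlt.le
    · intro hlt
      refine ⟨by omega, by omega, hin2.setReg (by decide) _, _,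
        hB2.congr (Mem.extends_setReg _ (by decide) _) rfl,
        hmem2, hsum2, hc2, ?_, by simp [hr2, hsize]⟩
      intro j' hj'
      simp only [Mem.reg_setReg, reduceCtorEq, if_false, hr2 .size (by decide)]
      by_cases e : (j' : ℕ) = j
      · obtain rfl := Fin.ext e
        exact not_lt.1 hlt
      · exact hle j' (by omega)
  · rintro t' s' ⟨-, ht, h, B, hB, hmem, hs, hc, hle, hsize⟩
    refine ⟨by omega, h, B, hB, ?_, by rw [hs, hsum], fun j => hc j (by omega),
      fun j => hle j (by omega), hsize⟩
    intro k e
    rw [hmem]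
    constructor
    · rintro ⟨j, h1, -, h3⟩
      exact ⟨j, h1, h3⟩
    · rintro ⟨j, h1, h3⟩
      exact ⟨j, h1, by omega, h3⟩

theorem alloc_face_step : Alloc (block [
        .assign .e (eltAt .q),
        .assign .node 0,
        forRange .i 0 (Reg.k - 1)
          (.assign .node (.get .child Reg.node (.get .vert Reg.e Reg.i))),
        .assign .last (.get .vert Reg.e (Reg.k - 1)),
        .write .child Reg.node Reg.last Reg.e,
        .write .sub Reg.e (Reg.k - 1) Reg.node,
        forRange .i 0 (Reg.k - 1)
          (.write .sub Reg.e Reg.i (.get .child (.get .sub Reg.node Reg.i) Reg.last))]) :=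
  .seq (.assign _ _ (by decide)) (.seq (.assign _ _ (by decide))
      (.seq (alloc_forRange (by decide) (.assign _ _ (by decide))) (.seq (.assign _ _ (by decide))
      (.seq (.write _ _ _ _ (by decide) (by decide)) (.seq (.write _ _ _ _ (by decide) (by decide))
      (alloc_forRange (by decide) (.write _ _ _ _ (by decide) (by decide))))))))

theorem trie_level_spec {H : WHypergraph n m} (hH : H.IsSimplicialComplex) {src : Fin n} {s : Mem}
    {B : ℕ → List ℕ} {g : ℕ → ℕ} {K t : ℕ} (hin : HasInput H src s) (hL : Lists .bucket B s)
    (hB : IsBuckets H B) (hg : ∀ j : Fin m, 5 + 6 * (H.edge j).card ≤ g (j + 1))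
    (hk : s.reg .k = K) (hT : Trie H (fun f => (H.edge f).card < K) s) :
    wp (forCells .q (get1 .bucket Reg.k) (block [
        .assign .e (eltAt .q),
        .assign .node 0,
        forRange .i 0 (Reg.k - 1)
          (.assign .node (.get .child Reg.node (.get .vert Reg.e Reg.i))),
        .assign .last (.get .vert Reg.e (Reg.k - 1)),
        .write .child Reg.node Reg.last Reg.e,
        .write .sub Reg.e (Reg.k - 1) Reg.node,
        forRange .i 0 (Reg.k - 1)
          (.write .sub Reg.e Reg.i (.get .child (.get .sub Reg.node Reg.i) Reg.last))])) t s
      fun t' s' => t' ≤ t + 2 + ((B K).map g).sum ∧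
        Trie H (fun f => (H.edge f).card < K + 1) s' := by
  refine wp_forCells (l := B K) (fun l t' s' => ∃ d, B K = d ++ l ∧
    t' ≤ t + 1 + (d.map g).sum ∧ HasInput H src s' ∧ s'.reg .k = K ∧
    Trie H (fun f => (H.edge f).card < K ∨ (f : ℕ) + 1 ∈ d) s') (by decide) alloc_face_step
    (by decide) ?_ ?_ ?_ ?_
  · simpa [hk] using hL K
  · exact ⟨[], rfl, by simp, hin.setReg (by decide) _, by simp [hk],
      hT.mono rfl rfl fun f hf => by simpa using hf⟩
  · rintro e l t1 s1 ⟨d, hd, ht1, hin1, hk1, hT1⟩ he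
    obtain ⟨j, rfl, hj⟩ := (hB K e).1 (by simp [hd])
    refine (face_step_spec hH hin1 (by rw [hk1, hj]) he hT1
      fun f hf => Or.inl (by omega)).exec ?_
    rintro t' s' hE ⟨ht', hT'⟩ q
    refine ⟨d ++ [(j : ℕ) + 1], by simp [hd], ?_, (hin1.exec hE (by decide)).setReg (by decide) _,
      ?_, hT'.mono rfl rfl ?_⟩
    · have := hg j
      simp only [List.map_append, List.sum_append, List.map_cons, List.sum_cons, List.map_nil,
        List.sum_nil]
      omega
    · simp [hE.reg_eq (show Cmd.modReg .k _ = false by decide), hk1]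
    · intro f hf
      rw [List.mem_append, List.mem_singleton] at hf
      rcases hf with hf | hf | hf
      · exact Or.inl (Or.inl hf)
      · exact Or.inl (Or.inr hf)
      · exact Or.inr (Fin.ext (by omega))
  · rintro t' s' ⟨d, hd, ht', -, -, hT'⟩
    rw [List.append_nil] at hd
    subst hd
    refine ⟨by omega, hT'.mono rfl rfl fun f hf => ?_⟩
    rcases Nat.lt_succ_iff_lt_or_eq.1 hf with hf | hf
    · exact Or.inl hf
    · exact Or.inr ((hB K _).2 ⟨f, rfl, hf⟩)

theorem trie_spec {H : WHypergraph n m} (hH : H.IsSimplicialComplex) {src : Fin n} {s : Mem}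
    {B : ℕ → List ℕ} {g : ℕ → ℕ} {t : ℕ} (hin : HasInput H src s) (hL : Lists .bucket B s)
    (hB : IsBuckets H B) (hg : ∀ j : Fin m, 5 + 6 * (H.edge j).card ≤ g (j + 1))
    (hle : ∀ j : Fin m, (H.edge j).card ≤ s.reg .size) :
    wp (forRange .k 1 (Reg.size + 1) (forCells .q (get1 .bucket Reg.k) (block [
        .assign .e (eltAt .q),
        .assign .node 0,
        forRange .i 0 (Reg.k - 1)
          (.assign .node (.get .child Reg.node (.get .vert Reg.e Reg.i))),
        .assign .last (.get .vert Reg.e (Reg.k - 1)),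
        .write .child Reg.node Reg.last Reg.e,
        .write .sub Reg.e (Reg.k - 1) Reg.node,
        forRange .i 0 (Reg.k - 1)
          (.write .sub Reg.e Reg.i (.get .child (.get .sub Reg.node Reg.i) Reg.last))]))) t s
      fun t' s' => t' ≤ t + 2 + ∑ k ∈ Finset.Icc 1 (s.reg .size), (4 + ((B k).map g).sum) ∧
        Trie H (fun _ => True) s' := by
  refine wp_forRange (N := s.reg .size + 1) (fun k t' s' => 1 ≤ k ∧
    t' ≤ t + 1 + ∑ i ∈ Finset.Ico 1 k, (4 + ((B i).map g).sum) ∧ s'.reg .size = s.reg .size ∧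
    HasInput H src s' ∧ Lists .bucket B s' ∧ Trie H (fun f => (H.edge f).card < k) s')
    (by decide) (by simp) ?_ ?_ ?_ ?_
  · refine ⟨by simp, by simp, by simp, hin.setReg (by decide) _,
      hL.congr (s.extends_setReg (by decide) _) rfl, ?_, ?_⟩
    · intro f _ _ _ hf
      have := (H.edge_nonempty f).card_pos
      simp only [Expr.eval_one] at hf
      omega
    · intro f _ hf
      have := (H.edge_nonempty f).card_pos
      simp only [Expr.eval_one] at hf
      omega
  · rintro k t' s' ⟨-, -, h, -⟩
    simp [h]
  · rintro k t1 s1 ⟨hk, ht1, hz1, hin1, hL1, hT1⟩ hk1 hkN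
    refine (trie_level_spec hH hin1 hL1 hB hg hk1 hT1).exec ?_
    rintro t' s' hE ⟨ht', hT'⟩
    refine ⟨by omega, ?_, ?_, (hin1.exec hE (by decide)).setReg (by decide) _, ?_,
      hT'.mono rfl rfl fun _ h => h⟩
    · rw [Finset.sum_Ico_succ_top hk]
      omega
    · simp [hE.reg_eq (show Cmd.modReg .size _ = false by decide), hz1]
    · refine (hL1.exec hE ?_ (by decide)).congr (Mem.extends_setReg _ (by decide) _) rfl
      exact alloc_forCells (by decide) alloc_face_step
  · rintro t' s' ⟨-, ht', -, -, -, hT'⟩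
    rw [show Finset.Ico 1 (s.reg .size + 1) = Finset.Icc 1 (s.reg .size) from rfl] at ht'
    exact ⟨by omega, hT'.mono rfl rfl fun f _ => Nat.lt_succ_of_le (hle f)⟩

/-! ### Top-down computation of the edge weights -/

/-- `cheap f` is a hyperedge that contains `f`, and its weight is at most that of `j` if `R f j`. -/
structure Cheap (H : WHypergraph n m) (R : Fin m → Fin m → Prop) (s : Mem) : Prop where
  sound : ∀ f : Fin m, ∃ c : Fin m, s.a1 .cheap (f + 1) = c + 1 ∧ H.edge f ⊆ H.edge c
  le : ∀ f j c : Fin m, R f j → s.a1 .cheap (f + 1) = c + 1 → H.weight c ≤ H.weight j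

theorem Cheap.mono {H : WHypergraph n m} {R R' : Fin m → Fin m → Prop} {s s' : Mem}
    (h : Cheap H R s) (hc : s'.a1 .cheap = s.a1 .cheap) (hR : ∀ f j, R' f j → R f j) :
    Cheap H R' s' :=
  ⟨by rw [hc]; exact h.sound, by rw [hc]; exact fun f j c hf => h.le f j c (hR f j hf)⟩

/-- By `hR` the entry of `e` itself is already final, so that passing it on to `x` accounts for all
hyperedges above `e` at once. It stays final during the loop, since entries are only replaced by
cheaper ones. -/
theorem cheap_step_spec {H : WHypergraph n m} (hH : H.IsSimplicialComplex) {src : Fin n} {s : Mem}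
    {R : Fin m → Fin m → Prop} {t : ℕ} {e : Fin m} (hin : HasInput H src s)
    (hk : s.reg .k = (H.edge e).card) (hk2 : 2 ≤ (H.edge e).card)
    (hq : s.a1 .elt (s.reg .q) = e + 1) (hT : Trie H (fun _ => True) s)
    (hC : Cheap H R s) (hR : ∀ j, H.edge e ⊆ H.edge j → R e j) :
    wp (block [
        .assign .e (eltAt .q),
        forRange .i 0 Reg.k (block [
          .assign .x (.get .sub Reg.e Reg.i),
          when (.wlt (wOf (get1 .cheap Reg.e)) (wOf (get1 .cheap Reg.x)))
            (write1 .cheap Reg.x (get1 .cheap Reg.e))])]) t s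
      fun t' s' => t' ≤ t + 3 + 5 * (H.edge e).card ∧ Cheap H (fun f j => R f j ∨
        ∃ i < (H.edge e).card, H.verts f = (H.verts e).eraseIdx i ∧ H.edge e ⊆ H.edge j) s' := by
  rw [block, wp_seq, wp_assign, block]
  simp only [eval_eltAt, hq]
  refine wp_forRange (N := (H.edge e).card) (fun i t' s' => t' = t + 2 + 5 * i ∧
    s'.reg .e = e + 1 ∧ s'.reg .k = (H.edge e).card ∧ s'.arr .sub = s.arr .sub ∧
    HasInput H src s' ∧ Cheap H (fun f j => R f j ∨
      ∃ i' < i, H.verts f = (H.verts e).eraseIdx i' ∧ H.edge e ⊆ H.edge j) s')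
    (by decide) (by simp) ?_ ?_ ?_ ?_
  · refine ⟨by simp, by simp, by simp [hk], rfl,
      (hin.setReg (by decide) _).setReg (by decide) _, hC.mono rfl ?_⟩
    rintro f j (h | ⟨i, hi, -⟩)
    · exact h
    · simp at hi
  · rintro i t' s' ⟨-, -, h, -⟩
    simp [h]
  · rintro i t1 s1 ⟨ht1, he1, hk1, hs1, hin1, hC1⟩ hi1 hi
    obtain ⟨x, hx, hxl⟩ := (hT.sub e i trivial hi).ne_nil (by
      rw [← List.length_pos_iff, List.length_eraseIdx, H.length_verts, if_pos hi]
      omega)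
    have hxe : H.edge x ⊆ H.edge e := by
      intro v hv
      rw [← H.succ_mem_verts, hxl] at hv
      exact H.succ_mem_verts.1 (List.mem_of_mem_eraseIdx hv)
    rw [block, wp_seq, wp_assign, block]
    simp only [Expr.eval_get, Expr.eval_reg, he1, hi1, hs1, hx]
    obtain ⟨ce, hce, hece⟩ := hC1.sound e
    obtain ⟨cx, hcx, hxcx⟩ := hC1.sound x
    have hle : ∀ j, H.edge e ⊆ H.edge j → H.weight ce ≤ H.weight j :=
      fun j hj => hC1.le e j ce (Or.inl (hR j hj)) hce
    have hRR : ∀ f j, (R f j ∨ ∃ i' < i + 1, H.verts f = (H.verts e).eraseIdx i' ∧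
        H.edge e ⊆ H.edge j) → (R f j ∨ ∃ i' < i, H.verts f = (H.verts e).eraseIdx i' ∧
        H.edge e ⊆ H.edge j) ∨ f = x ∧ H.edge e ⊆ H.edge j := by
      rintro f j (h | ⟨i', hi', h1, h2⟩)
      · exact Or.inl (Or.inl h)
      · rcases Nat.lt_succ_iff_lt_or_eq.1 hi' with hi' | rfl
        · exact Or.inl (Or.inr ⟨i', hi', h1, h2⟩)
        · exact Or.inr ⟨WHypergraph.verts_injective hH (h1.trans hxl.symm), h2⟩
    rw [wp_when]
    simp only [Test.holds_wlt, eval_wOf, eval_get1, Expr.eval_reg, Mem.reg_setReg, reduceCtorEq,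
      if_false, if_true, he1, Mem.a1_setReg, hce, hcx, Mem.wt_setReg, hin1.wt, ENNReal.coe_lt_coe,
      wp_write1]
    constructor
    · intro hlt
      refine ⟨by omega, by simp [he1], by simp [hk1], by simp [hs1], ?_, ?_, ?_⟩
      · refine HasInput.setReg (x := .i) (HasInput.congr (hin1.setReg (x := .x) (by decide) (x + 1))
          (s' := (s1.setReg .x (x + 1)).setArr .cheap (x + 1) 0 (ce + 1))
          (fun _ _ => rfl) (fun a ha => ?_) rfl) (by decide) _
        exact Mem.arr_setArr_ne _ (by rintro rfl; simp at ha) _ _ _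
      · intro f
        simp only [Mem.a1_setReg, Mem.a1_setArr, if_true]
        by_cases e : (f : ℕ) + 1 = x + 1
        · obtain rfl : f = x := Fin.ext (by omega)
          exact ⟨ce, Function.update_self .., hxe.trans hece⟩
        · rw [Function.update_of_ne e]
          exact hC1.sound f
      · intro f j c hf
        simp only [Mem.a1_setReg, Mem.a1_setArr, if_true]
        by_cases e : (f : ℕ) + 1 = x + 1
        · obtain rfl : f = x := Fin.ext (by omega)
          rw [Function.update_self]
          intro hc
          obtain rfl : ce = c := Fin.ext (by omega)
          rcases hRR _ _ hf with h | ⟨-, h⟩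
          · exact hlt.le.trans (hC1.le _ _ _ h hcx)
          · exact hle j h
        · rw [Function.update_of_ne e]
          refine hC1.le f j c ((hRR _ _ hf).resolve_right ?_)
          rintro ⟨rfl, -⟩
          exact e rfl
    · intro hlt
      refine ⟨by omega, by simp, by simp [hk1], by simp [hs1],
        (hin1.setReg (by decide) _).setReg (by decide) _, hC1.sound, ?_⟩
      intro f j c hf hc
      rcases hRR _ _ hf with h | ⟨rfl, h⟩
      · exact hC1.le f j c h hc
      · simp only [Mem.a1_setReg, hcx] at hc
        obtain rfl : cx = c := Fin.ext (by omega)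
        exact (not_lt.1 hlt).trans (hle j h)
  · rintro t' s' ⟨ht', -, -, -, -, hC'⟩
    exact ⟨by omega, hC'⟩

theorem alloc_cheap_step : Alloc (block [
    .assign .e (eltAt .q),
    forRange .i 0 Reg.k (block [
      .assign .x (.get .sub Reg.e Reg.i),
      when (.wlt (wOf (get1 .cheap Reg.e)) (wOf (get1 .cheap Reg.x)))
        (write1 .cheap Reg.x (get1 .cheap Reg.e))])]) :=
  .seq (.assign _ _ (by decide)) (alloc_forRange (by decide) (.seq (.assign _ _ (by decide))
    (.ite (.write _ _ _ _ (by decide) (by decide)) .skip)))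

/-- A hyperedge `j` properly above a face `f` with `K - 1` vertices contains a face `e` with `K`
vertices that arises from `f` by adding one vertex. The entry of `e` accounts for `j`, and it is
passed down to `f`. -/
theorem cheap_level_spec {H : WHypergraph n m} (hH : H.IsSimplicialComplex) {src : Fin n} {s : Mem}
    {B : ℕ → List ℕ} {g : ℕ → ℕ} {K t : ℕ} (hin : HasInput H src s) (hL : Lists .bucket B s)
    (hB : IsBuckets H B) (hg : ∀ j : Fin m, 5 + 6 * (H.edge j).card ≤ g (j + 1))
    (hk : s.reg .k = K) (hK : 2 ≤ K) (hT : Trie H (fun _ => True) s)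
    (hC : Cheap H (fun f j => f = j ∨ K ≤ (H.edge f).card ∧ H.edge f ⊆ H.edge j) s) :
    wp (forCells .q (get1 .bucket Reg.k) (block [
        .assign .e (eltAt .q),
        forRange .i 0 Reg.k (block [
          .assign .x (.get .sub Reg.e Reg.i),
          when (.wlt (wOf (get1 .cheap Reg.e)) (wOf (get1 .cheap Reg.x)))
            (write1 .cheap Reg.x (get1 .cheap Reg.e))])])) t s
      fun t' s' => t' ≤ t + 2 + ((B K).map g).sum ∧
        Cheap H (fun f j => f = j ∨ K - 1 ≤ (H.edge f).card ∧ H.edge f ⊆ H.edge j) s' := by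
  refine wp_forCells (l := B K) (fun l t' s' => ∃ d, B K = d ++ l ∧
    t' ≤ t + 1 + (d.map g).sum ∧ HasInput H src s' ∧ s'.reg .k = K ∧ Trie H (fun _ => True) s' ∧
    Cheap H (fun f j => (f = j ∨ K ≤ (H.edge f).card ∧ H.edge f ⊆ H.edge j) ∨
      ∃ e : Fin m, (e : ℕ) + 1 ∈ d ∧ ∃ i < (H.edge e).card,
        H.verts f = (H.verts e).eraseIdx i ∧ H.edge e ⊆ H.edge j) s')
    (by decide) alloc_cheap_step (by decide) ?_ ?_ ?_ ?_
  · simpa [hk] using hL K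
  · refine ⟨[], rfl, by simp, hin.setReg (by decide) _, by simp [hk],
      hT.mono rfl rfl fun _ h => h, hC.mono rfl ?_⟩
    rintro f j (h | ⟨e, he, -⟩)
    · exact h
    · simp at he
  · rintro e l t1 s1 ⟨d, hd, ht1, hin1, hk1, hT1, hC1⟩ he
    obtain ⟨j, rfl, hj⟩ := (hB K e).1 (by simp [hd])
    refine (cheap_step_spec hH hin1 (by rw [hk1, hj]) (by omega) he hT1 hC1
      fun j' hj' => Or.inl (Or.inr ⟨hj.ge, hj'⟩)).exec ?_
    rintro t' s' hE ⟨ht', hC'⟩ q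
    refine ⟨d ++ [(j : ℕ) + 1], by simp [hd], ?_, (hin1.exec hE (by decide)).setReg (by decide) _,
      ?_, hT1.mono (hE.arr_eq (by decide)) (hE.arr_eq (by decide)) fun _ h => h, hC'.mono rfl ?_⟩
    · have := hg j
      simp only [List.map_append, List.sum_append, List.map_cons, List.sum_cons, List.map_nil,
        List.sum_nil]
      omega
    · simp [hE.reg_eq (show Cmd.modReg .k _ = false by decide), hk1]
    · rintro f j' (h | ⟨e, he, h⟩)
      · exact Or.inl (Or.inl h)
      · rw [List.mem_append, List.mem_singleton] at he
        rcases he with he | he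
        · exact Or.inl (Or.inr ⟨e, he, h⟩)
        · obtain rfl : e = j := Fin.ext (by omega)
          exact Or.inr h
  · rintro t' s' ⟨d, hd, ht', -, -, -, hC'⟩
    rw [List.append_nil] at hd
    subst hd
    refine ⟨by omega, hC'.mono rfl ?_⟩
    rintro f j (h | ⟨h1, h2⟩)
    · exact Or.inl (Or.inl h)
    · by_cases h3 : K ≤ (H.edge f).card
      · exact Or.inl (Or.inr ⟨h3, h2⟩)
      · rcases h2.eq_or_ssubset with h4 | h4
        · exact Or.inl (Or.inl (hH.1 h4))
        · obtain ⟨e, he, hej, i, hi, hfe⟩ := WHypergraph.exists_eraseIdx hH h4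
          exact Or.inr ⟨e, (hB K _).2 ⟨e, rfl, by omega⟩, i, hi, hfe, hej⟩

theorem cheap_spec {H : WHypergraph n m} (hH : H.IsSimplicialComplex) {src : Fin n} {s : Mem}
    {B : ℕ → List ℕ} {g : ℕ → ℕ} {t : ℕ} (hin : HasInput H src s) (hL : Lists .bucket B s)
    (hB : IsBuckets H B) (hg : ∀ j : Fin m, 5 + 6 * (H.edge j).card ≤ g (j + 1))
    (hle : ∀ j : Fin m, (H.edge j).card ≤ s.reg .k) (hT : Trie H (fun _ => True) s)
    (hc : ∀ j : Fin m, s.a1 .cheap (j + 1) = j + 1) :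
    wp (.loop (.lt 2 Reg.k) (block [
      forCells .q (get1 .bucket Reg.k) (block [
        .assign .e (eltAt .q),
        forRange .i 0 Reg.k (block [
          .assign .x (.get .sub Reg.e Reg.i),
          when (.wlt (wOf (get1 .cheap Reg.e)) (wOf (get1 .cheap Reg.x)))
            (write1 .cheap Reg.x (get1 .cheap Reg.e))])]),
      .assign .k (Reg.k - 1)])) t s
      fun t' s' => t' ≤ t + 1 + ∑ k ∈ Finset.Icc 1 (s.reg .k), (4 + ((B k).map g).sum) ∧
        Cheap H (fun f j => 2 ≤ (H.edge f).card ∧ H.edge f ⊆ H.edge j) s' := by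
  refine wp_loop (fun k t' s' => s'.reg .k = k ∧ t' + ∑ i ∈ Finset.Icc 1 k, (4 + ((B i).map g).sum) ≤
    t + ∑ i ∈ Finset.Icc 1 (s.reg .k), (4 + ((B i).map g).sum) ∧ HasInput H src s' ∧
    Lists .bucket B s' ∧ Trie H (fun _ => True) s' ∧
    Cheap H (fun f j => f = j ∨ k ≤ (H.edge f).card ∧ H.edge f ⊆ H.edge j) s') ?_ ?_ (s.reg .k) _ _ ?_
  · rintro k t1 s1 ⟨hk1, ht1, hin1, hL1, hT1, hC1⟩ hb
    simp only [Test.holds_lt, Expr.eval_two, Expr.eval_reg, hk1] at hb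
    rw [block, wp_seq, block]
    refine (cheap_level_spec hH hin1 hL1 hB hg hk1 hb.le hT1 hC1).exec ?_
    rintro t' s' hE ⟨ht', hC'⟩
    rw [wp_assign]
    have hk' : s'.reg .k = k := (hE.reg_eq (by decide)).trans hk1
    obtain ⟨k, rfl⟩ : ∃ i, k = i + 1 := ⟨k - 1, by omega⟩
    rw [Finset.sum_Icc_succ_top (by omega)] at ht1
    refine ⟨k, by omega, by simp [hk'], by omega, (hin1.exec hE (by decide)).setReg (by decide) _,
      (hL1.exec hE (alloc_forCells (by decide) alloc_cheap_step) (by decide)).congr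
        (Mem.extends_setReg _ (by decide) _) rfl,
      hT1.mono (hE.arr_eq (by decide)) (hE.arr_eq (by decide)) fun _ h => h,
      hC'.mono rfl fun _ _ h => h⟩
  · rintro k t1 s1 ⟨hk1, ht1, -, -, -, hC1⟩ hb
    simp only [Test.holds_lt, Expr.eval_two, Expr.eval_reg, hk1] at hb
    exact ⟨by omega, hC1.mono rfl fun f j h => Or.inr ⟨by omega, h.2⟩⟩
  · refine ⟨rfl, le_rfl, hin, hL, hT, fun f => ⟨f, hc f, Finset.Subset.refl _⟩, ?_⟩
    rintro f j c h hfc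
    obtain rfl : f = c := Fin.ext (by have := hc f; omega)
    rcases h with rfl | ⟨h1, h2⟩
    · exact le_rfl
    -- Initially `k` is the largest cardinality, so a face with at least `k` vertices is contained
    -- in no other hyperedge.
    · rw [hH.1 (Finset.eq_of_subset_of_card_le h2 ((hle j).trans h1))]

/-- The underlying graph is read off from the faces with two vertices. -/
theorem graph_of_cheap_spec {H : WHypergraph n m} (hH : H.IsSimplicialComplex) {src : Fin n}
    {s : Mem} {B : ℕ → List ℕ} {t : ℕ} (hin : HasInput H src s) (hL : Lists .bucket B s)
    (hB : IsBuckets H B) (hadj : ∀ x, s.a1 .adj x = 0) (hbest : ∀ x y, s.arr .best x y = 0)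
    (hC : Cheap H (fun f j => 2 ≤ (H.edge f).card ∧ H.edge f ⊆ H.edge j) s) :
    wp (forCells .q (get1 .bucket 2) (block [
        .assign .e (eltAt .q),
        .assign .x (.get .vert Reg.e 0),
        .assign .y (.get .vert Reg.e 1),
        .write .best Reg.x Reg.y (get1 .cheap Reg.e),
        .write .best Reg.y Reg.x (get1 .cheap Reg.e),
        push .adj Reg.x Reg.y,
        push .adj Reg.y Reg.x])) t s
      fun t' s' => t' = t + 2 + 15 * (B 2).length ∧ HasInput H src s' ∧
        ∃ L, Graph H s' L (fun j x y => x ∈ H.verts j ∧ y ∈ H.verts j) ∧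
          ∑ x ∈ Finset.Icc 1 n, (L x).length = 2 * (B 2).length := by
  refine wp_forCells (l := B 2) (fun l t' s' => ∃ d, B 2 = d ++ l ∧
    t' = t + 1 + 15 * d.length ∧ HasInput H src s' ∧ s'.a1 .cheap = s.a1 .cheap ∧
    ∃ L, Graph H s' L (fun j x y => ∃ e : Fin m, (e : ℕ) + 1 ∈ d ∧ H.edge e ⊆ H.edge j ∧
        x ∈ H.verts e ∧ y ∈ H.verts e) ∧
      ∑ x ∈ Finset.Icc 1 n, (L x).length = 2 * d.length)
    (by decide) ?_ (by decide) (hL 2) ?_ ?_ ?_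
  · exact .seq (.assign _ _ (by decide)) (.seq (.assign _ _ (by decide)) (.seq (.assign _ _ (by decide))
      (.seq (.write _ _ _ _ (by decide) (by decide)) (.seq (.write _ _ _ _ (by decide) (by decide))
      (.seq (.push _ _ _ rfl rfl (by decide) (by decide))
        (.push _ _ _ rfl rfl (by decide) (by decide)))))))
  · refine ⟨[], rfl, by simp, hin.setReg (by decide) _, rfl, fun _ => [],
      ⟨?_, by simp [hbest], by simp [hbest], by simp⟩, by simp⟩
    intro x
    simp [hadj]
  · rintro e l t1 s1 ⟨d, hd, ht1, hin1, hc1, L, hG, hs⟩ he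
    obtain ⟨e, rfl, hcard⟩ := (hB 2 e).1 (by simp [hd])
    obtain ⟨x, y, hxy⟩ : ∃ x y, H.verts e = [x, y] := by
      rw [← List.length_eq_two, H.length_verts, hcard]
    have hmem : ∀ u, u ∈ H.verts e → u ∈ Finset.Icc 1 n := by
      intro u hu
      obtain ⟨v, hv, rfl⟩ := H.mem_verts.1 hu
      rw [Finset.mem_Icc]
      omega
    have hxe : x ∈ H.verts e := by simp [hxy]
    have hye : y ∈ H.verts e := by simp [hxy]
    have hne : x ≠ y := by
      have := H.nodup_verts e
      rw [hxy] at this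
      simpa using this
    obtain ⟨c, hc, hec⟩ := hC.sound e
    have hsub : ∀ j, H.edge e ⊆ H.edge j → ∀ u ∈ H.verts e, u ∈ H.verts j := by
      intro j hj u hu
      obtain ⟨v, hv, rfl⟩ := H.mem_verts.1 hu
      exact H.succ_mem_verts.2 (hj hv)
    simp only [block, wp_seq, wp_assign, wp_write]
    rw [wp_push rfl rfl (by decide), wp_push rfl rfl (by decide)]
    simp only [eval_eltAt, he, Expr.eval_get, Expr.eval_reg, Expr.eval_zero, Expr.eval_one,
      Mem.reg_setReg, Mem.arr_setReg, Mem.a1_setReg, Mem.reg_setArr, Mem.reg_pushed, eval_get1,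
      reduceCtorEq, if_false, if_true, hin1.vert, hxy, List.getD_cons_zero, List.getD_cons_succ,
      Mem.a1_setArr_ne _ (show Arr.cheap ≠ .best by decide), hc1, hc]
    set s2 := (((s1.setReg .e (e + 1)).setReg .x x).setReg .y y) with hs2
    set s3 := (s2.setArr .best x y (c + 1)).setArr .best y x (c + 1) with hs3
    set s4 := (s3.pushed .adj x y).pushed .adj y x with hs4
    set L4 := Function.update (Function.update L x (y :: L x)) y (x :: L y) with hL4
    have hx3 : Extends s1 s3 := (((((s1.extends_setReg (by decide) _).trans
      (Mem.extends_setReg _ (by decide) _)).trans (Mem.extends_setReg _ (by decide) _)).trans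
      (Mem.extends_setArr _ (by decide) (by decide) _ _ _))).trans
      (Mem.extends_setArr _ (by decide) (by decide) _ _ _)
    have hl4 : Lists .adj L4 s4 := by
      have := ((hG.lists.congr hx3 (by simp [hs3, hs2])).pushed x y (by decide) (by decide)).pushed
        y x (by decide) (by decide)
      rwa [Function.update_of_ne hne.symm] at this
    have hr4 : ∀ q, q ≠ .e → q ≠ .x → q ≠ .y → q ≠ .cell → s4.reg q = s1.reg q :=
      fun q h1 h2 h3 h4 => by simp [hs4, hs3, hs2, h1, h2, h3, h4]
    have ha4 : ∀ a, a ≠ .best → a ≠ .adj → a ≠ .elt → a ≠ .nxt → s4.arr a = s1.arr a :=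
      fun a h1 h2 h3 h4 => by simp [hs4, hs3, hs2, h1, h2, h3, h4]
    have hb4 : ∀ u v, s4.arr .best u v =
        if u = x ∧ v = y ∨ u = y ∧ v = x then (c : ℕ) + 1 else s1.arr .best u v := by
      intro u v
      simp only [hs4, Mem.arr_pushed _ _ _ (show Arr.best ≠ .adj by decide)
        (show Arr.best ≠ .elt by decide) (show Arr.best ≠ .nxt by decide), hs3,
        Mem.arr_setArr_apply, hs2, Mem.arr_setReg]
      split_ifs <;> first | rfl | tauto
    have hmem4 : ∀ u v, v ∈ L4 u ↔ (u = x ∧ v = y ∨ u = y ∧ v = x) ∨ v ∈ L u := by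
      intro u v
      rw [hL4]
      by_cases e1 : u = y
      · subst e1
        simp [hne.symm]
      · rw [Function.update_of_ne e1]
        by_cases e2 : u = x
        · subst e2
          simp [hne]
        · simp [e1, e2]
    have hsum : ∑ u ∈ Finset.Icc 1 n, (L4 u).length = 2 * d.length + 2 := by
      have h1 := sum_length_update (hmem x hxe) L (y :: L x)
      have h2 := sum_length_update (hmem y hye) (Function.update L x (y :: L x)) (x :: L y)
      rw [Function.update_of_ne hne.symm, ← hL4] at h2
      simp only [List.length_cons] at h1 h2
      omega
    have hw4 : s4.wt = s1.wt := rfl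
    clear_value s4 L4
    intro q
    refine ⟨d ++ [(e : ℕ) + 1], by simp [hd], by simp; omega, HasInput.setReg (x := .q)
      (hin1.congr (fun r hr => hr4 r ?_ ?_ ?_ ?_) (fun a ha => ha4 a ?_ ?_ ?_ ?_) (by rw [hw4]))
      (by decide) _, ?_, L4, ?_, by simp [hsum]; ring⟩
    iterate 4 (rintro rfl; simp at hr)
    iterate 4 (rintro rfl; simp at ha)
    · rw [← hc1]
      unfold Mem.a1
      rw [ha4 _ (by decide) (by decide) (by decide) (by decide)]
    · refine Graph.mono (s := s4) ⟨hl4, ?_, ?_, ?_⟩ (Mem.extends_setReg _ (by decide) _) rfl rfl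
        fun _ _ _ h _ => h
      · intro u v
        rw [hmem4, hb4, hG.mem]
        split_ifs with h <;> simp [h]
      · intro u v
        rw [hb4]
        split_ifs with h
        · rintro -
          refine ⟨c, rfl, hsub c hec _ ?_, hsub c hec _ ?_⟩ <;>
            rcases h with ⟨rfl, rfl⟩ | ⟨rfl, rfl⟩ <;> assumption
        · exact hG.best u v
      · rintro j u v ⟨f, hf, hfj, hu, hv⟩ huv
        rw [hb4]
        split_ifs with h
        · refine ⟨by omega, fun j' hj' => ?_⟩
          obtain rfl : c = j' := Fin.ext (by omega)
          refine hC.le e j c ⟨hcard.ge, ?_⟩ hc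
          refine Finset.Subset.trans ?_ hfj
          intro w hw
          rw [← H.succ_mem_verts, hxy] at hw
          rw [← H.succ_mem_verts]
          simp only [List.mem_cons, List.not_mem_nil, or_false] at hw
          rcases h with ⟨rfl, rfl⟩ | ⟨rfl, rfl⟩ <;> rcases hw with hw | hw <;> rwa [hw]
        · refine hG.le j u v ⟨f, ?_, hfj, hu, hv⟩ huv
          rw [List.mem_append, List.mem_singleton] at hf
          refine hf.resolve_right fun hf => h ?_
          obtain rfl : f = e := Fin.ext (by omega)
          rw [hxy] at hu hv
          simp only [List.mem_cons, List.not_mem_nil, or_false] at hu hv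
          rcases hu with rfl | rfl <;> rcases hv with rfl | rfl <;> simp at huv ⊢
  · rintro t' s' ⟨d, hd, ht', hin', -, L, hG, hs⟩
    rw [List.append_nil] at hd
    subst hd
    refine ⟨by omega, hin', L, hG.mono (.refl _) rfl rfl ?_, hs⟩
    rintro j x y ⟨hx, hy⟩ hne
    obtain ⟨u, hu, rfl⟩ := H.mem_verts.1 hx
    obtain ⟨v, hv, rfl⟩ := H.mem_verts.1 hy
    have huv : u ≠ v := by rintro rfl; exact hne rfl
    have hsub : ({u, v} : Finset (Fin n)) ⊆ H.edge j :=
      Finset.insert_subset hu (Finset.singleton_subset_iff.2 hv)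
    -- In a simplicial complex every pair of vertices of a hyperedge is itself a face, so all edges
    -- of the graph are found in the bucket of cardinality `2`.
    obtain ⟨e, he⟩ := (hH.2 ⟨j, rfl⟩).2 (show ({u, v} : Finset (Fin n)) ≤ H.edge j from hsub)
      (Finset.insert_nonempty _ _)
    refine ⟨e, (hB 2 _).2 ⟨e, rfl, by rw [he, Finset.card_pair huv]⟩, he ▸ hsub, ?_, ?_⟩ <;>
      rw [H.succ_mem_verts, he] <;> simp

/-- Sorting, trie and top-down pass each spend `O(|e|)` on a face `e`, apart from `O(1)` for each
bucket. Every face with two vertices gives two adjacency entries, so the graph has size `O(∑ |e|)`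
as well. -/
theorem drspTopDown_spec {H : WHypergraph n m} (hH : H.IsSimplicialComplex) (hn : 2 ≤ n)
    (src : Fin n) :
    ∃ t s', Exec drspTopDown (input H src) t s' ∧
      t ≤ 280 * (n * Nat.log 2 n) + 1000 * n + 10000 * ∑ j, (H.edge j).card ∧
      ∀ v : Fin n, v ≠ src → s'.wt .D (v + 1) = H.dist src v := by
  suffices h : wp drspTopDown 0 (input H src) fun t s' =>
      t ≤ 280 * (n * Nat.log 2 n) + 1000 * n + 10000 * ∑ j, (H.edge j).card ∧
      ∀ v : Fin n, v ≠ src → s'.wt .D (v + 1) = H.dist src v by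
    obtain ⟨t, s', hE, h1, h2⟩ := h
    exact ⟨t, s', hE, by omega, h2⟩
  set g : ℕ → ℕ := fun e => 10 + 10 * (input H src).a1 .card e with hgdef
  have hin0 := hasInput_input H src
  have hg : ∀ j : Fin m, g (j + 1) = 10 + 10 * (H.edge j).card := fun j => by
    simp only [hgdef, hin0.card]
  have hg' : ∀ j : Fin m, 5 + 6 * (H.edge j).card ≤ g (j + 1) := fun j => by
    rw [hg]
    omega
  unfold drspTopDown
  rw [block, wp_seq, block]
  have hgraph : wp underlyingGraphTopDown 0 (input H src) fun t s' => HasInput H src s' ∧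
      t ≤ 20 * n + 100 * ∑ j, (H.edge j).card ∧
      ∃ L, Graph H s' L (fun j x y => x ∈ H.verts j ∧ y ∈ H.verts j) ∧
        ∑ x ∈ Finset.Icc 1 n, (L x).length ≤ 2 * ∑ j, (H.edge j).card := by
    unfold underlyingGraphTopDown
    rw [block, wp_seq, wp_assign, block, wp_seq]
    refine (buckets_spec g (hin0.setReg (by decide) _) (fun _ => rfl) (by simp)).exec ?_
    rintro t1 s1 hE1 ⟨ht1, hin1, B, hL1, hB, hsum, hc1, hle, hsize⟩
    rw [block, wp_seq]
    refine (trie_spec hH hin1 hL1 hB hg' hle).exec ?_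
    rintro t2 s2 hE2 ⟨ht2, hT2⟩
    have hin2 := hin1.exec hE2 (by decide)
    have hsize2 : s2.reg .size = s1.reg .size := hE2.reg_eq (by decide)
    have hL2 : Lists .bucket B s2 := hL1.exec hE2 (alloc_forRange (by decide) (alloc_forCells (by decide) alloc_face_step)) (by decide)
    rw [block, wp_seq, wp_assign, block, wp_seq]
    simp only [Expr.eval_reg, hsize2]
    refine (cheap_spec hH (hin2.setReg (by decide) _)
      (hL2.congr (Mem.extends_setReg _ (by decide) _) rfl) hB hg' (by simpa using hle)
      (hT2.mono rfl rfl fun _ h => h) ?_).exec ?_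
    · rw [Mem.a1_setReg, hE2.a1_eq (by decide)]
      exact hc1
    rintro t3 s3 hE3 ⟨ht3, hC3⟩
    rw [block]
    refine (graph_of_cheap_spec hH ((hin2.setReg (by decide) _).exec hE3 (by decide))
      ((hL2.congr (Mem.extends_setReg _ (by decide) _) rfl).exec hE3 (.loop (.seq (alloc_forCells (by decide) alloc_cheap_step)
        (.assign _ _ (by decide)))) (by decide)) hB ?_
      ?_ hC3).mono ?_
    · intro x
      rw [hE3.a1_eq (by decide), Mem.a1_setReg, hE2.a1_eq (by decide), hE1.a1_eq (by decide)]
      rfl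
    · intro x y
      rw [hE3.arr_eq (by decide), Mem.arr_setReg, hE2.arr_eq (by decide), hE1.arr_eq (by decide)]
      rfl
    · rintro t4 s4 ⟨ht4, hin4, L, hG, hs⟩
      simp only [Mem.reg_setReg, if_true] at ht3
      have hmc : m ≤ ∑ j, (H.edge j).card := by
        calc m = ∑ _j : Fin m, 1 := by simp
          _ ≤ _ := Finset.sum_le_sum fun j _ => (H.edge_nonempty j).card_pos
      have hsumle : ∑ k ∈ Finset.Icc 1 (s1.reg .size), (4 + ((B k).map g).sum) ≤
          4 * n + 20 * ∑ j, (H.edge j).card := by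
        calc _ ≤ ∑ k ∈ Finset.Icc 1 n, (4 + ((B k).map g).sum) :=
              Finset.sum_le_sum_of_subset (Finset.Icc_subset_Icc_right hsize)
          _ = 4 * n + (10 * m + 10 * ∑ j, (H.edge j).card) := by
              rw [Finset.sum_add_distrib, hsum]
              simp [hg, Finset.sum_add_distrib, Finset.mul_sum, mul_comm]
          _ ≤ _ := by omega
      have hB2 : (B 2).length ≤ ∑ j, (H.edge j).card := by
        have h1 : ((B 2).map g).sum ≤ ∑ x ∈ Finset.Icc 1 n, ((B x).map g).sum :=
          Finset.single_le_sum (f := fun x => ((B x).map g).sum) (fun _ _ => Nat.zero_le _)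
            -- The sum runs over the cardinalities `1, …, n`, and contains the bucket of cardinality
            -- `2` because `2 ≤ n`.
            (Finset.mem_Icc.2 ⟨by omega, hn⟩)
        have h2 : (B 2).length * 20 ≤ ((B 2).map g).sum := by
          have := List.card_nsmul_le_sum ((B 2).map g) 20 ?_
          · simpa using this
          · intro a ha
            obtain ⟨e, he, rfl⟩ := List.mem_map.1 ha
            obtain ⟨j, rfl, hj⟩ := (hB 2 e).1 he
            rw [hg]
            omega
        have h3 : ∑ j : Fin m, g (j + 1) = 10 * m + 10 * ∑ j, (H.edge j).card := by
          simp [hg, Finset.sum_add_distrib, Finset.mul_sum, mul_comm]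
        omega
      exact ⟨hin4, by omega, L, hG, by omega⟩
  refine hgraph.exec ?_
  rintro t1 s1 hE1 ⟨hin1, ht1, L, hG, hs⟩
  have hfresh1 : Fresh s1 := by
    refine ⟨fun a ha x => ?_, (hE1.reg_eq (by decide)).trans rfl⟩
    simp only [List.mem_cons, List.not_mem_nil, or_false] at ha
    rcases ha with rfl | rfl | rfl | rfl | rfl | rfl | rfl <;>
      exact congrFun (hE1.a1_eq (by decide)) x
  refine (dijkstra_spec hin1 hfresh1 hG).mono ?_
  rintro t2 s2 ⟨ht2, hD⟩
  exact ⟨by omega, hD⟩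

end RAM

/-! ### Counting the faces of a simplicial complex -/

namespace WHypergraph

variable {n m : ℕ} (H : WHypergraph n m)

theorem exists_facet (j : Fin m) : ∃ F ∈ H.facets, H.edge j ⊆ F := by
  obtain ⟨F, hjF, hF⟩ := (Set.finite_range H.edge).exists_le_maximal ⟨j, rfl⟩
  exact ⟨F, by simpa [facets] using hF, hjF⟩

theorem card_facet_le {F : Finset (Fin n)} (hF : F ∈ H.facets) : F.card ≤ H.dim + 1 := by
  have : F.card - 1 ≤ H.dim := Finset.le_sup (f := fun F : Finset (Fin n) => F.card - 1) hF
  omega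

theorem card_edge_le (j : Fin m) : (H.edge j).card ≤ H.dim + 1 := by
  obtain ⟨F, hF, hjF⟩ := H.exists_facet j
  exact (Finset.card_le_card hjF).trans (H.card_facet_le hF)

variable {H}

/-- Every face is a subset of a facet, and a facet has at most `2 ^ (dim + 1)` subsets. -/
theorem card_edges_le (hH : H.IsSimplicialComplex) : m ≤ H.facets.card * 2 ^ (H.dim + 1) := by
  have h1 : (Finset.univ.image H.edge).card = m := by
    rw [Finset.card_image_of_injective _ hH.1, Finset.card_univ, Fintype.card_fin]
  have h2 : Finset.univ.image H.edge ⊆ H.facets.biUnion Finset.powerset := by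
    intro T hT
    obtain ⟨j, -, rfl⟩ := Finset.mem_image.1 hT
    obtain ⟨F, hF, hjF⟩ := H.exists_facet j
    exact Finset.mem_biUnion.2 ⟨F, hF, Finset.mem_powerset.2 hjF⟩
  calc m = (Finset.univ.image H.edge).card := h1.symm
    _ ≤ _ := Finset.card_le_card h2
    _ ≤ _ := Finset.card_biUnion_le_card_mul _ _ _ fun F hF => by
      rw [Finset.card_powerset]
      exact Nat.pow_le_pow_right (by norm_num) (H.card_facet_le hF)

theorem card_edges_le_of_dim_eq_zero (hH : H.IsSimplicialComplex) (hd : H.dim = 0) : m ≤ n := by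
  have h1 : (Finset.univ.image H.edge).card = m := by
    rw [Finset.card_image_of_injective _ hH.1, Finset.card_univ, Fintype.card_fin]
  have h2 : Finset.univ.image H.edge ⊆ Finset.univ.powersetCard 1 := by
    intro T hT
    obtain ⟨j, -, rfl⟩ := Finset.mem_image.1 hT
    have := H.card_edge_le j
    have := (H.edge_nonempty j).card_pos
    exact Finset.mem_powersetCard.2 ⟨Finset.subset_univ _, by omega⟩
  have h3 := Finset.card_le_card h2
  simpa [h1] using h3

/-- Bound each term by `(dim + 1) ^ p ≤ (2 * dim) ^ p` if `dim` is positive. In dimension `0` the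
product may vanish, but then the faces are distinct single vertices, which accounts for the summand
`n`. It is used with `p = 2` for Gallo's algorithm and `p = 1` for the top-down variant. -/
theorem sum_card_pow_le (hH : H.IsSimplicialComplex) (p : ℕ) :
    ∑ j, (H.edge j).card ^ p ≤ n + 2 ^ (p + 1) * (H.dim ^ p * 2 ^ H.dim * H.facets.card) := by
  have h1 : ∑ j, (H.edge j).card ^ p ≤ m * (H.dim + 1) ^ p := by
    calc _ ≤ ∑ _j : Fin m, (H.dim + 1) ^ p :=
          Finset.sum_le_sum fun j _ => Nat.pow_le_pow_left (H.card_edge_le j) p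
      _ = _ := by simp
  rcases Nat.eq_zero_or_pos H.dim with hd | hd
  · have h2 := card_edges_le_of_dim_eq_zero hH hd
    rw [hd] at h1
    simp only [zero_add, one_pow, mul_one] at h1
    omega
  · calc _ ≤ m * (H.dim + 1) ^ p := h1
      _ ≤ (H.facets.card * 2 ^ (H.dim + 1)) * (2 * H.dim) ^ p :=
          Nat.mul_le_mul (card_edges_le hH) (Nat.pow_le_pow_left (by omega) p)
      _ = 2 ^ (p + 1) * (H.dim ^ p * 2 ^ H.dim * H.facets.card) := by ring
      _ ≤ _ := Nat.le_add_left _ _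

variable (H)

/-- The hyperedges cover the vertices; this absorbs the linear terms for general hypergraphs. -/
theorem card_le_Phi : n ≤ H.Phi := by
  have h : (Finset.univ : Finset (Fin n)) ⊆ Finset.univ.biUnion H.edge := by
    intro v _
    obtain ⟨j, hj⟩ := H.edge_cover v
    exact Finset.mem_biUnion.2 ⟨j, Finset.mem_univ _, hj⟩
  calc n = (Finset.univ : Finset (Fin n)).card := by simp
    _ ≤ _ := Finset.card_le_card h
    _ ≤ _ := Finset.card_biUnion_le
    _ ≤ _ := Finset.sum_le_sum fun j _ => Nat.le_self_pow (by norm_num) _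

end WHypergraph

/-! ### Passage to natural logarithms and the final constants -/

theorem natLog_two_le (n : ℕ) : (Nat.log 2 n : ℝ) ≤ 2 * Real.log n := by
  have h : (Nat.log 2 n : ℝ) ≤ Real.logb 2 n := by exact_mod_cast Real.natLog_le_logb n 2
  have h2 := Real.log_two_gt_d9
  have h0 : 0 ≤ Real.log n := Real.log_natCast_nonneg n
  rw [Real.logb, le_div_iff₀ (by linarith)] at h
  have h3 : (0 : ℝ) ≤ Nat.log 2 n := Nat.cast_nonneg _
  nlinarith

/-- For simplicial complexes the linear terms are absorbed by `n * log n`, which fails for `n = 1`.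
-/
theorem le_two_mul_log {n : ℕ} (hn : 2 ≤ n) : (n : ℝ) ≤ 2 * (n * Real.log n) := by
  have h1 : Real.log 2 ≤ Real.log n := Real.log_le_log (by norm_num) (by exact_mod_cast hn)
  have h2 := Real.log_two_gt_d9
  have h3 : (0 : ℝ) ≤ n := Nat.cast_nonneg n
  nlinarith

theorem RAM.SolvesWithin.of_le {n m : ℕ} {c : RAM.Cmd} {H : WHypergraph n m} {s : Fin n} {T : ℕ}
    {U : ℝ} (h : ∃ t s', RAM.Exec c (RAM.input H s) t s' ∧ t ≤ T ∧
      ∀ v : Fin n, v ≠ s → s'.wt .D (v + 1) = H.dist s v) (hU : (T : ℝ) ≤ U) :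
    RAM.SolvesWithin c H s U := by
  obtain ⟨t, s', hE, ht, hD⟩ := h
  exact ⟨t, s', hE, le_trans (by exact_mod_cast ht) hU, hD⟩

theorem mainTheorem5 :
    ∃ C : ℝ,
      (∀ (n k : ℕ) (H : WHypergraph n k) (s : Fin n),
        RAM.SolvesWithin RAM.gallo H s (C * (n * Real.log n + H.Phi)) ∧
        RAM.SolvesWithin RAM.drsp H s (C * (n * Real.log n + H.Phi))) ∧
      (∀ (n k : ℕ) (H : WHypergraph n k) (s : Fin n), 2 ≤ n → H.IsSimplicialComplex →
        RAM.SolvesWithin RAM.gallo H s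
          (C * (n * Real.log n + H.dim ^ 2 * 2 ^ H.dim * H.facets.card)) ∧
        RAM.SolvesWithin RAM.drspTopDown H s
          (C * (n * Real.log n + H.dim * 2 ^ H.dim * H.facets.card))) := by
  have hlog : ∀ n : ℕ, (n : ℝ) * Nat.log 2 n ≤ 2 * (n * Real.log n) ∧
      0 ≤ (n : ℝ) * Real.log n := by
    intro n
    have h0 : (0 : ℝ) ≤ n := Nat.cast_nonneg n
    refine ⟨?_, mul_nonneg h0 (Real.log_natCast_nonneg n)⟩
    have := mul_le_mul_of_nonneg_left (natLog_two_le n) h0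
    linarith
  -- The largest coefficient that arises is `40000 = 10000 * 4`, at `dim * 2 ^ dim * m` in the last
  -- bound.
  refine ⟨100000, fun n k H s => ⟨?_, ?_⟩, fun n k H s hn hH => ⟨?_, ?_⟩⟩
  · refine .of_le (RAM.gallo_spec H s) ?_
    have h1 : (n : ℝ) ≤ H.Phi := by exact_mod_cast H.card_le_Phi
    obtain ⟨h2, h3⟩ := hlog n
    have h4 : (0 : ℝ) ≤ n := Nat.cast_nonneg n
    push_cast
    linarith
  · refine .of_le (RAM.drsp_spec H s) ?_
    have h1 : (n : ℝ) ≤ H.Phi := by exact_mod_cast H.card_le_Phi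
    obtain ⟨h2, h3⟩ := hlog n
    have h4 : (0 : ℝ) ≤ n := Nat.cast_nonneg n
    push_cast
    linarith
  · refine .of_le (RAM.gallo_spec H s) ?_
    have h1 : (H.Phi : ℝ) ≤ n + 8 * (H.dim ^ 2 * 2 ^ H.dim * H.facets.card) := by
      exact_mod_cast WHypergraph.sum_card_pow_le hH 2
    obtain ⟨h2, h3⟩ := hlog n
    have h4 := le_two_mul_log hn
    have h5 : (0 : ℝ) ≤ H.dim ^ 2 * 2 ^ H.dim * H.facets.card := by positivity
    generalize (H.dim : ℝ) ^ 2 * 2 ^ H.dim * H.facets.card = X at *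
    push_cast at h1 ⊢
    linarith
  · refine .of_le (RAM.drspTopDown_spec hH hn s) ?_
    have h1 : ((∑ j, (H.edge j).card : ℕ) : ℝ) ≤
        n + 4 * (H.dim * 2 ^ H.dim * H.facets.card) := by
      have := WHypergraph.sum_card_pow_le hH 1
      simp only [pow_one] at this
      exact_mod_cast this
    obtain ⟨h2, h3⟩ := hlog n
    have h4 := le_two_mul_log hn
    have h5 : (0 : ℝ) ≤ H.dim * 2 ^ H.dim * H.facets.card := by positivity
    generalize (H.dim : ℝ) * 2 ^ H.dim * H.facets.card = X at *
    rw [Nat.cast_add, Nat.cast_add, Nat.cast_mul 10000]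
    push_cast at h1 ⊢
    linarith
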